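/- **Setting.** PPT means probabilistic polynomial time (uniform); a function is negligible if it is asymptotically smaller than $1/p(n)$ for every polynomial $p$. The running time of a PPT oracle algorithm is bounded by a polynomial in its input length and the maximal length of a single oracle reply. A *symmetric-key encryption scheme* $\Pi=(\mathsf{KeyGen},\mathsf{Enc},\mathsf{Dec})$ consists of three PPT algorithms, with plaintext space $\{0,1\}^{\ell(n)}$ for a polynomially bounded $\ell$, ciphertexts that are bit strings, and $\mathsf{Dec}_k$ returning a plaintext or $\bot$, such that for some negligible $\varepsilon$ one has $\Pr[\mathsf{Dec}_k(\mathsf{Enc}_k(m))=m]\ge 1-\varepsilon(n)$ for all $n$, all $k$ in the support of $\mathsf{KeyGen}(1^n)$ and all $m\in\{0,1\}^{\ell(n)}$. In every experiment below $k\leftarrow\mathsf{KeyGen}(1^n)$, the PPT adversary $\mathcal A$ gets $1^n$ and oracles, and $L$ is the list of all ciphertexts returned by its encryption oracle. Encryption queries that are not in $\{0,1\}^{\ell(n)}$ are answered by $\bot$. Write $\mathsf{Enc}_k(\$)$ for the oracle that replies to each query with an encryption of a fresh uniformly random plaintext. * $\mathsf{UF}$: for every PPT $\mathcal A$, $\bigl|\Pr[\mathsf{UF\text{-}Forge}\to\mathsf{win}]-\Pr[\mathsf{UF\text{-}Cheat}\to\mathsf{cheat}]\bigr|$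 is negligible. In $\mathsf{UF\text{-}Forge}$, $\mathcal A^{\mathsf{Enc}_k}(1^n)$ outputs $c$, and the result is $\mathsf{win}$ iff $\mathsf{Dec}_k(c)\ne\bot$. In $\mathsf{UF\text{-}Cheat}$, $\mathcal A^{\mathsf{Enc}_k(\$)}(1^n)$ outputs $c$, and the result is $\mathsf{cheat}$ iff $c\in L$. * $\mathsf{IND\text{-}CPA}$: for every PPT $\mathcal A$, the probabilities that $\mathcal A$ outputs $1$ with the left-or-right oracle $(m_0,m_1)\mapsto\mathsf{Enc}_k(m_b)$ for $b=0$ and for $b=1$ differ by a negligible function (a query is answered by $\bot$ unless $m_0,m_1\in\{0,1\}^{\ell(n)}$). * $\mathsf{INT\text{-}CTXT}$: for every PPT $\mathcal A$, the probability that $\mathcal A^{\mathsf{Enc}_k}(1^n)$ outputs some $c\notin L$ with $\mathsf{Dec}_k(c)\neq\bot$ is negligible. * $\mathsf{AE}$: $\mathsf{IND\text{-}CPA}$ and $\mathsf{INT\text{-}CTXT}$. * $\mathsf{IND\text{-}CCA3}$ (the real/ideal form of $\mathsf{AE}$): for every PPT $\mathcal A$, the probabilities that $\mathcal A$ outputs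 $1$ in the following two worlds differ by a negligible function. Real: oracles $\mathsf{Enc}_k$ and $\mathsf{Dec}_k$, where decryption queries on elements of the current list $L$ are answered by $\bot$. Ideal: oracles $\mathsf{Enc}_k(\$)$ and the constant $\bot$. **Theorem.** For every symmetric-key encryption scheme $\Pi$, $$\Pi\text{ is }\mathsf{UF}\iff\Pi\text{ is }\mathsf{AE},\qquad\text{and}\qquad \Pi\text{ is }\mathsf{UF}\iff\Pi\text{ is }\mathsf{IND\text{-}CCA3}.$$ -/

import Mathlib

open Filter

/-! ### Probabilistic oracle programs with a step count

Algorithms are programs over registers `0, 1, 2, …`, each holding a finite stack of bits. A program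
mentions finitely many registers, its elementary instructions act on the top bit of one stack, and
the number of passes through a loop is the height of a stack on entry to the loop. Programs always
terminate, and, up to polynomial overhead, those with a polynomial step bound are the
polynomial-time probabilistic (oracle) Turing machines: such a machine is simulated by a loop over
a clock of polynomial height, whose body performs one step of the machine. -/

/-- Programs with oracles named by `ι`. -/
inductive Prog (ι : Type) : Type
  /-- do nothing -/
  | skip : Prog ι
  /-- push the bit `b` on register `x` -/
  | push (x : ℕ) (b : Bool) : Prog ι
  /-- remove the top bit of register `x`, if there is one -/
  | pop (x : ℕ) : Prog ι
  /-- push a fresh uniformly random bit on register `x` -/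
  | flip (x : ℕ) : Prog ι
  /-- query oracle `o` on the contents of `x` and `y`, and replace `z` by the reply -/
  | call (o : ι) (x y z : ℕ) : Prog ι
  /-- run `c`, then `d` -/
  | seq (c d : Prog ι) : Prog ι
  /-- run `e`, `f` or `t` if `x` is empty, has top bit `false`, or has top bit `true` -/
  | cases (x : ℕ) (e f t : Prog ι) : Prog ι
  /-- run `c` as many times as `x` has bits on entry to the loop -/
  | loop (x : ℕ) (c : Prog ι) : Prog ι

/-- A probabilistic oracle with internal states in `σ`: from a state, the name of the oracle and
two query strings it produces a reply and the next state. -/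
abbrev Oracle (ι σ : Type) : Type :=
  σ → ι → List Bool → List Bool → PMF (List Bool × σ)

/-- Register contents, state of the oracle, and number of steps performed so far. -/
structure Config (σ : Type) : Type where
  store : ℕ → List Bool
  oracle : σ
  time : ℕ

namespace Config

variable {σ : Type}

/-- Count one step. -/
def tick (s : Config σ) : Config σ := { s with time := s.time + 1 }

/-- Replace the contents of register `x` by `w`, in one step. -/
def set (s : Config σ) (x : ℕ) (w : List Bool) : Config σ :=
  { s with store := Function.update s.store x w, time := s.time + 1 }

/-- Initial configuration: the inputs are in registers `0, 1, …`; all others are empty. -/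
def init (inputs : List (List Bool)) (s₀ : σ) : Config σ where
  store := fun x => inputs.getD x []
  oracle := s₀
  time := 0

/-- The output is what register `0` contains. -/
def out (s : Config σ) : List Bool := s.store 0

end Config

namespace Prog

variable {ι σ : Type}

/-- Semantics: every elementary instruction, every test and every pass through a loop is one
step. -/
noncomputable def run (O : Oracle ι σ) : Prog ι → Config σ → PMF (Config σ)
  | skip => fun s => PMF.pure s.tick
  | push x b => fun s => PMF.pure (s.set x (b :: s.store x))
  | pop x => fun s => PMF.pure (s.set x (s.store x).tail)
  | flip x => fun s => (PMF.uniformOfFintype Bool).map fun b => s.set x (b :: s.store x)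
  | call o x y z => fun s =>
      (O s.oracle o (s.store x) (s.store y)).map fun r => { s.set z r.1 with oracle := r.2 }
  | seq c d => fun s => (run O c s).bind (run O d)
  | cases x e f t => fun s =>
      match s.store x with
      | [] => run O e s.tick
      | false :: _ => run O f s.tick
      | true :: _ => run O t s.tick
  | loop x c => fun s =>
      (fun μ : PMF (Config σ) => μ.bind fun s' => run O c s'.tick)^[(s.store x).length]
        (PMF.pure s.tick)

/-- `c` runs in polynomial time: for all inputs, all outcomes of its coins and all oracles, the
number of steps is at most a fixed polynomial in the total length of the inputs plus a bound on the
length of the oracle's individual replies. (In all experiments below the replies have length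
polynomial in the security parameter.) -/
def PolyTime (c : Prog ι) : Prop :=
  ∃ p : Polynomial ℕ, ∀ (τ : Type) (O : Oracle ι τ) (s₀ : τ) (inputs : List (List Bool)) (L : ℕ),
    (∀ s o x y, ∀ r ∈ (O s o x y).support, r.1.length ≤ L) →
      ∀ s ∈ (c.run O (Config.init inputs s₀)).support,
        s.time ≤ p.eval ((inputs.map List.length).sum + L)

/-- The final configuration of an oracle program run on `inputs`, reduced to its output and the
final state of the oracle. -/
noncomputable def exec (c : Prog ι) (O : Oracle ι σ) (s₀ : σ) (inputs : List (List Bool)) :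
    PMF (List Bool × σ) :=
  (c.run O (Config.init inputs s₀)).map fun s => (s.out, s.oracle)

/-- The output distribution of a program without oracles. -/
noncomputable def output (c : Prog Empty) (inputs : List (List Bool)) : PMF (List Bool) :=
  (c.exec (fun (_ : Unit) o => o.elim) () inputs).map Prod.fst

end Prog

/-- The security parameter `n` in unary. -/
def unary (n : ℕ) : List Bool := List.replicate n true

/-- Negligible functions: smaller than every inverse polynomial, asymptotically. -/
def Negligible (f : ℕ → ℝ) : Prop :=
  Asymptotics.SuperpolynomialDecay atTop (fun n : ℕ => (n : ℝ)) f

/-- The uniform distribution on the bit strings of length `l`. -/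
noncomputable def uniformBits (l : ℕ) : PMF (List Bool) :=
  (PMF.uniformOfFintype (Fin l → Bool)).map List.ofFn

/-! ### Symmetric-key encryption schemes -/

/-- The outcome of decryption that an output string of the decryption program stands for:
`true :: m` with `m` of the plaintext length `l` is the plaintext `m`, all else is `⊥`. -/
def parsePlaintext (l : ℕ) : List Bool → Option (List Bool)
  | true :: m => if m.length = l then some m else none
  | _ => none

/-- A reply of an oracle as a string; `none` is `⊥`. -/
def encodeReply : Option (List Bool) → List Bool
  | none => []
  | some w => true :: w

/-- The algorithms of a symmetric-key encryption scheme with plaintext space `{0,1}^(msgLen n)`;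
ciphertexts are bit strings. `keyGen` has input `1ⁿ`, `enc` has inputs `1ⁿ`, a key and a plaintext,
and `dec` has inputs `1ⁿ`, a key and a ciphertext. -/
structure SKESAlgorithms : Type where
  msgLen : ℕ → ℕ
  keyGen : Prog Empty
  enc : Prog Empty
  dec : Prog Empty

namespace SKESAlgorithms

variable (S : SKESAlgorithms)

/-- `k ← KeyGen(1ⁿ)` -/
noncomputable def KeyGen (n : ℕ) : PMF (List Bool) := S.keyGen.output [unary n]

/-- `c ← Enc_k(m)` -/
noncomputable def Enc (n : ℕ) (k m : List Bool) : PMF (List Bool) := S.enc.output [unary n, k, m]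

/-- `Dec_k(c)`, where `none` is `⊥` -/
noncomputable def Dec (n : ℕ) (k c : List Bool) : PMF (Option (List Bool)) :=
  (S.dec.output [unary n, k, c]).map (parsePlaintext (S.msgLen n))

end SKESAlgorithms

/-- Symmetric-key encryption schemes: the three algorithms are polynomial-time, plaintexts have
polynomial length, and decryption inverts encryption except with negligible probability, for all
keys in the support of key generation and all plaintexts. -/
structure SKES : Type extends SKESAlgorithms where
  msgLen_le : ∃ p : Polynomial ℕ, ∀ n, msgLen n ≤ p.eval n
  keyGen_polyTime : keyGen.PolyTime
  enc_polyTime : enc.PolyTime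
  dec_polyTime : dec.PolyTime
  correct : ∃ ε : ℕ → ℝ, Negligible ε ∧
    ∀ n, ∀ k ∈ (toSKESAlgorithms.KeyGen n).support, ∀ m : List Bool, m.length = msgLen n →
      1 - ε n ≤
        (((toSKESAlgorithms.Enc n k m).bind (toSKESAlgorithms.Dec n k)) (some m)).toReal

/-- The two oracles of the experiments for authenticated encryption. -/
inductive AEOracle : Type
  | enc
  | dec

namespace SKES

variable (S : SKES)

/-! ### Oracles

The state of an oracle is the list of ciphertexts that it has returned. Queries that are not
plaintexts are answered by `⊥`, and an unneeded second query string is ignored. -/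

/-- Encryption of the query. -/
noncomputable def realEnc (n : ℕ) (k : List Bool) : Oracle Unit (List (List Bool)) :=
  fun issued _ m _ =>
    if m.length = S.msgLen n then
      (S.Enc n k m).map fun c => (encodeReply (some c), c :: issued)
    else PMF.pure (encodeReply none, issued)

/-- Encryption of a fresh uniformly random plaintext in place of the query. -/
noncomputable def randEnc (n : ℕ) (k : List Bool) : Oracle Unit (List (List Bool)) :=
  fun issued _ m _ =>
    if m.length = S.msgLen n then
      ((uniformBits (S.msgLen n)).bind (S.Enc n k)).map fun c =>
        (encodeReply (some c), c :: issued)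
    else PMF.pure (encodeReply none, issued)

/-- Left-or-right encryption: `m₁` is encrypted if `b` is true, and `m₀` otherwise. -/
noncomputable def lrEnc (n : ℕ) (k : List Bool) (b : Bool) : Oracle Unit (List (List Bool)) :=
  fun issued _ m₀ m₁ =>
    if m₀.length = S.msgLen n ∧ m₁.length = S.msgLen n then
      (S.Enc n k (if b then m₁ else m₀)).map fun c => (encodeReply (some c), c :: issued)
    else PMF.pure (encodeReply none, issued)

/-- Encryption, and decryption that rejects the ciphertexts returned by encryption. -/
noncomputable def aeRealOracle (n : ℕ) (k : List Bool) : Oracle AEOracle (List (List Bool)) :=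
  fun issued o x y =>
    match o with
    | AEOracle.enc => S.realEnc n k issued () x y
    | AEOracle.dec =>
        if x ∈ issued then PMF.pure (encodeReply none, issued)
        else (S.Dec n k x).map fun m => (encodeReply m, issued)

/-- Encryption of random plaintexts, and decryption that always rejects. -/
noncomputable def aeIdealOracle (n : ℕ) (k : List Bool) : Oracle AEOracle (List (List Bool)) :=
  fun issued o x y =>
    match o with
    | AEOracle.enc => S.randEnc n k issued () x y
    | AEOracle.dec => PMF.pure (encodeReply none, issued)

/-! ### Unforgeability `UF` -/

/-- The adversary wins if its output decrypts to something other than `⊥`. -/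
noncomputable def ufForge (A : Prog Unit) (n : ℕ) : PMF Bool :=
  (S.KeyGen n).bind fun k =>
    (A.exec (S.realEnc n k) [] [unary n]).bind fun r =>
      (S.Dec n k r.1).map fun m => m.isSome

/-- Random plaintexts are encrypted; the adversary cheats if it outputs one of the ciphertexts
that it received. -/
noncomputable def ufCheat (A : Prog Unit) (n : ℕ) : PMF Bool :=
  (S.KeyGen n).bind fun k =>
    (A.exec (S.randEnc n k) [] [unary n]).map fun r => decide (r.1 ∈ r.2)

/-- Unforgeability of ciphertexts: the classical restriction of quantum unforgeability. -/
def UF : Prop :=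
  ∀ A : Prog Unit, A.PolyTime →
    Negligible fun n => |(S.ufForge A n true).toReal - (S.ufCheat A n true).toReal|

/-! ### Authenticated encryption -/

/-- The adversary interacts with the left-or-right encryption oracle and outputs a bit. -/
noncomputable def cpaGame (A : Prog Unit) (b : Bool) (n : ℕ) : PMF Bool :=
  (S.KeyGen n).bind fun k =>
    (A.exec (S.lrEnc n k b) [] [unary n]).map fun r => decide (r.1.head? = some true)

/-- Indistinguishability under chosen-plaintext attacks. -/
def INDCPA : Prop :=
  ∀ A : Prog Unit, A.PolyTime →
    Negligible fun n => |(S.cpaGame A true n true).toReal - (S.cpaGame A false n true).toReal|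

/-- The adversary wins if its output is valid and was not returned by the encryption oracle. -/
noncomputable def ctxtGame (A : Prog Unit) (n : ℕ) : PMF Bool :=
  (S.KeyGen n).bind fun k =>
    (A.exec (S.realEnc n k) [] [unary n]).bind fun r =>
      (S.Dec n k r.1).map fun m => m.isSome && decide (r.1 ∉ r.2)

/-- Integrity of ciphertexts. -/
def INTCTXT : Prop :=
  ∀ A : Prog Unit, A.PolyTime → Negligible fun n => (S.ctxtGame A n true).toReal

/-- Authenticated encryption. -/
def AE : Prop := S.INDCPA ∧ S.INTCTXT

/-- The real world: the adversary outputs a bit. -/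
noncomputable def aeReal (A : Prog AEOracle) (n : ℕ) : PMF Bool :=
  (S.KeyGen n).bind fun k =>
    (A.exec (S.aeRealOracle n k) [] [unary n]).map fun r => decide (r.1.head? = some true)

/-- The ideal world: the adversary outputs a bit. -/
noncomputable def aeIdeal (A : Prog AEOracle) (n : ℕ) : PMF Bool :=
  (S.KeyGen n).bind fun k =>
    (A.exec (S.aeIdealOracle n k) [] [unary n]).map fun r => decide (r.1.head? = some true)

/-- Authenticated encryption in its real/ideal form. -/
def INDCCA3 : Prop :=
  ∀ A : Prog AEOracle, A.PolyTime →
    Negligible fun n => |(S.aeReal A n true).toReal - (S.aeIdeal A n true).toReal|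

end SKES

/-! The implications proved form a cycle: `UF` gives `AE`, `AE` gives `INDCCA3`, and `INDCCA3` gives
`UF`.

From `UF` to integrity (`UF.intctxt`): given an integrity adversary, output its string if that
string was not received, and otherwise a string too long to be a received ciphertext. This algorithm
never cheats, so by `UF` its forging probability is negligible, and that probability bounds the
success of the given adversary.

From `UF` to `INDCPA` (`UF.indcpa`): for each side `b`, answer left-or-right queries by encrypting
side `b`, and output a received ciphertext if the distinguisher says 1. The probability of such a
replay is that of answering 1 after at least one ciphertext was issued. Replaying is close to
forging by integrity and correctness (`INTCTXT.close_replay`), forging is close to cheating by `UF`,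
and cheating does not depend on `b`, because random plaintexts are encrypted instead of the queries.
Runs in which no ciphertext is issued contribute equally to both sides (`lrEnc_expect_eq`).

From `AE` to `INDCCA3` (`AE.indcca3`): the intermediate world encrypts honestly and rejects all
decryption queries. It is exchanged for the ideal world by left-or-right queries whose right half is
a random string. It differs from the real world only if some decryption query is a forgery; an
adversary that guesses the index of such a query and outputs the query breaks integrity, with a
polynomial loss (`INTCTXT.close_reject`).

From `INDCCA3` to `UF` (`INDCCA3.uf`): at the end, ask for the decryption of the adversary's output,
and accept if it was received or is valid. In the ideal world this is cheating. In the real world it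
is forging, up to failed decryptions of issued ciphertexts, whose expected number is at most the
running time times the correctness error.

The reductions have to be polynomial-time programs. A `Handler` couples such programs with the
distributions that they realise, and `Handler.exists_reduction` compiles an algorithm together with
a handler. Experiments are compared by couplings (`PMF.Lift`), which pass from single queries to
whole runs in `lift_run`; `run_bind_kernel` does this for randomised maps between oracle states, and
`expect_run_le` for expectations. -/

namespace PMF

/-! ### Expectations and couplings of discrete distributions -/

variable {α β γ δ : Type*}

/-- The expectation of a nonnegative function. -/
noncomputable def expect (μ : PMF α) (g : α → ENNReal) : ENNReal := ∑' a, μ a * g a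

@[simp] theorem expect_pure (a : α) (g : α → ENNReal) : (PMF.pure a).expect g = g a := by
  rw [expect, tsum_eq_single a]
  · simp
  · intro b hb; simp [hb]

theorem expect_bind (μ : PMF α) (f : α → PMF β) (g : β → ENNReal) :
    (μ.bind f).expect g = μ.expect fun a => (f a).expect g := by
  simp only [expect, PMF.bind_apply, ← ENNReal.tsum_mul_right, ← ENNReal.tsum_mul_left]
  rw [ENNReal.tsum_comm]
  simp only [mul_assoc]

theorem expect_map (μ : PMF α) (f : α → β) (g : β → ENNReal) :
    (μ.map f).expect g = μ.expect fun a => g (f a) := by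
  simp [PMF.map, expect_bind, Function.comp_def]

theorem expect_mono {μ : PMF α} {f g : α → ENNReal} (h : ∀ a ∈ μ.support, f a ≤ g a) :
    μ.expect f ≤ μ.expect g := by
  refine ENNReal.tsum_le_tsum fun a => ?_
  by_cases ha : a ∈ μ.support
  · exact mul_le_mul_right (h a ha) _
  · rw [PMF.apply_eq_zero_iff _ _ |>.2 ha]; simp

theorem expect_congr {μ : PMF α} {f g : α → ENNReal} (h : ∀ a ∈ μ.support, f a = g a) :
    μ.expect f = μ.expect g :=
  le_antisymm (expect_mono fun a ha => (h a ha).le) (expect_mono fun a ha => (h a ha).ge)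

theorem expect_add (μ : PMF α) (f g : α → ENNReal) :
    (μ.expect fun a => f a + g a) = μ.expect f + μ.expect g := by
  simp only [expect, mul_add, ENNReal.tsum_add]

theorem expect_const (μ : PMF α) (c : ENNReal) : (μ.expect fun _ => c) = c := by
  simp [expect, ENNReal.tsum_mul_right]

theorem expect_const_mul (μ : PMF α) (c : ENNReal) (f : α → ENNReal) :
    (μ.expect fun a => c * f a) = c * μ.expect f := by
  simp only [expect, ← ENNReal.tsum_mul_left]
  exact tsum_congr fun a => by ring

theorem expect_finset_sum {ι : Type*} (μ : PMF α) (t : Finset ι) (f : ι → α → ENNReal) :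
    (μ.expect fun a => ∑ i ∈ t, f i a) = ∑ i ∈ t, μ.expect (f i) := by
  simp only [expect, Finset.mul_sum]
  exact Summable.tsum_finsetSum fun i _ => ENNReal.summable

theorem apply_mul_le_expect (μ : PMF α) (f : α → ENNReal) (a : α) : μ a * f a ≤ μ.expect f :=
  ENNReal.le_tsum a

theorem expect_ite_eq [DecidableEq α] (μ : PMF α) (a : α) :
    (μ.expect fun b => if b = a then 1 else 0) = μ a := by
  rw [expect, tsum_eq_single a]
  · simp
  · intro b hb; simp [hb]

theorem bind_apply_eq_expect (μ : PMF α) (f : α → PMF β) (b : β) :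
    (μ.bind f) b = μ.expect fun a => f a b := rfl

theorem map_apply_true (μ : PMF α) (f : α → Bool) :
    (μ.map f) true = μ.expect fun a => if f a then 1 else 0 := by
  rw [← expect_ite_eq, expect_map]

theorem bind_congr {μ : PMF α} {f g : α → PMF β} (h : ∀ a ∈ μ.support, f a = g a) :
    μ.bind f = μ.bind g := by
  ext b
  exact expect_congr fun a ha => by rw [h a ha]

theorem map_congr {μ : PMF α} {f g : α → β} (h : ∀ a ∈ μ.support, f a = g a) :
    μ.map f = μ.map g :=
  bind_congr fun a ha => by simp [h a ha]

/-- The distributions `μ` and `ν` have a coupling that is concentrated on `R`. -/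
def Lift (R : α → β → Prop) (μ : PMF α) (ν : PMF β) : Prop :=
  ∃ ρ : PMF (α × β), ρ.map Prod.fst = μ ∧ ρ.map Prod.snd = ν ∧ ∀ p ∈ ρ.support, R p.1 p.2

namespace Lift

variable {R S : α → β → Prop} {μ : PMF α} {ν : PMF β}

theorem mk {R : α → β → Prop} (ρ : PMF γ) (f : γ → α) (g : γ → β)
    (h : ∀ c ∈ ρ.support, R (f c) (g c)) : Lift R (ρ.map f) (ρ.map g) := by
  refine ⟨ρ.map fun c => (f c, g c), ?_, ?_, ?_⟩
  · rw [PMF.map_comp]; rfl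
  · rw [PMF.map_comp]; rfl
  · intro p hp
    obtain ⟨c, hc, rfl⟩ := (PMF.mem_support_map_iff _ _ _).1 hp
    exact h c hc

theorem pure {R : α → β → Prop} {a : α} {b : β} (h : R a b) :
    Lift R (PMF.pure a) (PMF.pure b) :=
  ⟨PMF.pure (a, b), by simp [PMF.pure_map], by simp [PMF.pure_map], by simpa using h⟩

theorem mono_support (h : Lift R μ ν)
    (hRS : ∀ a b, a ∈ μ.support → b ∈ ν.support → R a b → S a b) : Lift S μ ν := by
  obtain ⟨ρ, rfl, rfl, hρ⟩ := h
  refine ⟨ρ, rfl, rfl, fun p hp => hRS _ _ ?_ ?_ (hρ p hp)⟩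
  · exact (PMF.mem_support_map_iff _ _ _).2 ⟨p, hp, rfl⟩
  · exact (PMF.mem_support_map_iff _ _ _).2 ⟨p, hp, rfl⟩

theorem mono (h : Lift R μ ν) (hRS : ∀ a b, R a b → S a b) : Lift S μ ν :=
  h.mono_support fun a b _ _ => hRS a b

/-- The independent coupling. It serves where only the supports are known, for instance after a bad
event. -/
theorem of_support (h : ∀ a ∈ μ.support, ∀ b ∈ ν.support, R a b) : Lift R μ ν := by
  refine ⟨μ.bind fun a => ν.map fun b => (a, b), ?_, ?_, ?_⟩
  · simp only [PMF.map_bind, PMF.map_comp, Function.comp_def]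
    exact (bind_congr fun a _ => PMF.map_const ν a).trans μ.bind_pure
  · simp only [PMF.map_bind, PMF.map_comp, Function.comp_def]
    rw [show (fun b : β => b) = id from rfl, PMF.map_id, PMF.bind_const]
  · intro p hp
    obtain ⟨a, ha, hp⟩ := (PMF.mem_support_bind_iff _ _ _).1 hp
    obtain ⟨b, hb, rfl⟩ := (PMF.mem_support_map_iff _ _ _).1 hp
    exact h a ha b hb

theorem bind {T : γ → δ → Prop} {f : α → PMF γ} {g : β → PMF δ} (h : Lift R μ ν)
    (hfg : ∀ a b, R a b → Lift T (f a) (g b)) : Lift T (μ.bind f) (ν.bind g) := by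
  classical
  obtain ⟨ρ, rfl, rfl, hρ⟩ := h
  have key : ∀ p : α × β, ∃ r : PMF (γ × δ), p ∈ ρ.support →
      (r.map Prod.fst = f p.1 ∧ r.map Prod.snd = g p.2 ∧ ∀ q ∈ r.support, T q.1 q.2) := by
    intro p
    by_cases hp : p ∈ ρ.support
    · obtain ⟨r, hr⟩ := hfg _ _ (hρ p hp)
      exact ⟨r, fun _ => hr⟩
    -- Outside the support of `ρ` any distribution will do, since it gets weight zero.
    · exact ⟨(f p.1).bind fun a => (g p.2).map fun b => (a, b), fun h => absurd h hp⟩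
  choose r hr using key
  refine ⟨ρ.bind r, ?_, ?_, ?_⟩
  · rw [PMF.map_bind, PMF.bind_map]
    exact bind_congr fun p hp => (hr p hp).1
  · rw [PMF.map_bind, PMF.bind_map]
    exact bind_congr fun p hp => (hr p hp).2.1
  · intro q hq
    obtain ⟨p, hp, hq⟩ := (PMF.mem_support_bind_iff _ _ _).1 hq
    exact (hr p hp).2.2 q hq

theorem map {T : γ → δ → Prop} {f : α → γ} {g : β → δ} (h : Lift R μ ν)
    (hfg : ∀ a b, R a b → T (f a) (g b)) : Lift T (μ.map f) (ν.map g) :=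
  h.bind fun a b hab => pure (hfg a b hab)

theorem refl {R : α → α → Prop} {μ : PMF α} (h : ∀ a ∈ μ.support, R a a) : Lift R μ μ := by
  simpa [PMF.map_id] using mk (R := R) μ id id h

theorem swap (h : Lift R μ ν) : Lift (fun b a => R a b) ν μ := by
  obtain ⟨ρ, rfl, rfl, hρ⟩ := h
  exact mk ρ _ _ hρ

theorem map_eq (f : α → γ) (g : β → γ) (h : Lift (fun a b => f a = g b) μ ν) :
    μ.map f = ν.map g := by
  obtain ⟨ρ, rfl, rfl, hρ⟩ := h
  rw [PMF.map_comp, PMF.map_comp]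
  exact map_congr fun p hp => hρ p hp

/-- Carries worst-case statements across a coupling. The running times of the reductions are bounded
in this way. -/
theorem exists_of_mem_support (h : Lift R μ ν) {a : α} (ha : a ∈ μ.support) :
    ∃ b ∈ ν.support, R a b := by
  obtain ⟨ρ, rfl, rfl, hρ⟩ := h
  obtain ⟨p, hp, rfl⟩ := (PMF.mem_support_map_iff _ _ _).1 ha
  exact ⟨p.2, (PMF.mem_support_map_iff _ _ _).2 ⟨p, hp, rfl⟩, hρ p hp⟩

theorem expect_le {f : α → ENNReal} {g : β → ENNReal} (h : Lift R μ ν)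
    (hfg : ∀ a b, R a b → f a ≤ g b) : μ.expect f ≤ ν.expect g := by
  obtain ⟨ρ, rfl, rfl, hρ⟩ := h
  rw [expect_map, expect_map]
  exact expect_mono fun p hp => hfg _ _ (hρ p hp)

theorem expect_eq {f : α → ENNReal} {g : β → ENNReal} (h : Lift R μ ν)
    (hfg : ∀ a b, R a b → f a = g b) : μ.expect f = ν.expect g :=
  le_antisymm (h.expect_le fun a b hab => (hfg a b hab).le)
    (h.swap.expect_le fun b a hab => (hfg a b hab).ge)

end Lift

end PMF

/-! ### Runs of programs: invariants, couplings, kernels and drift -/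

namespace Prog

open PMF

variable {ι κ σ τ : Type}

/-- `n` passes through the body `c` of a loop. -/
noncomputable def passes (O : Oracle ι σ) (c : Prog ι) : ℕ → Config σ → PMF (Config σ)
  | 0 => PMF.pure
  | n + 1 => fun s => (passes O c n s).bind fun s' => c.run O s'.tick

theorem run_loop (O : Oracle ι σ) (x : ℕ) (c : Prog ι) (s : Config σ) :
    (loop x c).run O s = passes O c (s.store x).length s.tick := by
  simp only [run]
  generalize (s.store x).length = n
  induction n with
  | zero => rfl
  | succ n ih => rw [Function.iterate_succ_apply', ih]; rfl

/-- `passes` splits off the last pass by definition; deterministic loops are followed from the first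
one. -/
theorem passes_succ (O : Oracle ι σ) (c : Prog ι) (n : ℕ) (s : Config σ) :
    passes O c (n + 1) s = (c.run O s.tick).bind (passes O c n) := by
  induction n generalizing s with
  | zero => simp [passes]
  | succ n ih =>
    change (passes O c (n + 1) s).bind (fun s' => c.run O s'.tick) = _
    rw [ih, PMF.bind_bind]
    rfl

/-- The branch that is taken if the tested register contains `w`. -/
def branch (w : List Bool) (e f t : Prog ι) : Prog ι :=
  match w with
  | [] => e
  | false :: _ => f
  | true :: _ => t

theorem run_cases (O : Oracle ι σ) (x : ℕ) (e f t : Prog ι) (s : Config σ) :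
    (cases x e f t).run O s = (branch (s.store x) e f t).run O s.tick := by
  simp only [run]
  rcases s.store x with _ | ⟨_ | _, _⟩ <;> rfl

theorem branch_eq (w : List Bool) (e f t : Prog ι) :
    branch w e f t = e ∨ branch w e f t = f ∨ branch w e f t = t := by
  rcases w with _ | ⟨_ | _, _⟩ <;> simp [branch]

theorem run_seq (O : Oracle ι σ) (c d : Prog ι) (s : Config σ) :
    (seq c d).run O s = (c.run O s).bind (d.run O) := rfl

theorem run_call (O : Oracle ι σ) (o : ι) (x y z : ℕ) (s : Config σ) :
    (call o x y z).run O s = (O s.oracle o (s.store x) (s.store y)).map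
      fun r => { s.set z r.1 with oracle := r.2 } := rfl

/-- A property that is preserved by all elementary steps holds after every run. -/
theorem run_invariant {O : Oracle ι σ} {P : Config σ → Prop} (htick : ∀ s, P s → P s.tick)
    (hset : ∀ (s : Config σ) x w, w.length ≤ (s.store x).length + 1 → P s → P (s.set x w))
    (hcall : ∀ (s : Config σ) o x y z, ∀ r ∈ (O s.oracle o x y).support, P s →
      P { s.set z r.1 with oracle := r.2 }) (c : Prog ι) :
    ∀ s, P s → ∀ s' ∈ (c.run O s).support, P s' := by
  induction c with
  | skip => intro s hs s' hs'; simp only [run, support_pure, Set.mem_singleton_iff] at hs'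
            exact hs' ▸ htick s hs
  | push x b => intro s hs s' hs'; simp only [run, support_pure, Set.mem_singleton_iff] at hs'
                exact hs' ▸ hset s x _ (by simp) hs
  | pop x => intro s hs s' hs'; simp only [run, support_pure, Set.mem_singleton_iff] at hs'
             exact hs' ▸ hset s x _ (by simp; omega) hs
  | flip x =>
    intro s hs s' hs'
    obtain ⟨b, _, rfl⟩ := (mem_support_map_iff _ _ _).1 hs'
    exact hset s x _ (by simp) hs
  | call o x y z =>
    intro s hs s' hs'
    obtain ⟨r, hr, rfl⟩ := (mem_support_map_iff _ _ _).1 hs'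
    exact hcall s o _ _ z r hr hs
  | seq c d ihc ihd =>
    intro s hs s' hs'
    obtain ⟨s₁, h₁, h₂⟩ := (mem_support_bind_iff _ _ _).1 hs'
    exact ihd s₁ (ihc s hs s₁ h₁) s' h₂
  | cases x e f t ihe ihf iht =>
    intro s hs s' hs'
    rw [run_cases] at hs'
    rcases branch_eq (s.store x) e f t with h | h | h <;> rw [h] at hs'
    · exact ihe _ (htick s hs) _ hs'
    · exact ihf _ (htick s hs) _ hs'
    · exact iht _ (htick s hs) _ hs'
  | loop x c ih =>
    intro s hs s' hs'
    rw [run_loop] at hs'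
    have hs := htick s hs
    generalize s.tick = u at hs hs'
    generalize (s.store x).length = n at hs'
    induction n generalizing s' with
    | zero => simp only [passes, support_pure, Set.mem_singleton_iff] at hs'; exact hs' ▸ hs
    | succ n ihn =>
      obtain ⟨s₁, h₁, h₂⟩ := (mem_support_bind_iff _ _ _).1 hs'
      exact ih _ (htick _ (ihn _ h₁)) _ h₂

theorem time_le_of_mem_support {O : Oracle ι σ} {c : Prog ι} {s s' : Config σ}
    (h : s' ∈ (c.run O s).support) : s.time ≤ s'.time :=
  run_invariant (P := fun u => s.time ≤ u.time) (fun _ h => Nat.le_succ_of_le h)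
    (fun _ _ _ _ h => Nat.le_succ_of_le h) (fun _ _ _ _ _ _ _ h => Nat.le_succ_of_le h) c s le_rfl
    s' h

theorem oracle_invariant {O : Oracle ι σ} {P : σ → Prop}
    (hP : ∀ s o x y, ∀ r ∈ (O s o x y).support, P s → P r.2) {c : Prog ι} {s s' : Config σ}
    (h : s' ∈ (c.run O s).support) (hs : P s.oracle) : P s'.oracle :=
  run_invariant (P := fun u => P u.oracle) (fun _ h => h) (fun _ _ _ _ h => h)
    (fun _ _ _ _ _ _ hr h => hP _ _ _ _ _ hr h) c s hs s' h

/-- Every query increases a counter by at most one, hence so does every step. -/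
theorem counter_le_time {O : Oracle ι σ} {q : σ → ℕ}
    (hq : ∀ s o x y, ∀ r ∈ (O s o x y).support, q r.2 ≤ q s + 1) {c : Prog ι} {s s' : Config σ}
    (h : s' ∈ (c.run O s).support) : q s'.oracle + s.time ≤ q s.oracle + s'.time :=
  run_invariant (P := fun u => q u.oracle + s.time ≤ q s.oracle + u.time)
    (fun _ h => h.trans (by simp [Config.tick])) (fun _ _ _ _ h => h.trans (by simp [Config.set]))
    (fun u o x y _ r hr h => by have := hq _ _ _ _ r hr; simp only [Config.set]; omega)
    c s le_rfl s' h

/-- Every step adds at most `L + 1` bits to a register if `L` bounds the length of replies. -/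
theorem length_store_le {O : Oracle ι σ} {L : ℕ}
    (hL : ∀ s o x y, ∀ r ∈ (O s o x y).support, r.1.length ≤ L) {m : ℕ} {c : Prog ι}
    {s s' : Config σ} (h : s' ∈ (c.run O s).support)
    (hs : ∀ x, (s.store x).length ≤ m + s.time * (L + 1)) (x : ℕ) :
    (s'.store x).length ≤ m + s'.time * (L + 1) := by
  refine run_invariant (P := fun u => ∀ x, (u.store x).length ≤ m + u.time * (L + 1))
    ?_ ?_ ?_ c s hs s' h x
  · intro u hu x
    have := hu x
    simp only [Config.tick, add_mul]; omega
  · intro u y w hw hu x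
    have := hu x
    have hy := hu y
    by_cases hxy : x = y
    · subst hxy; simp only [Config.set, Function.update_self, add_mul]; omega
    · simp only [Config.set, Function.update_of_ne hxy, add_mul]; omega
  · intro u o _ _ y r hr hu x
    have := hu x
    have hr := hL _ _ _ _ r hr
    by_cases hxy : x = y
    · subst hxy; simp only [Config.set, Function.update_self, add_mul]; omega
    · simp only [Config.set, Function.update_of_ne hxy, add_mul]; omega

/-- Runs with two oracles that behave alike up to `R`, until `Bad` happens. -/
theorem lift_run {O₁ : Oracle ι σ} {O₂ : Oracle ι τ} {R Bad : σ → τ → Prop}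
    (hstep : ∀ s₁ s₂, R s₁ s₂ → ∀ o x y, Lift
      (fun r₁ r₂ => (r₁.1 = r₂.1 ∧ R r₁.2 r₂.2) ∨ Bad r₁.2 r₂.2) (O₁ s₁ o x y) (O₂ s₂ o x y))
    (hbad₁ : ∀ s₁ s₂, Bad s₁ s₂ → ∀ o x y, ∀ r ∈ (O₁ s₁ o x y).support, Bad r.2 s₂)
    (hbad₂ : ∀ s₁ s₂, Bad s₁ s₂ → ∀ o x y, ∀ r ∈ (O₂ s₂ o x y).support, Bad s₁ r.2)
    (c : Prog ι) :
    ∀ s₁ s₂, (s₁.store = s₂.store ∧ s₁.time = s₂.time ∧ R s₁.oracle s₂.oracle) ∨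
        Bad s₁.oracle s₂.oracle →
      Lift (fun s₁ s₂ => (s₁.store = s₂.store ∧ s₁.time = s₂.time ∧ R s₁.oracle s₂.oracle) ∨
        Bad s₁.oracle s₂.oracle) (c.run O₁ s₁) (c.run O₂ s₂) := by
  -- After a bad event the runs may branch differently and cannot be paired step by step. As `Bad`
  -- survives the queries of either side alone, the independent coupling suffices.
  have hbad : ∀ (c : Prog ι) (s₁ : Config σ) (s₂ : Config τ), Bad s₁.oracle s₂.oracle →
      Lift (fun s₁ s₂ => (s₁.store = s₂.store ∧ s₁.time = s₂.time ∧ R s₁.oracle s₂.oracle) ∨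
        Bad s₁.oracle s₂.oracle) (c.run O₁ s₁) (c.run O₂ s₂) := by
    intro c s₁ s₂ h
    refine Lift.of_support fun a ha b hb => Or.inr ?_
    have h₁ : Bad a.oracle s₂.oracle :=
      oracle_invariant (P := fun s => Bad s s₂.oracle)
        (fun s o x y r hr h => hbad₁ _ _ h _ _ _ r hr) ha h
    exact oracle_invariant (P := fun s => Bad a.oracle s)
        (fun s o x y r hr h => hbad₂ _ _ h _ _ _ r hr) hb h₁
  induction c with
  | skip =>
    rintro s₁ s₂ (⟨h, ht, hR⟩ | h)
    · exact Lift.pure (Or.inl ⟨h, congrArg (· + 1) ht, hR⟩)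
    · exact hbad _ _ _ h
  | push x b =>
    rintro s₁ s₂ (⟨h, ht, hR⟩ | h)
    · exact Lift.pure (Or.inl ⟨by simp [Config.set, h], congrArg (· + 1) ht, hR⟩)
    · exact hbad _ _ _ h
  | pop x =>
    rintro s₁ s₂ (⟨h, ht, hR⟩ | h)
    · exact Lift.pure (Or.inl ⟨by simp [Config.set, h], congrArg (· + 1) ht, hR⟩)
    · exact hbad _ _ _ h
  | flip x =>
    rintro s₁ s₂ (⟨h, ht, hR⟩ | h)
    · exact Lift.mk _ _ _ fun b _ =>
        Or.inl ⟨by simp [Config.set, h], congrArg (· + 1) ht, hR⟩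
    · exact hbad _ _ _ h
  | call o x y z =>
    rintro s₁ s₂ (⟨h, ht, hR⟩ | h)
    · rw [run_call, run_call, h]
      refine (hstep _ _ hR o _ _).map ?_
      rintro r₁ r₂ (⟨hr, hR⟩ | h')
      · exact Or.inl ⟨by simp [Config.set, h, hr], congrArg (· + 1) ht, hR⟩
      · exact Or.inr h'
    · exact hbad _ _ _ h
  | seq c d ihc ihd =>
    intro s₁ s₂ h
    exact (ihc _ _ h).bind ihd
  | cases x e f t ihe ihf iht =>
    rintro s₁ s₂ (⟨h, ht, hR⟩ | h)
    · have h' : (s₁.tick.store = s₂.tick.store ∧ s₁.tick.time = s₂.tick.time ∧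
          R s₁.tick.oracle s₂.tick.oracle) ∨ Bad s₁.tick.oracle s₂.tick.oracle :=
        Or.inl ⟨h, congrArg (· + 1) ht, hR⟩
      rw [run_cases, run_cases, h]
      rcases branch_eq (s₂.store x) e f t with h | h | h <;> rw [h]
      exacts [ihe _ _ h', ihf _ _ h', iht _ _ h']
    · exact hbad _ _ _ h
  | loop x c ih =>
    rintro s₁ s₂ (⟨h, ht, hR⟩ | h)
    · rw [run_loop, run_loop, h]
      have h' : (s₁.tick.store = s₂.tick.store ∧ s₁.tick.time = s₂.tick.time ∧
          R s₁.tick.oracle s₂.tick.oracle) ∨ Bad s₁.tick.oracle s₂.tick.oracle :=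
        Or.inl ⟨h, congrArg (· + 1) ht, hR⟩
      generalize (s₂.store x).length = n
      generalize s₁.tick = u₁ at h'
      generalize s₂.tick = u₂ at h'
      induction n with
      | zero => exact Lift.pure h'
      | succ n ihn =>
        refine ihn.bind fun a b hab => ih _ _ ?_
        rcases hab with ⟨h, ht, hR⟩ | h
        · exact Or.inl ⟨h, congrArg (· + 1) ht, hR⟩
        · exact Or.inr h
    · exact hbad _ _ _ h

/-- A randomised map between oracle states that commutes with queries commutes with runs. -/
theorem run_bind_kernel {O₁ : Oracle ι σ} {O₂ : Oracle ι τ} (F : σ → PMF τ)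
    (hF : ∀ s o x y, ((O₁ s o x y).bind fun r => (F r.2).map fun s' => (r.1, s')) =
      (F s).bind fun s' => O₂ s' o x y) (c : Prog ι) :
    ∀ s : Config σ, ((c.run O₁ s).bind fun u =>
        (F u.oracle).map fun s' => (⟨u.store, s', u.time⟩ : Config τ)) =
      (F s.oracle).bind fun s' => c.run O₂ ⟨s.store, s', s.time⟩ := by
  induction c with
  | skip => intro s; simp only [run, PMF.pure_bind]; rfl
  | push x b => intro s; simp only [run, PMF.pure_bind]; rfl
  | pop x => intro s; simp only [run, PMF.pure_bind]; rfl
  | flip x =>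
    intro s
    simp only [run, PMF.map, Function.comp_def, PMF.bind_bind, PMF.pure_bind]
    -- The coin and the draw from `F` are independent, so their order does not matter.
    rw [PMF.bind_comm]
    rfl
  | call o x y z =>
    intro s
    have h := congrArg (PMF.map fun r : List Bool × τ =>
      (⟨Function.update s.store z r.1, r.2, s.time + 1⟩ : Config τ))
      (hF s.oracle o (s.store x) (s.store y))
    simp only [PMF.map_bind, PMF.map_comp, Function.comp_def] at h
    simp only [run_call, PMF.bind_map, Function.comp_def]
    exact h
  | seq c d ihc ihd =>
    intro s
    simp only [run_seq, PMF.bind_bind, ihd]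
    rw [← PMF.bind_bind, ← ihc, PMF.bind_bind]
    simp only [PMF.bind_map, Function.comp_def]
  | cases x e f t ihe ihf iht =>
    intro s
    simp only [run_cases]
    rcases branch_eq (s.store x) e f t with h | h | h <;> rw [h]
    exacts [ihe s.tick, ihf s.tick, iht s.tick]
  | loop x c ih =>
    intro s
    simp only [run_loop]
    have key : ∀ n (u : Config σ), ((passes O₁ c n u).bind fun u =>
        (F u.oracle).map fun s' => (⟨u.store, s', u.time⟩ : Config τ)) =
        (F u.oracle).bind fun s' => passes O₂ c n ⟨u.store, s', u.time⟩ := by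
      intro n
      induction n with
      | zero => intro u; simp only [passes, PMF.pure_bind]; rfl
      | succ n ihn =>
        intro u
        simp only [passes]
        rw [← PMF.bind_bind (F u.oracle), ← ihn, PMF.bind_bind, PMF.bind_bind]
        congr 1; funext v
        rw [ih v.tick, PMF.bind_map]
        rfl
    exact key _ s.tick

/-- If a query increases the expectation of `f` by at most `ε`, then so does a step. -/
theorem expect_run_le {O : Oracle ι σ} {f : σ → ENNReal} {ε : ENNReal}
    (hf : ∀ s o x y, (O s o x y).expect (fun r => f r.2) ≤ f s + ε) (T : ℕ) (c : Prog ι) :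
    ∀ s : Config σ, (∀ s' ∈ (c.run O s).support, s'.time ≤ T) →
      (c.run O s).expect (fun u => f u.oracle + ε * ((T - u.time : ℕ) : ENNReal)) ≤
        f s.oracle + ε * ((T - s.time : ℕ) : ENNReal) := by
  -- The potential is `f` plus `ε` per remaining step: a query pays for its increase of `f` with the
  -- step that it takes, and other steps only lower the potential.
  have mono : ∀ t : ℕ, ε * ((T - (t + 1) : ℕ) : ENNReal) ≤ ε * ((T - t : ℕ) : ENNReal) := by
    intro t; gcongr; omega
  have htick : ∀ u : Config σ, f u.tick.oracle + ε * ((T - u.tick.time : ℕ) : ENNReal) ≤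
      f u.oracle + ε * ((T - u.time : ℕ) : ENNReal) := fun u => add_le_add_right (mono u.time) _
  induction c with
  | skip => intro s _; simp only [run, expect_pure]; exact add_le_add_right (mono _) _
  | push x b => intro s _; simp only [run, expect_pure]; exact add_le_add_right (mono _) _
  | pop x => intro s _; simp only [run, expect_pure]; exact add_le_add_right (mono _) _
  | flip x =>
    intro s _
    simp only [run, expect_map, Config.set, expect_const]
    exact add_le_add_right (mono _) _
  | call o x y z =>
    intro s hs
    rw [run_call] at hs ⊢
    obtain ⟨r, hr⟩ := (O s.oracle o (s.store x) (s.store y)).support_nonempty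
    -- The query ends within the time bound, so the truncated subtraction still has a unit left to
    -- pay with.
    have ht : s.time + 1 ≤ T := hs _ ((mem_support_map_iff _ _ _).2 ⟨r, hr, rfl⟩)
    simp only [expect_map, Config.set, expect_add, expect_const]
    calc _ ≤ f s.oracle + ε + ε * ((T - (s.time + 1) : ℕ) : ENNReal) := by gcongr; apply hf
      _ = f s.oracle + ε * ((T - s.time : ℕ) : ENNReal) := by
        rw [show T - s.time = (T - (s.time + 1)) + 1 by omega]
        push_cast; ring
  | seq c d ihc ihd =>
    intro s hs
    have hd : ∀ u ∈ (c.run O s).support, ∀ s' ∈ (d.run O u).support, s'.time ≤ T :=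
      fun u hu s' hs' => hs s' ((mem_support_bind_iff _ _ _).2 ⟨u, hu, hs'⟩)
    rw [run_seq, expect_bind]
    refine (expect_mono fun u hu => ihd u (hd u hu)).trans (ihc s fun u hu => ?_)
    obtain ⟨v, hv⟩ := (d.run O u).support_nonempty
    exact (time_le_of_mem_support hv).trans (hd u hu v hv)
  | cases x e f t ihe ihf iht =>
    intro s hs
    rw [run_cases] at hs ⊢
    refine le_trans ?_ (htick s)
    rcases branch_eq (s.store x) e f t with h | h | h <;> rw [h] at hs ⊢
    exacts [ihe s.tick hs, ihf s.tick hs, iht s.tick hs]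
  | loop x c ih =>
    intro s hs
    rw [run_loop] at hs ⊢
    refine le_trans ?_ (htick s)
    have key : ∀ n (u : Config σ), (∀ s' ∈ (passes O c n u).support, s'.time ≤ T) →
        (passes O c n u).expect (fun u => f u.oracle + ε * ((T - u.time : ℕ) : ENNReal)) ≤
        f u.oracle + ε * ((T - u.time : ℕ) : ENNReal) := by
      intro n
      induction n with
      | zero => intro u _; simp [passes]
      | succ n ihn =>
        intro u hu
        have hd : ∀ v ∈ (passes O c n u).support, ∀ s' ∈ (c.run O v.tick).support, s'.time ≤ T :=
          fun v hv s' hs' => hu s' ((mem_support_bind_iff _ _ _).2 ⟨v, hv, hs'⟩)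
        rw [passes, expect_bind]
        refine (expect_mono fun v hv => (ih v.tick (hd v hv)).trans (htick v)).trans
          (ihn u fun v hv => ?_)
        obtain ⟨w, hw⟩ := (c.run O v.tick).support_nonempty
        exact (Nat.le_succ _).trans ((time_le_of_mem_support hw).trans (hd v hv w hw))
    exact key _ s.tick hs

end Prog

/-! ### Two blocks of registers -/

/-- The registers below `N` are those of `a`, the others those of `h`. -/
def overlay (N : ℕ) (a h : ℕ → List Bool) : ℕ → List Bool :=
  fun i => if i < N then a i else h (i - N)

theorem overlay_of_lt {N i : ℕ} (a h : ℕ → List Bool) (hi : i < N) : overlay N a h i = a i :=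
  if_pos hi

@[simp] theorem overlay_add (N i : ℕ) (a h : ℕ → List Bool) : overlay N a h (N + i) = h i := by
  simp [overlay]

theorem update_overlay_of_lt {N i : ℕ} (a h : ℕ → List Bool) (w : List Bool) (hi : i < N) :
    Function.update (overlay N a h) i w = overlay N (Function.update a i w) h := by
  funext j
  by_cases hj : j = i
  · subst hj; simp [overlay, hi]
  · simp [overlay, hj]

theorem update_overlay_add (N i : ℕ) (a h : ℕ → List Bool) (w : List Bool) :
    Function.update (overlay N a h) (N + i) w = overlay N a (Function.update h i w) := by
  funext j
  by_cases hj : j = N + i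
  · subst hj; simp
  · rw [Function.update_of_ne hj]
    by_cases hN : j < N
    · simp [overlay, hN]
    · have : j - N ≠ i := by omega
      simp [overlay, hN, this]

namespace Prog

open PMF

variable {ι κ σ τ : Type}

/-- Replace each register `x` by `N + x`. -/
def shift (N : ℕ) : Prog ι → Prog ι
  | skip => skip
  | push x b => push (N + x) b
  | pop x => pop (N + x)
  | flip x => flip (N + x)
  | call o x y z => call o (N + x) (N + y) (N + z)
  | seq c d => seq (shift N c) (shift N d)
  | cases x e f t => cases (N + x) (shift N e) (shift N f) (shift N t)
  | loop x c => loop (N + x) (shift N c)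

theorem branch_shift (N : ℕ) (w : List Bool) (e f t : Prog ι) :
    branch w (e.shift N) (f.shift N) (t.shift N) = (branch w e f t).shift N := by
  rcases w with _ | ⟨_ | _, _⟩ <;> rfl

/-- The shifted program cannot address the registers below `N`, so they are carried along unchanged.
-/
theorem run_shift (O : Oracle ι σ) (N : ℕ) (a : ℕ → List Bool) (c : Prog ι) :
    ∀ s : Config σ, (c.shift N).run O ⟨overlay N a s.store, s.oracle, s.time⟩ =
      (c.run O s).map fun s => ⟨overlay N a s.store, s.oracle, s.time⟩ := by
  induction c with
  | skip => intro s; simp [shift, run, PMF.pure_map, Config.tick]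
  | push x b => intro s; simp [shift, run, PMF.pure_map, Config.set, update_overlay_add]
  | pop x => intro s; simp [shift, run, PMF.pure_map, Config.set, update_overlay_add]
  | flip x =>
    intro s
    simp [shift, run, PMF.map_comp, Config.set, update_overlay_add, Function.comp_def]
  | call o x y z =>
    intro s
    simp [shift, run, PMF.map_comp, Config.set, update_overlay_add, Function.comp_def]
  | seq c d ihc ihd =>
    intro s
    simp only [shift, run_seq, ihc, PMF.bind_map, PMF.map_bind]
    congr 1; funext u; exact ihd u
  | cases x e f t ihe ihf iht =>
    intro s
    simp only [shift, run_cases, overlay_add, branch_shift]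
    rcases branch_eq (s.store x) e f t with h | h | h <;> rw [h]
    exacts [ihe s.tick, ihf s.tick, iht s.tick]
  | loop x c ih =>
    intro s
    simp only [shift, run_loop, overlay_add]
    have key : ∀ n (u : Config σ),
        passes O (c.shift N) n ⟨overlay N a u.store, u.oracle, u.time⟩ =
        (passes O c n u).map fun s => ⟨overlay N a s.store, s.oracle, s.time⟩ := by
      intro n
      induction n with
      | zero => intro u; simp [passes, PMF.pure_map]
      | succ n ihn =>
        intro u
        simp only [passes, ihn, PMF.bind_map, PMF.map_bind]
        congr 1; funext v; exact ih v.tick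
    exact key _ s.tick

/-! ### Deterministic register programs -/

/-- `c` turns the register contents `h` into `h'`, in at most `B` steps. -/
def Det (c : Prog ι) (h h' : ℕ → List Bool) (B : ℕ) : Prop :=
  ∃ T ≤ B, ∀ (σ : Type) (O : Oracle ι σ) (s : σ) (t : ℕ),
    c.run O ⟨h, s, t⟩ = PMF.pure ⟨h', s, t + T⟩

/-- `n` passes through `c` turn `h` into `h'`, in at most `B` steps. -/
def DetPasses (c : Prog ι) (n : ℕ) (h h' : ℕ → List Bool) (B : ℕ) : Prop :=
  ∃ T ≤ B, ∀ (σ : Type) (O : Oracle ι σ) (s : σ) (t : ℕ),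
    passes O c n ⟨h, s, t⟩ = PMF.pure ⟨h', s, t + T⟩

namespace Det

variable {c d e f : Prog ι} {h h' h'' : ℕ → List Bool} {B C n : ℕ}

theorem mono (H : Det c h h' B) (hB : B ≤ C) : Det c h h' C := by
  obtain ⟨T, hT, H⟩ := H
  exact ⟨T, hT.trans hB, H⟩

theorem congr (H : Det c h h' B) (hh : h' = h'') (hB : B ≤ C) : Det c h h'' C :=
  hh ▸ H.mono hB

theorem skip : Det (Prog.skip : Prog ι) h h 1 := ⟨1, le_rfl, fun _ _ _ _ => rfl⟩

theorem push (x : ℕ) (b : Bool) :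
    Det (Prog.push x b : Prog ι) h (Function.update h x (b :: h x)) 1 :=
  ⟨1, le_rfl, fun _ _ _ _ => rfl⟩

theorem pop (x : ℕ) : Det (Prog.pop x : Prog ι) h (Function.update h x (h x).tail) 1 :=
  ⟨1, le_rfl, fun _ _ _ _ => rfl⟩

theorem seq (H : Det c h h' B) (H' : Det d h' h'' C) : Det (Prog.seq c d) h h'' (B + C) := by
  obtain ⟨T, hT, H⟩ := H
  obtain ⟨T', hT', H'⟩ := H'
  exact ⟨T + T', add_le_add hT hT', fun σ O s t => by
    rw [run_seq, H, PMF.pure_bind, H', add_assoc]⟩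

theorem cases {x : ℕ} (H : Det (branch (h x) c d e) h h' B) :
    Det (Prog.cases x c d e) h h' (B + 1) := by
  obtain ⟨T, hT, H⟩ := H
  exact ⟨T + 1, by omega, fun σ O s t => by
    rw [run_cases]
    exact (H σ O s (t + 1)).trans (by rw [add_assoc, add_comm 1])⟩

theorem loop {x : ℕ} (H : DetPasses c (h x).length h h' B) :
    Det (Prog.loop x c) h h' (B + 1) := by
  obtain ⟨T, hT, H⟩ := H
  exact ⟨T + 1, by omega, fun σ O s t => by
    rw [run_loop]
    exact (H σ O s (t + 1)).trans (by rw [add_assoc, add_comm 1])⟩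

theorem passes_zero : DetPasses c 0 h h 0 := ⟨0, le_rfl, fun _ _ _ _ => rfl⟩

theorem passes_succ (H : Det c h h' B) (H' : DetPasses c n h' h'' C) :
    DetPasses c (n + 1) h h'' (C + (B + 1)) := by
  obtain ⟨T, hT, H⟩ := H
  obtain ⟨T', hT', H'⟩ := H'
  exact ⟨T' + (T + 1), by omega, fun σ O s t => by
    rw [Prog.passes_succ]
    rw [show (⟨h, s, t⟩ : Config σ).tick = ⟨h, s, t + 1⟩ from rfl, H, PMF.pure_bind, H']
    congr 2; omega⟩

/-- The form in which a deterministic prefix is peeled off a program that goes on with coins or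
queries. -/
theorem run_seq_eq (H : Det c h h' B) : ∃ T ≤ B, ∀ (d : Prog ι) (σ : Type) (O : Oracle ι σ)
    (s : σ) (t : ℕ), (Prog.seq c d).run O ⟨h, s, t⟩ = d.run O ⟨h', s, t + T⟩ := by
  obtain ⟨T, hT, H⟩ := H
  exact ⟨T, hT, fun d σ O s t => by rw [run_seq, H, PMF.pure_bind]⟩

end Det

theorem DetPasses.congr {c : Prog ι} {h h' h'' : ℕ → List Bool} {B C n : ℕ}
    (H : DetPasses c n h h' B) (hh : h' = h'') (hB : B ≤ C) : DetPasses c n h h'' C := by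
  obtain ⟨T, hT, H⟩ := H
  exact ⟨T, hT.trans hB, hh ▸ H⟩

/-- Empty register `x`. -/
def clear (x : ℕ) : Prog ι := loop x (pop x)

/-- Move the bits of `x` onto `y`, one after the other. -/
def move (x y : ℕ) : Prog ι :=
  loop x (cases x skip (seq (pop x) (push y false)) (seq (pop x) (push y true)))

/-- Move the bits of `x` onto both `y` and `z`, one after the other. -/
def moveTwo (x y z : ℕ) : Prog ι :=
  loop x (cases x skip (seq (pop x) (seq (push y false) (push z false)))
    (seq (pop x) (seq (push y true) (push z true))))

/-- Copy `x` to the top of `y`, by means of the empty register `t`. -/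
def copy (x y t : ℕ) : Prog ι := seq (move x t) (moveTwo t x y)

open Function (update)

theorem det_popLoop (x y : ℕ) (h : ℕ → List Bool) :
    Det (loop x (pop y) : Prog ι) h (update h y ((h y).drop (h x).length))
      (2 * (h x).length + 1) := by
  refine Det.loop ?_
  generalize (h x).length = n
  induction n generalizing h with
  | zero => exact Det.passes_zero.congr (by simp) (by simp)
  | succ n ih =>
    exact (Det.passes_succ (Det.pop y) (ih _)).congr (by simp) (by omega)

theorem det_clear (x : ℕ) (h : ℕ → List Bool) :
    Det (clear x : Prog ι) h (update h x []) (2 * (h x).length + 1) := by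
  refine Det.loop ?_
  generalize hw : h x = w
  induction w generalizing h with
  | nil => exact Det.passes_zero.congr (by simp [hw]) (by simp)
  | cons b w ih =>
    refine (Det.passes_succ (Det.pop x) (ih _ (by simp [hw]))).congr (by simp) (by simp; omega)

theorem det_pushLoop (x y : ℕ) (b : Bool) (h : ℕ → List Bool) :
    Det (loop x (push y b) : Prog ι) h (update h y (List.replicate (h x).length b ++ h y))
      (2 * (h x).length + 1) := by
  refine Det.loop ?_
  generalize (h x).length = n
  induction n generalizing h with
  | zero => exact Det.passes_zero.congr (by simp) (by simp)
  | succ n ih =>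
    exact (Det.passes_succ (Det.push y b) (ih _)).congr
      (by simp [List.replicate_succ']) (by omega)

/-- Popping and pushing reverses the order of the bits, so a string whose order matters is moved
twice, through an empty register. -/
theorem det_move {x y : ℕ} (hxy : x ≠ y) (h : ℕ → List Bool) :
    Det (move x y : Prog ι) h (update (update h y ((h x).reverse ++ h y)) x [])
      (4 * (h x).length + 1) := by
  refine Det.loop ?_
  generalize hw : h x = w
  induction w generalizing h with
  | nil => exact Det.passes_zero.congr (by simp [hw]) (by simp)
  | cons b w ih =>
    have step : Det (cases x skip (seq (pop x) (push y false)) (seq (pop x) (push y true)) :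
        Prog ι) h (update (update h x w) y (b :: h y)) 3 := by
      refine Det.cases (B := 2) ?_
      rw [hw]
      cases b <;>
      exact (Det.seq (Det.pop x) (Det.push y _)).congr (by simp [hw, hxy.symm]) le_rfl
    refine (Det.passes_succ step (ih _ (by simp [hxy]))).congr ?_ (by simp; omega)
    funext i
    by_cases hx : i = x
    · subst hx; simp
    · by_cases hy : i = y
      · subst hy; simp [hx]
      · simp [hx, hy]

theorem det_moveTwo {x y z : ℕ} (hxy : x ≠ y) (hxz : x ≠ z) (hyz : y ≠ z) (h : ℕ → List Bool) :
    Det (moveTwo x y z : Prog ι) h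
      (update (update (update h z ((h x).reverse ++ h z)) y ((h x).reverse ++ h y)) x [])
      (5 * (h x).length + 1) := by
  refine Det.loop ?_
  generalize hw : h x = w
  induction w generalizing h with
  | nil => exact Det.passes_zero.congr (by simp [hw]) (by simp)
  | cons b w ih =>
    have step : Det (cases x skip (seq (pop x) (seq (push y false) (push z false)))
        (seq (pop x) (seq (push y true) (push z true))) : Prog ι) h
        (update (update (update h x w) y (b :: h y)) z (b :: h z)) 4 := by
      refine Det.cases (B := 3) ?_
      rw [hw]
      cases b <;>
      exact (Det.seq (Det.pop x) (Det.seq (Det.push y _) (Det.push z _))).congr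
        (by simp [hw, hxy.symm, hxz.symm, hyz.symm]) le_rfl
    refine (Det.passes_succ step (ih _ (by simp [hxy, hxz]))).congr ?_ (by simp; omega)
    funext i
    by_cases hx : i = x
    · subst hx; simp
    · by_cases hy : i = y
      · subst hy; simp [hx, hyz]
      · by_cases hz : i = z
        · subst hz; simp [hx, hy]
        · simp [hx, hy, hz]

theorem det_copy {x y t : ℕ} (hxy : x ≠ y) (hxt : x ≠ t) (hyt : y ≠ t) {h : ℕ → List Bool}
    (ht : h t = []) :
    Det (copy x y t : Prog ι) h (update h y (h x ++ h y)) (9 * (h x).length + 2) := by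
  refine ((det_move hxt h).seq (det_moveTwo hxt.symm hyt.symm hxy _)).congr ?_ ?_
  · funext i
    by_cases hx : i = x
    · subst hx; simp [ht, hxt, hxt.symm, hxy]
    · by_cases hy : i = y
      · subst hy; simp [hx, hyt, ht, hxt.symm]
      · by_cases hz : i = t
        · subst hz; simp [hy, ht]
        · simp [hx, hy, hz]
  · simp [hxt.symm, ht]; omega

end Prog

theorem Polynomial.eval_nat_mono (p : Polynomial ℕ) : Monotone fun n => p.eval n := by
  intro a b hab
  simp only [Polynomial.eval_eq_sum, Polynomial.sum]
  gcongr

/-! ### Replacing oracle calls by subroutines -/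

namespace Prog

open PMF
open Function (update)

variable {ι κ σ τ : Type}

/-- All registers of a program are below `N`. -/
def Below (N : ℕ) : Prog ι → Prop
  | skip => True
  | push x _ => x < N
  | pop x => x < N
  | flip x => x < N
  | call _ x y z => x < N ∧ y < N ∧ z < N
  | seq c d => Below N c ∧ Below N d
  | cases x e f t => x < N ∧ Below N e ∧ Below N f ∧ Below N t
  | loop x c => x < N ∧ Below N c

theorem Below.mono {M N : ℕ} (h : M ≤ N) {c : Prog ι} (hc : c.Below M) : c.Below N := by
  induction c with
  | skip => trivial
  | push x b => exact lt_of_lt_of_le hc h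
  | pop x => exact lt_of_lt_of_le hc h
  | flip x => exact lt_of_lt_of_le hc h
  | call o x y z => exact ⟨hc.1.trans_le h, hc.2.1.trans_le h, hc.2.2.trans_le h⟩
  | seq c d ihc ihd => exact ⟨ihc hc.1, ihd hc.2⟩
  | cases x e f t ihe ihf iht =>
    exact ⟨hc.1.trans_le h, ihe hc.2.1, ihf hc.2.2.1, iht hc.2.2.2⟩
  | loop x c ih => exact ⟨hc.1.trans_le h, ih hc.2⟩

/-- A program mentions finitely many registers; those from `N` on are free for subroutines. -/
theorem exists_below (c : Prog ι) : ∃ N, 0 < N ∧ c.Below N := by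
  induction c with
  | skip => exact ⟨1, one_pos, trivial⟩
  | push x b => exact ⟨x + 1, by omega, Nat.lt_succ_self x⟩
  | pop x => exact ⟨x + 1, by omega, Nat.lt_succ_self x⟩
  | flip x => exact ⟨x + 1, by omega, Nat.lt_succ_self x⟩
  | call o x y z =>
    exact ⟨x + y + z + 1, by omega, by omega, by omega, by omega⟩
  | seq c d ihc ihd =>
    obtain ⟨M, hM, hc⟩ := ihc
    obtain ⟨N, _, hd⟩ := ihd
    exact ⟨M + N, by omega, hc.mono (by omega), hd.mono (by omega)⟩
  | cases x e f t ihe ihf iht =>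
    obtain ⟨M, hM, he⟩ := ihe
    obtain ⟨N, _, hf⟩ := ihf
    obtain ⟨K, _, ht⟩ := iht
    exact ⟨x + M + N + K, by omega, by omega, he.mono (by omega), hf.mono (by omega),
      ht.mono (by omega)⟩
  | loop x c ih =>
    obtain ⟨M, hM, hc⟩ := ih
    exact ⟨x + M, by omega, by omega, hc.mono (by omega)⟩

/-- Run `P` on the registers from `N` on, with arguments from `x` and `y` and result to `z`. -/
def callVia (N : ℕ) (P : Prog κ) (x y z : ℕ) : Prog κ :=
  seq (copy x (N + 0) (N + 3)) (seq (copy y (N + 1) (N + 3)) (seq (shift N P)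
    (seq (clear z) (seq (move (N + 2) (N + 3)) (move (N + 3) z)))))

/-- Replace each oracle call by a subroutine that works on the registers from `N` on. -/
def simulate (N : ℕ) (H : ι → Prog κ) : Prog ι → Prog κ
  | skip => skip
  | push x b => push x b
  | pop x => pop x
  | flip x => flip x
  | call o x y z => callVia N (H o) x y z
  | seq c d => seq (simulate N H c) (simulate N H d)
  | cases x e f t => cases x (simulate N H e) (simulate N H f) (simulate N H t)
  | loop x c => loop x (simulate N H c)

theorem branch_simulate (N : ℕ) (H : ι → Prog κ) (w : List Bool) (e f t : Prog ι) :
    branch w (e.simulate N H) (f.simulate N H) (t.simulate N H) =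
      (branch w e f t).simulate N H := by
  rcases w with _ | ⟨_ | _, _⟩ <;> rfl

/-- The relation `K` is left open so that the same statement serves the answers to queries, where
the handler's state must survive, and the final output. Registers 0 and 1 of the block receive the
arguments, 3 is scratch space, and the reply is fetched from 2. Copying arguments and moving the
reply adds a linear cost. -/
theorem lift_callVia {ρ : Type} {O : Oracle κ σ} {N x y z : ℕ} (hx : x < N) (hy : y < N)
    (hz : z < N) {P : Prog κ} {a h : ℕ → List Bool} (h0 : h 0 = []) (h1 : h 1 = [])
    (h3 : h 3 = []) {s : σ} {t C R : ℕ} {μ : PMF ρ} {reply : ρ → List Bool}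
    {K : (ℕ → List Bool) → σ → ρ → Prop}
    (H : ∀ t, Lift (fun c r => ∃ h' : ℕ → List Bool, c.store = update h' 2 (reply r) ∧ h' 2 = [] ∧ h' 3 = [] ∧
      K h' c.oracle r ∧ c.time ≤ t + C ∧ (reply r).length ≤ R)
      (P.run O ⟨update (update h 0 (a x)) 1 (a y), s, t⟩) μ) :
    Lift (fun c r => ∃ h' : ℕ → List Bool, c.store = overlay N (update a z (reply r)) h' ∧ K h' c.oracle r ∧
      c.time ≤ t + (C + 9 * ((a x).length + (a y).length) + 2 * (a z).length + 8 * R + 7))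
      ((callVia N P x y z).run O ⟨overlay N a h, s, t⟩) μ := by
  have hne : ∀ i j, i < N → i ≠ N + j := fun i j hi => by omega
  obtain ⟨T₁, hT₁, e₁⟩ := (det_copy (ι := κ) (h := overlay N a h) (hne x 0 hx) (hne x 3 hx)
    (by omega) (by simpa using h3)).run_seq_eq
  simp only [overlay_of_lt _ _ hx, overlay_add, h0, List.append_nil, update_overlay_add]
    at e₁ hT₁
  obtain ⟨T₂, hT₂, e₂⟩ := (det_copy (ι := κ) (h := overlay N a (update h 0 (a x))) (hne y 1 hy)
    (hne y 3 hy) (by omega) (by simpa using h3)).run_seq_eq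
  simp only [overlay_of_lt _ _ hy, overlay_add, update_overlay_add] at e₂ hT₂
  rw [Function.update_of_ne one_ne_zero, h1, List.append_nil] at e₂
  rw [callVia, e₁, e₂, run_seq, run_shift O N a P
    ⟨update (update h 0 (a x)) 1 (a y), s, t + T₁ + T₂⟩, ← PMF.bind_pure μ, PMF.bind_map]
  refine (H _).bind ?_
  rintro ⟨hc, sc, tc⟩ r ⟨h', h_store, h'2, h'3, hK, htime, hR⟩
  simp only at h_store hK htime
  subst h_store
  have hdet : Det (seq (clear z) (seq (move (N + 2) (N + 3)) (move (N + 3) z)) : Prog κ)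
      (overlay N a (update h' 2 (reply r))) (overlay N (update a z (reply r)) h')
      (2 * (a z).length + 8 * R + 3) := by
    refine ((det_clear z _).seq ((det_move (by omega) _).seq
      (det_move (hne z 3 hz).symm _))).congr ?_ ?_
    · simp only [update_overlay_of_lt _ _ _ hz, update_overlay_add, overlay_add,
        overlay_of_lt _ _ hz]
      congr 1
      · simp [h'3]
      · funext i
        by_cases h3 : i = 3
        · subst h3; simp [h'3]
        · by_cases h2 : i = 2
          · subst h2; simp [h'2]
          · simp [h3, h2]
    · simp only [update_overlay_of_lt _ _ _ hz, update_overlay_add, overlay_add,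
        overlay_of_lt _ _ hz]
      simp [h'3]
      omega
  obtain ⟨T₃, hT₃, e₃⟩ := hdet
  simp only [Function.comp]
  rw [e₃]
  exact Lift.pure ⟨h', rfl, hK, by simp only; omega⟩

end Prog

/-! ### Handlers and the reductions that they define -/

open PMF Function in
/-- A transformation of oracle algorithms: the queries of `ι` are answered, and the final output is
computed, by programs with oracles `κ` that keep states in registers of their own. -/
structure Handler (ι κ : Type) where
  /-- abstract states of the handler -/
  State : Type
  /-- how states are stored -/
  Rep : State → (ℕ → List Bool) → Prop
  /-- length of the stored states -/
  size : State → ℕ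
  /-- number of registers that are emptied at the beginning -/
  width : ℕ
  /-- bound for the running times -/
  cost : Polynomial ℕ
  start : Prog κ
  step : ι → Prog κ
  finish : Prog κ
  startDist : List Bool → PMF State
  stepDist : ∀ {σ : Type}, Oracle κ σ → Oracle ι (State × σ)
  finishDist : ∀ {σ : Type}, Oracle κ σ → State × σ → List Bool → PMF (List Bool × σ)
  width_gt : 3 < width
  rep_empty : ∀ {q h}, Rep q h → h 0 = [] ∧ h 1 = [] ∧ h 2 = [] ∧ h 3 = []
  start_spec : ∀ {σ : Type} (O : Oracle κ σ) (s : σ) (t : ℕ) (w : List Bool) (h : ℕ → List Bool),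
    h 0 = w → (∀ i, 0 < i → i < width → h i = []) →
      Lift (fun c q => Rep q c.store ∧ c.oracle = s ∧ c.time ≤ t + cost.eval w.length ∧
        size q = 0) (start.run O ⟨h, s, t⟩) (startDist w)
  step_spec : ∀ {σ : Type} (O : Oracle κ σ) (L : ℕ),
    (∀ s o x y, ∀ r ∈ (O s o x y).support, r.1.length ≤ L) → ∀ (o : ι) (q : State) (s : σ)
      (t : ℕ) (h : ℕ → List Bool) (x y : List Bool), Rep q h →
      Lift (fun c (r : List Bool × (State × σ)) => ∃ h' : ℕ → List Bool, c.store = update h' 2 r.1 ∧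
        Rep r.2.1 h' ∧ c.oracle = r.2.2 ∧
        c.time ≤ t + cost.eval (x.length + y.length + size q + L) ∧ r.1.length ≤ L ∧
        size r.2.1 ≤ size q + (x.length + y.length + L + 1))
        ((step o).run O ⟨update (update h 0 x) 1 y, s, t⟩) (stepDist O (q, s) o x y)
  finish_spec : ∀ {σ : Type} (O : Oracle κ σ) (L : ℕ),
    (∀ s o x y, ∀ r ∈ (O s o x y).support, r.1.length ≤ L) → ∀ (q : State) (s : σ)
      (t : ℕ) (h : ℕ → List Bool) (x : List Bool), Rep q h →
      Lift (fun c (r : List Bool × σ) => ∃ h' : ℕ → List Bool, c.store = update h' 2 r.1 ∧ h' 2 = [] ∧ h' 3 = [] ∧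
        c.oracle = r.2 ∧ c.time ≤ t + cost.eval (x.length + size q + L) ∧
        r.1.length ≤ cost.eval (x.length + size q + L))
        (finish.run O ⟨update (update h 0 x) 1 x, s, t⟩) (finishDist O (q, s) x)
  step_length_le : ∀ {σ : Type} (O : Oracle κ σ) (L : ℕ),
    (∀ s o x y, ∀ r ∈ (O s o x y).support, r.1.length ≤ L) →
      ∀ s o x y, ∀ r ∈ (stepDist O s o x y).support, r.1.length ≤ L

namespace Handler

open Prog PMF
open Function (update)

variable {ι κ σ : Type} (H : Handler ι κ)

/-- Bound for the registers of an algorithm after `j` steps. -/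
def regBound (n j : ℕ) : ℕ := n + j * (n + 1)

/-- Bound for the size of the handler's state after `j` steps. -/
def sizeBound (n j : ℕ) : ℕ := j * (2 * regBound n j + n + 1)

/-- Bound for the time that the simulation of each of the first `j` steps takes. -/
def stepCost (n j : ℕ) : ℕ :=
  H.cost.eval (2 * regBound n j + sizeBound n j + n) + 20 * regBound n j + 8 * n + 8

theorem regBound_mono (n : ℕ) : Monotone (regBound n) := fun i j h => by
  unfold regBound; gcongr

theorem sizeBound_mono (n : ℕ) : Monotone (sizeBound n) := fun i j h => by
  unfold sizeBound; gcongr; exact regBound_mono n h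

theorem stepCost_mono (n : ℕ) : Monotone (H.stepCost n) := fun i j h => by
  have := regBound_mono n h
  have := sizeBound_mono n h
  have := H.cost.eval_nat_mono
    (show 2 * regBound n i + sizeBound n i + n ≤ 2 * regBound n j + sizeBound n j + n by omega)
  simp only [stepCost] at *
  omega

/-- The configurations of the simulating and the simulated algorithm match. -/
structure Sim (N n t : ℕ) (u : Config σ) (v : Config (H.State × σ)) : Prop where
  ex : ∃ h, u.store = overlay N v.store h ∧ H.Rep v.oracle.1 h
  oracle_eq : u.oracle = v.oracle.2
  time_le : u.time ≤ t + v.time * H.stepCost n v.time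
  size_le : H.size v.oracle.1 ≤ sizeBound n v.time
  length_le : ∀ x, (v.store x).length ≤ regBound n v.time

variable {H}

/-- All earlier steps are charged the new price, which is no lower by monotonicity, and one more
step is added. -/
theorem Sim.time_step {t a b n j c : ℕ} (h : a ≤ t + j * H.stepCost n j)
    (hb : b ≤ a + c) (hc : c ≤ H.stepCost n (j + 1)) :
    b ≤ t + (j + 1) * H.stepCost n (j + 1) := by
  have : j * H.stepCost n j ≤ j * H.stepCost n (j + 1) :=
    Nat.mul_le_mul_left _ (H.stepCost_mono n (Nat.le_succ j))
  rw [add_mul, one_mul]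
  omega

theorem Sim.tick {N n t : ℕ} {u : Config σ} {v : Config (H.State × σ)} (h : H.Sim N n t u v) :
    H.Sim N n t u.tick v.tick where
  ex := h.ex
  oracle_eq := h.oracle_eq
  time_le := Sim.time_step h.time_le le_rfl (by unfold stepCost; omega)
  size_le := h.size_le.trans (sizeBound_mono n (Nat.le_succ _))
  length_le x := (h.length_le x).trans (regBound_mono n (Nat.le_succ _))

theorem Sim.set {N n t : ℕ} {u : Config σ} {v : Config (H.State × σ)} (h : H.Sim N n t u v)
    {x : ℕ} (hx : x < N) {w : List Bool} (hw : w.length ≤ (v.store x).length + 1) :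
    H.Sim N n t (u.set x w) (v.set x w) where
  ex := by
    obtain ⟨g, hg, hR⟩ := h.ex
    exact ⟨g, by simp [Config.set, hg, update_overlay_of_lt _ _ _ hx], hR⟩
  oracle_eq := h.oracle_eq
  time_le := Sim.time_step h.time_le le_rfl (by unfold stepCost; omega)
  size_le := h.size_le.trans (sizeBound_mono n (Nat.le_succ _))
  length_le y := by
    have hx := h.length_le x
    have hy := h.length_le y
    simp only [Config.set, regBound, add_mul] at *
    by_cases hxy : y = x
    · subst hxy; simp only [Function.update_self]; omega
    · rw [Function.update_of_ne hxy]; omega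

theorem Sim.store_eq {N n t x : ℕ} {u : Config σ} {v : Config (H.State × σ)}
    (h : H.Sim N n t u v) (hx : x < N) : u.store x = v.store x := by
  obtain ⟨g, hg, _⟩ := h.ex
  rw [hg, overlay_of_lt _ _ hx]

variable {O : Oracle κ σ} {n : ℕ}

/-- Only calls are changed, and `step_spec` matches each of them with one query to the abstract
oracle. All other instructions act below `N`, identically on both sides. -/
theorem lift_simulate (hO : ∀ s o x y, ∀ r ∈ (O s o x y).support, r.1.length ≤ n) (N t : ℕ)
    (c : Prog ι) (hc : c.Below N) : ∀ u v, H.Sim N n t u v →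
      Lift (H.Sim N n t) ((c.simulate N H.step).run O u) (c.run (H.stepDist O) v) := by
  induction c with
  | skip => exact fun u v h => Lift.pure h.tick
  | push x b =>
    intro u v h
    simp only [simulate, run, h.store_eq hc]
    exact Lift.pure (h.set hc (by simp))
  | pop x =>
    intro u v h
    simp only [simulate, run, h.store_eq hc]
    exact Lift.pure (h.set hc (by simp; omega))
  | flip x =>
    intro u v h
    simp only [simulate, run, h.store_eq hc]
    exact Lift.mk _ _ _ fun b _ => h.set hc (by simp)
  | call o x y z =>
    rintro ⟨us, s, ut⟩ ⟨a, ⟨q, s'⟩, vt⟩ h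
    obtain ⟨g, rfl, hR⟩ := h.ex
    obtain rfl : s = s' := h.oracle_eq
    have hE := H.rep_empty hR
    have hax := h.length_le x
    have hay := h.length_le y
    have haz := h.length_le z
    have hs := h.size_le
    have ht := h.time_le
    simp only at hR hE hax hay haz hs ht
    have hreg : regBound n vt ≤ regBound n (vt + 1) := regBound_mono n (Nat.le_succ vt)
    have hsz : sizeBound n vt ≤ sizeBound n (vt + 1) := sizeBound_mono n (Nat.le_succ vt)
    rw [simulate, run_call]
    -- `K` retains what `Sim` asks for after the call: the stored state, the oracle's state, and
    -- bounds for the reply and for the growth of the stored state.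
    have key := lift_callVia hc.1 hc.2.1 hc.2.2 (P := H.step o) hE.1 hE.2.1 hE.2.2.2
      (s := s) (t := ut) (reply := fun r : List Bool × (H.State × σ) => r.1) (R := n)
      (K := fun h' s' r => H.Rep r.2.1 h' ∧ s' = r.2.2 ∧ r.1.length ≤ n ∧
        H.size r.2.1 ≤ H.size q + ((a x).length + (a y).length + n + 1))
      fun t' => (H.step_spec O n hO o q s t' g (a x) (a y) hR).mono
        fun c r ⟨h', hs, hr, ho, ht, hl, hz⟩ => ⟨h', hs, (H.rep_empty hr).2.2.1,
          (H.rep_empty hr).2.2.2, ⟨hr, ho, hl, hz⟩, ht, hl⟩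
    rw [← PMF.map_id ((callVia N (H.step o) x y z).run O _)]
    refine key.map ?_
    rintro ⟨_, sc, tc⟩ ⟨r, q', s'⟩ ⟨h', rfl, ⟨hr, hso, hl, hz⟩, htime⟩
    simp only at hr hl hz htime hso
    refine ⟨⟨h', rfl, hr⟩, hso, ?_, ?_, ?_⟩
    · refine Sim.time_step ht htime ?_
      clear ht
      have := H.cost.eval_nat_mono (show (a x).length + (a y).length + H.size q + n ≤
        2 * regBound n (vt + 1) + sizeBound n (vt + 1) + n by omega)
      simp only [stepCost] at *
      omega
    · have : sizeBound n vt ≤ vt * (2 * regBound n (vt + 1) + n + 1) :=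
        Nat.mul_le_mul_left _ (by omega)
      change H.size q' ≤ (vt + 1) * (2 * regBound n (vt + 1) + n + 1)
      rw [add_mul vt 1]
      omega
    · intro i
      have hi := h.length_le i
      simp only [Config.set, regBound, add_mul] at *
      by_cases hiz : i = z
      · subst hiz; simp only [Function.update_self]; omega
      · rw [Function.update_of_ne hiz]; omega
  | seq c d ihc ihd => exact fun u v h => (ihc hc.1 u v h).bind (ihd hc.2)
  | cases x e f g ihe ihf ihg =>
    intro u v h
    rw [simulate, run_cases, run_cases, branch_simulate, h.store_eq hc.1]
    rcases branch_eq (v.store x) e f g with h' | h' | h' <;> rw [h']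
    exacts [ihe hc.2.1 _ _ h.tick, ihf hc.2.2.1 _ _ h.tick, ihg hc.2.2.2 _ _ h.tick]
  | loop x c ih =>
    intro u v h
    rw [simulate, run_loop, run_loop, h.store_eq hc.1]
    have h := h.tick
    generalize (v.store x).length = k
    generalize u.tick = u' at h
    generalize v.tick = v' at h
    induction k with
    | zero => exact Lift.pure h
    | succ k ihk => exact ihk.bind fun a b hab => ih hc.2 _ _ hab.tick

/-- Empty the `m` registers from `N` on. -/
def clearAll (N : ℕ) : ℕ → Prog κ
  | 0 => skip
  | m + 1 => seq (clearAll N m) (clear (N + m))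

theorem det_clearAll (N m : ℕ) {h : ℕ → List Bool} {n : ℕ} (hn : ∀ i, (h i).length ≤ n) :
    Det (clearAll N m : Prog κ) h (fun i => if N ≤ i ∧ i < N + m then [] else h i)
      (m * (2 * n + 1) + 1) := by
  induction m with
  | zero =>
    exact Det.skip.congr (by funext i; rw [if_neg (by omega)]) (by omega)
  | succ m ih =>
    refine (ih.seq (det_clear _ _)).congr ?_ ?_
    · funext i
      by_cases hi : i = N + m
      · subst hi; simp
      · rw [Function.update_of_ne hi]
        exact if_congr (by omega) rfl rfl
    · have := hn (N + m)
      rw [add_mul m 1]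
      simp
      omega

variable (H) in
/-- The algorithm `A` with its queries answered, and its output transformed, by the handler. -/
def reduce (N : ℕ) (A : Prog ι) : Prog κ :=
  seq (clearAll N H.width) (seq (copy 0 (N + 0) (N + 3)) (seq (shift N H.start)
    (seq (A.simulate N H.step) (callVia N H.finish 0 0 0))))

variable (H) in
/-- Running time of the transformed algorithm if the given one takes `j` steps. -/
def totalCost (n j : ℕ) : ℕ :=
  H.width * (2 * n + 1) + 1 + (9 * n + 2) + H.cost.eval n + j * H.stepCost n j +
    (9 * H.cost.eval (regBound n j + sizeBound n j + n) + 20 * regBound n j + 7)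

/-- The abstract execution also returns its number of steps, so a single coupling yields both the
output distribution and the running time of the compiled program. -/
theorem lift_reduce (hO : ∀ s o x y, ∀ r ∈ (O s o x y).support, r.1.length ≤ n) {N : ℕ}
    (hN : 0 < N) {A : Prog ι} (hA : A.Below N) (inputs : List (List Bool))
    (hin : ∀ i, (inputs.getD i []).length ≤ n) (s₀ : σ) :
    Lift (fun u (r : ℕ × (List Bool × σ)) => u.out = r.2.1 ∧ u.oracle = r.2.2 ∧
        u.time ≤ H.totalCost n r.1)
      ((H.reduce N A).run O (Config.init inputs s₀))
      ((H.startDist (inputs.getD 0 [])).bind fun q =>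
        (A.run (H.stepDist O) (Config.init inputs (q, s₀))).bind fun v =>
          (H.finishDist O v.oracle v.out).map fun r => (v.time, r)) := by
  set a : ℕ → List Bool := fun i => inputs.getD i [] with ha
  set g : ℕ → List Bool := fun i => if i < H.width then [] else a (N + i) with hg
  have hw := H.width_gt
  obtain ⟨T₁, hT₁, e₁⟩ := (det_clearAll (κ := κ) N H.width hin).run_seq_eq
  -- `PolyTime` admits any number of inputs, and some may lie in the handler's block; hence the
  -- initial clearing.
  have hcl : (fun i => if N ≤ i ∧ i < N + H.width then [] else inputs.getD i []) =
      overlay N a g := by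
    funext i
    by_cases hi : i < N
    · rw [overlay_of_lt _ _ hi, if_neg (by omega)]
    · obtain ⟨j, rfl⟩ := Nat.exists_eq_add_of_le (Nat.le_of_not_lt hi)
      rw [overlay_add]
      exact if_congr (by omega) rfl rfl
  rw [hcl] at e₁
  have hg0 : ∀ i, i < H.width → g i = [] := fun i hi => if_pos hi
  obtain ⟨T₂, hT₂, e₂⟩ := (det_copy (ι := κ) (x := 0) (y := N + 0) (t := N + 3)
    (h := overlay N a g) (by omega) (by omega) (by omega)
    (by rw [overlay_add, hg0 3 hw])).run_seq_eq
  rw [update_overlay_add, overlay_add, hg0 0 (by omega), List.append_nil,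
    overlay_of_lt _ _ hN] at e₂
  rw [overlay_of_lt _ _ hN] at hT₂
  rw [reduce, show Config.init inputs s₀ = ⟨a, s₀, 0⟩ from rfl, e₁, e₂, run_seq,
    run_shift O N a H.start ⟨update g 0 (a 0), s₀, 0 + T₁ + T₂⟩, PMF.bind_map]
  have hcost := H.cost.eval_nat_mono (hin 0)
  have hin0 := hin 0
  refine (H.start_spec O s₀ _ (a 0) _ (by simp) fun i hi hiw => ?_).bind ?_
  · rw [Function.update_of_ne (by omega), hg0 i hiw]
  rintro ⟨us, s, ut⟩ q ⟨hR, rfl, ht, hz⟩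
  simp only [Function.comp, run_seq]
  have hsim : H.Sim N n (H.width * (2 * n + 1) + 1 + (9 * n + 2) + H.cost.eval n)
      ⟨overlay N a us, s, ut⟩ (Config.init inputs (q, s)) := by
    refine ⟨⟨us, rfl, hR⟩, rfl, ?_, hz.le.trans (Nat.zero_le _), fun i => ?_⟩
    · simp only [Config.init, zero_mul, ha] at *
      omega
    · exact (hin i).trans (by simp [regBound])
  refine (lift_simulate hO N _ A hA _ _ hsim).bind ?_
  rintro ⟨us, s, ut⟩ ⟨vs, ⟨q', s'⟩, vt⟩ h
  obtain ⟨g', rfl, hR⟩ := h.ex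
  obtain rfl : s = s' := h.oracle_eq
  have hE := H.rep_empty hR
  have ht := h.time_le
  have hz := h.size_le
  have hl := h.length_le 0
  simp only at hR ht hz hl hE
  have key := lift_callVia hN hN hN (P := H.finish) hE.1 hE.2.1 hE.2.2.2
      (s := s) (t := ut) (reply := fun r : List Bool × σ => r.1)
      (R := H.cost.eval ((vs 0).length + H.size q' + n))
      (K := fun h' s' r => s' = r.2)
      fun t' => (H.finish_spec O n hO q' s t' g' (vs 0) hR).mono
        fun c r ⟨h', hs, h2, h3, ho, ht, hl⟩ => ⟨h', hs, h2, h3, ho, ht, hl⟩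
  rw [← PMF.map_id ((callVia N H.finish 0 0 0).run O _)]
  refine key.map ?_
  rintro ⟨_, sc, tc⟩ ⟨r, s'⟩ ⟨h', rfl, hso, htime⟩
  simp only at htime hso
  refine ⟨?_, hso, ?_⟩
  · simp [Config.out, overlay_of_lt _ _ hN]
  · have := H.cost.eval_nat_mono (show (vs 0).length + H.size q' + n ≤
        regBound n vt + sizeBound n vt + n by omega)
    simp only [totalCost, id] at *
    omega

/-- All the bounds are monotone in the number of steps, which may thus be replaced by its polynomial
bound; the result is a polynomial expression in `n`. -/
theorem exists_totalCost_le (p : Polynomial ℕ) :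
    ∃ P : Polynomial ℕ, ∀ n j, j ≤ p.eval n → H.totalCost n j ≤ P.eval n := by
  let X : Polynomial ℕ := Polynomial.X
  let R : Polynomial ℕ := X + p * (X + 1)
  let S : Polynomial ℕ := p * (2 * R + X + 1)
  refine ⟨(H.width : Polynomial ℕ) * (2 * X + 1) + 1 + (9 * X + 2) + H.cost +
    p * (H.cost.comp (2 * R + S + X) + 20 * R + 8 * X + 8) +
    (9 * H.cost.comp (R + S + X) + 20 * R + 7), fun n j hj => ?_⟩
  have hR : R.eval n = regBound n (p.eval n) := by simp [R, X, regBound]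
  have hS : S.eval n = sizeBound n (p.eval n) := by simp [S, X, sizeBound, hR]
  have hm : H.totalCost n j ≤ H.totalCost n (p.eval n) := by
    have h₁ := regBound_mono n hj
    have h₂ := sizeBound_mono n hj
    have h₃ := H.cost.eval_nat_mono (show regBound n j + sizeBound n j + n ≤
      regBound n (p.eval n) + sizeBound n (p.eval n) + n by omega)
    have h₄ := Nat.mul_le_mul hj (H.stepCost_mono n hj)
    simp only [totalCost] at *
    omega
  refine hm.trans_eq ?_
  simp [totalCost, stepCost, hR, hS, X, Polynomial.eval_comp]

theorem polyTime_reduce {N : ℕ} (hN : 0 < N) {A : Prog ι} (hA : A.Below N) (hp : A.PolyTime) :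
    (H.reduce N A).PolyTime := by
  obtain ⟨p, hp⟩ := hp
  -- The algorithm has inputs of total length `m` and is run with the reply bound `m + L`; together
  -- this is at most `2 * (m + L)`.
  obtain ⟨P, hP⟩ := H.exists_totalCost_le (p.comp (2 * Polynomial.X))
  refine ⟨P, fun τ O s₀ inputs L hL s hs => ?_⟩
  set m := (inputs.map List.length).sum
  have hin : ∀ i, (inputs.getD i []).length ≤ m := by
    intro i
    by_cases hi : i < inputs.length
    · rw [List.getD_eq_getElem _ _ hi]
      exact List.le_sum_of_mem (List.mem_map_of_mem (List.getElem_mem hi))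
    · rw [List.getD_eq_default _ _ (by omega)]; simp
  have hO : ∀ s o x y, ∀ r ∈ (O s o x y).support, r.1.length ≤ m + L :=
    fun s o x y r hr => (hL s o x y r hr).trans (by omega)
  obtain ⟨r, hr, -, -, ht⟩ := (lift_reduce (H := H) hO hN hA inputs
    (fun i => (hin i).trans (by omega)) s₀).exists_of_mem_support hs
  obtain ⟨q, _, hr⟩ := (mem_support_bind_iff _ _ _).1 hr
  obtain ⟨v, hv, hr⟩ := (mem_support_bind_iff _ _ _).1 hr
  obtain ⟨_, _, rfl⟩ := (mem_support_map_iff _ _ _).1 hr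
  refine ht.trans (hP _ _ ?_)
  -- The time bound of `A` applies to the oracle presented by the handler, as its replies obey the
  -- same length bound as those of `O`.
  refine (hp _ _ _ _ _ (H.step_length_le O _ hO) v hv).trans ?_
  simp only [Polynomial.eval_comp, Polynomial.eval_mul, Polynomial.eval_X, Polynomial.eval_ofNat]
  exact p.eval_nat_mono (by simp only [m]; omega)

theorem exec_reduce {L : ℕ} (hO : ∀ s o x y, ∀ r ∈ (O s o x y).support, r.1.length ≤ L) {N : ℕ}
    (hN : 0 < N) {A : Prog ι} (hA : A.Below N) (s₀ : σ) (w : List Bool) :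
    (H.reduce N A).exec O s₀ [w] = (H.startDist w).bind fun q =>
      (A.exec (H.stepDist O) (q, s₀) [w]).bind fun r => H.finishDist O r.2 r.1 := by
  have hin : ∀ i, (([w] : List (List Bool)).getD i []).length ≤ w.length + L := by
    intro i
    rcases i with _ | i <;> simp
  have key := Lift.map_eq
    (fun u => (u.out, u.oracle)) (fun r => r.2)
    ((lift_reduce (H := H) (n := w.length + L) (fun s o x y r hr =>
      (hO s o x y r hr).trans (by omega)) hN hA [w] hin s₀).mono
      fun u r h => Prod.ext h.1 h.2.1)
  rw [exec, key]
  simp only [exec, PMF.map_bind, PMF.map_comp, PMF.bind_map, Function.comp_def]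
  congr 1; funext q; congr 1; funext v
  exact PMF.map_id _

variable (H) in
/-- The reduction that the handler defines. -/
theorem exists_reduction {A : Prog ι} (hA : A.PolyTime) : ∃ B : Prog κ, B.PolyTime ∧
    ∀ {σ : Type} {O : Oracle κ σ} {L : ℕ},
      (∀ s o x y, ∀ r ∈ (O s o x y).support, r.1.length ≤ L) → ∀ (s₀ : σ) (w : List Bool),
      B.exec O s₀ [w] = (H.startDist w).bind fun q =>
        (A.exec (H.stepDist O) (q, s₀) [w]).bind fun r => H.finishDist O r.2 r.1 := by
  obtain ⟨N, hN, hb⟩ := A.exists_below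
  exact ⟨H.reduce N A, polyTime_reduce hN hb hA, fun hO s₀ w => exec_reduce hO hN hb s₀ w⟩

end Handler

/-! ### Recording replies and searching the record -/

namespace Prog

open PMF
open Function (update update_apply)

variable {ι κ σ : Type}

theorem run_call_seq (O : Oracle ι σ) (o : ι) (x y z : ℕ) (d : Prog ι) (h : ℕ → List Bool) (s : σ)
    (t : ℕ) : (seq (call o x y z) d).run O ⟨h, s, t⟩ =
      (O s o (h x) (h y)).bind fun r => d.run O ⟨update h z r.1, r.2, t + 1⟩ := by
  rw [run_seq, run_call, PMF.bind_map]
  rfl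

theorem DetPasses.append {c : Prog ι} {h h' h'' : ℕ → List Bool} {m n B C : ℕ}
    (H : DetPasses c m h h' B) (H' : DetPasses c n h' h'' C) :
    DetPasses c (m + n) h h'' (B + C) := by
  obtain ⟨T, hT, H⟩ := H
  obtain ⟨T', hT', H'⟩ := H'
  refine ⟨T + T', by omega, fun σ O s t => ?_⟩
  rw [show t + (T + T') = t + T + T' by omega, ← H', ← PMF.pure_bind ⟨h', s, t + T⟩ (passes O c n),
    ← H σ O]
  generalize (⟨h, s, t⟩ : Config σ) = u
  clear H H'
  induction n with
  | zero => exact (PMF.bind_pure _).symm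
  | succ n ih =>
    change (passes O c (m + n) u).bind _ = _
    rw [ih, PMF.bind_bind]
    rfl

theorem Det.assoc {a b c : Prog ι} {h h' : ℕ → List Bool} {B : ℕ}
    (H : Det (Prog.seq (Prog.seq a b) c) h h' B) : Det (Prog.seq a (Prog.seq b c)) h h' B := by
  obtain ⟨T, hT, e⟩ := H
  refine ⟨T, hT, fun σ O s t => ?_⟩
  rw [← e σ O s t]
  simp only [run_seq, PMF.bind_bind]
  rfl

/-- Record the contents of register 2 on register 8. -/
def record : Prog ι :=
  seq (push 8 false) (seq (move 2 3) (loop 3 (cases 3 skip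
    (seq (pop 3) (seq (push 2 false) (seq (push 8 false) (push 8 true))))
    (seq (pop 3) (seq (push 2 true) (seq (push 8 true) (push 8 true)))))))

/-- Encoding of a list of bit strings on one register. -/
def encodeList (W : List (List Bool)) : List Bool :=
  W.flatMap fun w => (w.flatMap fun b => [true, b]) ++ [false]

/-- Register 2 is reversed onto register 3; reading it back restores register 2 and writes the
encoding to register 8. The stack is filled from the end, so the final mark `false` is pushed first
and each bit before its mark `true`. -/
theorem det_record {h : ℕ → List Bool} (h3 : h 3 = []) {W : List (List Bool)}
    (h8 : h 8 = encodeList W) :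
    Det (record : Prog ι) h (update h 8 (encodeList (h 2 :: W))) (12 * (h 2).length + 12) := by
  have hloop : ∀ (v : List Bool) (g : ℕ → List Bool), g 3 = v →
      DetPasses (cases 3 skip
        (seq (pop 3) (seq (push 2 false) (seq (push 8 false) (push 8 true))))
        (seq (pop 3) (seq (push 2 true) (seq (push 8 true) (push 8 true)))) : Prog ι) v.length g
        (update (update (update g 3 []) 2 (v.reverse ++ g 2)) 8
          ((v.reverse.flatMap fun b => [true, b]) ++ g 8)) (6 * v.length) := by
    intro v
    induction v with
    | nil =>
      intro g hg
      refine Det.passes_zero.congr ?_ (by simp)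
      funext i
      simp only [update_apply]
      split_ifs <;> first | omega | simp_all
    | cons b v ih =>
      intro g hg
      have step : Det (cases 3 skip
          (seq (pop 3) (seq (push 2 false) (seq (push 8 false) (push 8 true))))
          (seq (pop 3) (seq (push 2 true) (seq (push 8 true) (push 8 true)))) : Prog ι) g
          (update (update (update g 3 v) 2 (b :: g 2)) 8 (true :: b :: g 8)) 5 := by
        refine Det.cases (B := 4) ?_
        rw [hg]
        cases b <;>
        exact (Det.seq (Det.pop _) (Det.seq (Det.push _ _) (Det.seq (Det.push _ _)
          (Det.push _ _)))).congr (by simp [hg]) le_rfl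
      refine (Det.passes_succ step (ih _ (by simp))).congr ?_ (by simp; omega)
      funext i
      simp only [update_apply]
      split_ifs <;> first | omega | simp_all
  refine ((Det.push 8 false).seq ((det_move (by decide) _).seq
    (Det.loop (hloop _ _ rfl)))).congr ?_ ?_
  · funext i
    simp only [update_apply]
    split_ifs <;> first | omega | (subst_vars; simp [h3, h8, encodeList])
  · simp [h3]
    omega

/-- One step of the comparison of register 0 with the strings listed on register 8: register 5
is what is left to compare, register 6 tells of a mismatch, register 7 of a match. -/
def searchStep : Prog ι :=
  cases 8 skip
    (seq (pop 8) (seq (cases 6 (cases 5 (push 7 true) skip skip) skip skip)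
      (seq (pop 6) (seq (clear 5) (copy 0 5 3)))))
    (seq (pop 8) (seq (cases 8 skip
        (cases 5 (seq (pop 6) (push 6 true)) skip (seq (pop 6) (push 6 true)))
        (cases 5 (seq (pop 6) (push 6 true)) (seq (pop 6) (push 6 true)) skip))
      (seq (pop 8) (pop 5))))

/-- Register contents during the search. -/
def searchStore (h : ℕ → List Bool) (r u : List Bool) (m : Bool) (f : List Bool) :
    ℕ → List Bool :=
  update (update (update (update h 8 r) 5 u) 6 (if m then [] else [true])) 7 f

theorem det_searchStep_nil (h : ℕ → List Bool) (u : List Bool) (m : Bool) (f : List Bool) :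
    Det (searchStep : Prog ι) (searchStore h [] u m f) (searchStore h [] u m f) 2 := by
  refine Det.cases (B := 1) ?_
  simp only [searchStore, update_apply, Nat.reduceEqDiff, if_true, if_false]
  exact Det.skip

/-- The mark `true` announces a bit of the listed string, which has to agree with the top of what is
left of the pattern; an exhausted pattern has no top and counts as a mismatch. -/
theorem det_searchStep_bit (h : ℕ → List Bool) (b : Bool) (r u : List Bool) (m : Bool)
    (f : List Bool) :
    Det (searchStep : Prog ι) (searchStore h (true :: b :: r) u m f)
      (searchStore h r u.tail (m && decide (u.head? = some b)) f) 10 := by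
  have inner : Det (cases 8 skip
        (cases 5 (seq (pop 6) (push 6 true)) skip (seq (pop 6) (push 6 true)))
        (cases 5 (seq (pop 6) (push 6 true)) (seq (pop 6) (push 6 true)) skip) : Prog ι)
      (searchStore h (b :: r) u m f)
      (searchStore h (b :: r) u (m && decide (u.head? = some b)) f) 4 := by
    have mismatch : Det (seq (pop 6) (push 6 true) : Prog ι) (searchStore h (b :: r) u m f)
        (searchStore h (b :: r) u false f) 2 := by
      refine ((Det.pop _).seq (Det.push _ _)).congr ?_ le_rfl
      funext i
      cases m <;> simp only [searchStore, update_apply] <;> split_ifs <;> first | omega | simp_all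
    have same : Det (skip : Prog ι) (searchStore h (b :: r) u m f)
        (searchStore h (b :: r) u m f) 2 := Det.skip.mono one_le_two
    refine Det.cases (B := 3) ?_
    rw [show searchStore h (b :: r) u m f 8 = b :: r by simp [searchStore]]
    have h5 : searchStore h (b :: r) u m f 5 = u := by simp [searchStore]
    cases b <;> refine Det.cases (B := 2) ?_ <;> rw [h5] <;>
      rcases u with _ | ⟨_ | _, u⟩ <;> simpa [branch] using by assumption
  refine Det.cases (B := 9) ?_
  rw [show searchStore h (true :: b :: r) u m f 8 = true :: b :: r by simp [searchStore]]
  have first : Det (pop 8 : Prog ι) (searchStore h (true :: b :: r) u m f)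
      (searchStore h (b :: r) u m f) 1 := by
    refine (Det.pop _).congr ?_ le_rfl
    funext i
    simp only [searchStore, update_apply]
    split_ifs <;> first | omega | simp_all
  refine (first.seq (inner.seq ((Det.pop 8).seq (Det.pop 5)))).congr ?_ (by omega)
  funext i
  simp only [searchStore, update_apply]
  split_ifs <;> first | omega | simp_all

/-- At the end of a listed string there is a match if no bit differed and nothing of the pattern is
left. The pattern is then restored for the next string. -/
theorem det_searchStep_sep {h : ℕ → List Bool} (h3 : h 3 = []) (r u : List Bool) (m : Bool)
    (f : List Bool) :
    Det (searchStep : Prog ι) (searchStore h (false :: r) u m f)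
      (searchStore h r (h 0) true (if m = true ∧ u = [] then true :: f else f))
      (2 * u.length + 9 * (h 0).length + 10) := by
  have first : Det (pop 8 : Prog ι) (searchStore h (false :: r) u m f)
      (searchStore h r u m f) 1 := by
    refine (Det.pop _).congr ?_ le_rfl
    funext i
    simp only [searchStore, update_apply]
    split_ifs <;> first | omega | simp_all
  have second : Det (cases 6 (cases 5 (push 7 true) skip skip) skip skip : Prog ι)
      (searchStore h r u m f)
      (searchStore h r u m (if m = true ∧ u = [] then true :: f else f)) 3 := by
    refine Det.cases (B := 2) ?_
    rw [show searchStore h r u m f 6 = if m then [] else [true] by simp [searchStore]]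
    rcases m with _ | _
    · exact Det.skip.congr (by simp) one_le_two
    · refine Det.cases (B := 1) ?_
      rw [show searchStore h r u true f 5 = u by simp [searchStore]]
      rcases u with _ | ⟨_ | _, u⟩
      · refine (Det.push _ _).congr ?_ le_rfl
        funext i
        simp only [searchStore, update_apply]
        split_ifs <;> first | omega | simp_all
      · exact Det.skip.congr (by simp) le_rfl
      · exact Det.skip.congr (by simp) le_rfl
  refine Det.cases (B := 2 * u.length + 9 * (h 0).length + 9) ?_
  rw [show searchStore h (false :: r) u m f 8 = false :: r by simp [searchStore]]
  refine (first.seq (second.seq ((Det.pop 6).seq ((det_clear 5 _).seq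
    (det_copy (by decide) (by decide) (by decide) ?_))))).congr ?_ ?_
  · simp [searchStore, h3]
  · funext i
    simp only [searchStore, update_apply]
    split_ifs <;> first | omega | simp_all
  · simp [searchStore]
    omega

theorem det_search_string {h : ℕ → List Bool} (h3 : h 3 = []) (w r u : List Bool) (m : Bool)
    (f : List Bool) :
    DetPasses (searchStep : Prog ι) (w.length + 1)
      (searchStore h ((w.flatMap fun b => [true, b]) ++ false :: r) u m f)
      (searchStore h r (h 0) true (if m = true ∧ w = u then true :: f else f))
      (11 * w.length + 2 * u.length + 9 * (h 0).length + 11) := by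
  induction w generalizing u m with
  | nil =>
    exact (Det.passes_succ (det_searchStep_sep h3 r u m f) Det.passes_zero).congr
      (by simp [eq_comm]) (by simp)
  | cons b w ih =>
    refine (Det.passes_succ (det_searchStep_bit h b _ u m f) (ih u.tail _)).congr ?_ ?_
    · congr 1
      rcases u with _ | ⟨c, u⟩
      · simp
      · refine if_congr ?_ rfl rfl
        simp only [List.head?_cons, Option.some.injEq, Bool.and_eq_true, decide_eq_true_eq,
          List.tail_cons, List.cons.injEq]
        constructor
        · rintro ⟨⟨a, b⟩, c⟩; exact ⟨a, b.symm, c⟩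
        · rintro ⟨a, b, c⟩; exact ⟨⟨a, b.symm⟩, c⟩
    · simp only [List.length_cons, List.length_tail]
      omega

/-- Register 7 collects one bit per match; only whether it is empty will matter, so its contents are
existential. -/
theorem det_search_list {h : ℕ → List Bool} (h3 : h 3 = []) (W : List (List Bool))
    (f : List Bool) : ∃ f', (f' = [] ↔ f = [] ∧ h 0 ∉ W) ∧
    DetPasses (searchStep : Prog ι) (W.map fun w => w.length + 1).sum
      (searchStore h (encodeList W) (h 0) true f) (searchStore h [] (h 0) true f')
      ((11 * (h 0).length + 11) * (W.map fun w => w.length + 1).sum) := by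
  induction W generalizing f with
  | nil => exact ⟨f, by simp, Det.passes_zero.congr rfl (by simp)⟩
  | cons w W ih =>
    obtain ⟨f', hf', H⟩ := ih (if w = h 0 then true :: f else f)
    refine ⟨f', ?_, ?_⟩
    · rw [hf']
      by_cases hw : w = h 0
      · simp [hw]
      · simp [hw, Ne.symm hw]
    · have H' := (det_search_string (ι := ι) h3 w (encodeList W) (h 0) true f).append
        (by simpa only [true_and] using H)
      simp only [List.map_cons, List.sum_cons]
      have e : encodeList (w :: W) =
        (w.flatMap fun b => [true, b]) ++ false :: encodeList W := by simp [encodeList]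
      rw [e]
      refine H'.congr rfl ?_
      rw [mul_add]
      gcongr
      nlinarith

/-- Find out if `true :: w` is listed on register 8, where `w` is on register 0. -/
def search : Prog ι := seq (push 0 true) (seq (copy 0 5 3) (loop 8 searchStep))

/-- The search reads a mark and its bit in one pass, so useful passes and encoded bits are counted
differently; the counts agree up to a factor 2. -/
theorem length_encodeList (W : List (List Bool)) :
    (W.map fun w => w.length + 1).sum ≤ (encodeList W).length ∧
      (encodeList W).length ≤ 2 * (W.map fun w => w.length + 1).sum := by
  induction W with
  | nil => simp [encodeList]
  | cons w W ih =>
    have hw : (w.flatMap fun b => [true, b]).length = 2 * w.length := by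
      induction w with
      | nil => rfl
      | cons b w ihw => simp [ihw]; omega
    have e : encodeList (w :: W) =
      (w.flatMap fun b => [true, b]) ++ false :: encodeList W := by simp [encodeList]
    simp only [e, List.length_append, List.map_cons, List.sum_cons, hw, List.length_cons]
    omega

theorem det_search {h : ℕ → List Bool} {W : List (List Bool)} (h3 : h 3 = []) (h5 : h 5 = [])
    (h6 : h 6 = []) (h7 : h 7 = []) (h8 : h 8 = encodeList W) {n : ℕ} (hn : (h 0).length ≤ n)
    (hW : (W.map fun w => w.length + 1).sum ≤ n) : ∃ f, (f = [] ↔ true :: h 0 ∉ W) ∧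
    Det (search : Prog ι) h (searchStore (update h 0 (true :: h 0)) [] (true :: h 0) true f)
      (40 * (n + 1) * (n + 1)) := by
  obtain ⟨f, hf, H⟩ := det_search_list (ι := ι) (h := update h 0 (true :: h 0)) (by simpa using h3)
    W []
  obtain ⟨l₁, l₂⟩ := length_encodeList W
  obtain ⟨d, hd⟩ := Nat.exists_eq_add_of_le l₁
  -- The loop has as many passes as the encoding has bits. The `d` surplus passes find register 8
  -- empty and do nothing.
  have idle : ∀ k (u f : List Bool), DetPasses (searchStep : Prog ι) k
      (searchStore (update h 0 (true :: h 0)) [] u true f)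
      (searchStore (update h 0 (true :: h 0)) [] u true f) (3 * k) := by
    intro k u f
    induction k with
    | zero => exact Det.passes_zero
    | succ k ih => exact (Det.passes_succ (det_searchStep_nil _ _ _ _) ih).congr rfl (by omega)
  refine ⟨f, by simpa using hf, ?_⟩
  have H' := H.append (idle d _ f)
  rw [← hd] at H'
  simp only [Function.update_self] at H'
  have start : Det (seq (push 0 true) (copy 0 5 3) : Prog ι) h
      (searchStore (update h 0 (true :: h 0)) (encodeList W) (true :: h 0) true [])
      (9 * (n + 1) + 3) := by
    refine ((Det.push 0 true).seq (det_copy (by decide) (by decide) (by decide) ?_)).congr ?_ ?_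
    · simpa using h3
    · funext i
      simp only [searchStore, update_apply]
      split_ifs <;> first | omega | simp_all
    · simp
      omega
  have hl : Det (loop 8 searchStep : Prog ι)
      (searchStore (update h 0 (true :: h 0)) (encodeList W) (true :: h 0) true [])
      (searchStore (update h 0 (true :: h 0)) [] (true :: h 0) true f) _ :=
    Det.loop (by
      rw [show searchStore (update h 0 (true :: h 0)) (encodeList W) (true :: h 0) true [] 8 =
        encodeList W by simp [searchStore]]
      exact H')
  refine (start.seq hl).assoc.mono ?_
  have h₁ : (11 * (true :: h 0).length + 11) * (W.map fun w => w.length + 1).sum ≤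
      (11 * (n + 1) + 11) * n := by
    gcongr; simpa using hn
  have h₂ : d ≤ n := by omega
  nlinarith

end Prog

/-! ### Handlers that record replies: fresh outputs and the validity test -/

open Prog PMF
open Function (update update_apply)

/-- The algorithm does nothing, except that it empties register 0. -/
theorem Prog.lift_clear_zero {κ σ : Type} (O : Oracle κ σ) (s : σ) (t : ℕ) {δ : Type} (q : δ)
    {Q : Config σ → δ → Prop} (h : ℕ → List Bool)
    (H : ∀ T ≤ 2 * (h 0).length + 1, Q ⟨update h 0 [], s, t + T⟩ q) :
    Lift Q ((clear 0 : Prog κ).run O ⟨h, s, t⟩) (PMF.pure q) := by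
  obtain ⟨T, hT, e⟩ := det_clear (ι := κ) 0 h
  rw [e]
  exact Lift.pure (H T hT)

/-- A bound for the running times of handlers. -/
noncomputable def handlerCost : Polynomial ℕ := 100 * (Polynomial.X + 1) ^ 2

theorem eval_handlerCost (n : ℕ) : handlerCost.eval n = 100 * ((n + 1) * (n + 1)) := by
  simp [handlerCost, sq]

/-- Among the programs charged to `handlerCost`, only those that search the record need the square.
-/
theorem le_handlerCost {a n : ℕ} (h : a ≤ 100 * (n + 1)) : a ≤ handlerCost.eval n := by
  rw [eval_handlerCost]
  exact h.trans (Nat.mul_le_mul_left _ (Nat.le_mul_of_pos_left _ (Nat.succ_pos n)))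

/-- The registers 0 to 7 are empty. -/
def Idle (h : ℕ → List Bool) : Prop := ∀ i < 8, h i = []

theorem idle_update_zero {h : ℕ → List Bool} {n : ℕ} (hn : 8 ≤ n)
    (H : ∀ i, 0 < i → i < n → h i = []) : Idle (update h 0 []) := by
  intro i hi
  by_cases hi0 : i = 0
  · simp [hi0]
  · rw [Function.update_of_ne hi0, H i (by omega) (by omega)]

/-- Register contents that stand for a list of recorded replies. -/
def RecordRep (W : List (List Bool)) (h : ℕ → List Bool) : Prop := Idle h ∧ h 8 = encodeList W

/-- Forward the query to the oracle `o` and record the reply. -/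
def recordStep {κ : Type} (o : κ) : Prog κ :=
  seq (call o 0 1 2) (seq record (seq (clear 0) (clear 1)))

/-- Forward the query to the oracle `o` and record the reply. -/
noncomputable def recordDist {ι κ σ : Type} (o : κ) (O : Oracle κ σ) :
    Oracle ι (List (List Bool) × σ) :=
  fun s _ x y => (O s.2 o x y).map fun r => (r.1, (r.1 :: s.1, r.2))

theorem lift_recordStep {κ σ : Type} (o : κ) (O : Oracle κ σ) {L : ℕ}
    (hO : ∀ s o x y, ∀ r ∈ (O s o x y).support, r.1.length ≤ L) {ι : Type} (i : ι)
    {W : List (List Bool)} (s : σ) (t : ℕ) {h : ℕ → List Bool} (x y : List Bool)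
    (hR : RecordRep W h) :
    Lift (fun c (r : List Bool × (List (List Bool) × σ)) => ∃ h' : ℕ → List Bool,
        c.store = update h' 2 r.1 ∧ RecordRep r.2.1 h' ∧ c.oracle = r.2.2 ∧
        c.time ≤ t + (12 * L + 2 * (x.length + y.length) + 15) ∧ r.1.length ≤ L ∧
        (r.2.1.map fun w => w.length + 1).sum ≤
          (W.map fun w => w.length + 1).sum + (x.length + y.length + L + 1))
      ((recordStep o).run O ⟨update (update h 0 x) 1 y, s, t⟩) (recordDist o O (W, s) i x y) := by
  obtain ⟨hI, h8⟩ := hR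
  rw [recordStep, run_call_seq]
  refine Lift.bind (R := fun r r' => r = r' ∧ r.1.length ≤ L) (Lift.refl fun r hr =>
    ⟨rfl, hO _ _ _ _ r (by simpa [update_apply] using hr)⟩) ?_
  rintro ⟨r, s'⟩ _ ⟨rfl, hr⟩
  simp only at hr
  obtain ⟨T, hT, e⟩ := ((det_record (ι := κ) (W := W)
    (h := update (update (update h 0 x) 1 y) 2 r) (by simp [hI 3]) (by simp [h8])).seq
      ((det_clear 0 _).seq (det_clear 1 _)))
  simp only [e, Function.comp]
  refine Lift.pure ⟨update h 8 (encodeList (r :: W)), ?_, ⟨fun i hi => ?_, by simp⟩, rfl, ?_, hr, ?_⟩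
  · have h0 := hI 0 (by norm_num)
    have h1 := hI 1 (by norm_num)
    funext i
    simp only [update_apply]
    split_ifs <;> first | omega | (subst_vars; simp [h0, h1])
  · rw [Function.update_of_ne (by omega), hI i hi]
  · simp at hT ⊢
    omega
  · simp
    omega

theorem recordDist_length_le {ι κ σ : Type} (o : κ) {O : Oracle κ σ} {L : ℕ}
    (hO : ∀ s o x y, ∀ r ∈ (O s o x y).support, r.1.length ≤ L) :
    ∀ s (i : ι) x y, ∀ r ∈ (recordDist o O s i x y).support, r.1.length ≤ L := by
  intro s i x y r hr
  obtain ⟨r', hr', rfl⟩ := (mem_support_map_iff _ _ _).1 hr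
  exact hO _ _ _ _ r' hr'

/-- Output a string that is different from all ciphertexts received if the algorithm outputs
one of them. -/
noncomputable def freshHandler : Handler Unit Unit where
  State := List (List Bool)
  Rep := RecordRep
  size W := (W.map fun w => w.length + 1).sum
  width := 9
  cost := handlerCost
  start := clear 0
  step _ := recordStep ()
  finish := seq (loop 8 (push 4 true)) (seq search
    (cases 7 (seq (move 1 3) (move 3 2)) (move 4 2) (move 4 2)))
  startDist _ := PMF.pure []
  stepDist O := recordDist () O
  finishDist _ s x := PMF.pure
    (if true :: x ∈ s.1 then List.replicate (encodeList s.1).length true else x, s.2)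
  width_gt := by norm_num
  rep_empty h := ⟨h.1 0 (by norm_num), h.1 1 (by norm_num), h.1 2 (by norm_num),
    h.1 3 (by norm_num)⟩
  start_spec O s t w h h0 h1 := by
    refine lift_clear_zero O s t _ h fun T hT =>
      ⟨⟨idle_update_zero (by norm_num) h1, ?_⟩, rfl, ?_, rfl⟩
    · simp [h1 8, encodeList]
    · rw [h0] at hT
      exact Nat.add_le_add_left (hT.trans (le_handlerCost (by omega))) t
  step_spec O L hO o W s t h x y hR := by
    refine (lift_recordStep () O hO o s t x y hR).mono ?_
    rintro c r ⟨h', h₁, h₂, h₃, h₄, h₅, h₆⟩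
    refine ⟨h', h₁, h₂, h₃, h₄.trans (Nat.add_le_add_left (le_handlerCost (by omega)) t), h₅, h₆⟩
  finish_spec O L hO W s t h x hR := by
    obtain ⟨hI, h8⟩ := hR
    set n := x.length + (W.map fun w => w.length + 1).sum + L with hn
    have hl := (length_encodeList W).2
    obtain ⟨f, hf, H⟩ := det_search (ι := Unit) (W := W) (n := n)
      (h := update (update (update h 0 x) 1 x) 4
        (List.replicate (encodeList W).length true)) (by simp [hI 3])
      (by simp [hI 5]) (by simp [hI 6]) (by simp [hI 7]) (by simp [h8])
      (by simp; omega) (by omega)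
    have hp : Det (loop 8 (push 4 true) : Prog Unit) (update (update h 0 x) 1 x)
        (update (update (update h 0 x) 1 x) 4 (List.replicate (encodeList W).length true))
        (4 * n + 1) := by
      refine (det_pushLoop 8 4 true _).congr ?_ ?_
      · simp [h8, hI 4]
      · simp [h8]
        omega
    set G := searchStore (update (update (update (update h 0 x) 1 x) 4
      (List.replicate (encodeList W).length true)) 0 (true :: x)) [] (true :: x) true f with hG
    have hfin : ∃ g : ℕ → List Bool, g 2 = (if true :: x ∈ W then
        List.replicate (encodeList W).length true else x) ∧ g 3 = [] ∧
        Det (cases 7 (seq (move 1 3) (move 3 2)) (move 4 2) (move 4 2) : Prog Unit) G g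
          (8 * n + 3) := by
      by_cases hx : true :: x ∈ W
      -- The replacement string is constant, so a single, reversing move is enough.
      · have hm := det_move (ι := Unit) (x := 4) (y := 2) (by decide) G
        refine ⟨update (update G 2 ((G 4).reverse ++ G 2)) 4 [], ?_, ?_,
          Det.cases (B := 8 * n + 2) ?_⟩
        rotate_left 2
        · rw [show G 7 = f by simp [hG, searchStore]]
          have : f ≠ [] := fun h => hf.1 h (by simpa using hx)
          rcases f with _ | ⟨_ | _, f⟩
          · exact absurd rfl this
          · refine hm.mono ?_
            simp [hG, searchStore]
            omega
          · refine hm.mono ?_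
            simp [hG, searchStore]
            omega
        · simp [hG, searchStore, hx, hI 2]
        · simp [hG, searchStore, hI 3]
      · set g := update (update G 3 ((G 1).reverse ++ G 3)) 1 [] with hg
        refine ⟨update (update g 2 ((g 3).reverse ++ g 2)) 3 [], ?_, ?_,
          Det.cases (B := 8 * n + 2) ?_⟩
        rotate_left 2
        · rw [show G 7 = f by simp [hG, searchStore], hf.2 (by simpa using hx)]
          refine Det.mono ((det_move (by decide) G).seq (det_move (by decide) _)) ?_
          simp [hG, searchStore, hI 3]
          omega
        · simp [hg, hG, searchStore, hx, hI 2, hI 3]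
        · simp
    obtain ⟨g, hg2, hg3, hg⟩ := hfin
    obtain ⟨T, hT, e⟩ := hp.seq (H.seq hg)
    rw [e]
    refine Lift.pure ⟨update g 2 [], ?_, by simp, by simp [hg3], rfl, ?_, ?_⟩
    · simp [← hg2]
    · refine Nat.add_le_add_left (hT.trans ?_) t
      rw [eval_handlerCost, mul_assoc]
      have : n + 1 ≤ (n + 1) * (n + 1) := Nat.le_mul_of_pos_left _ (Nat.succ_pos n)
      omega
    · refine le_handlerCost ?_
      simp only
      split_ifs
      · simp
        omega
      · omega
  step_length_le O L hO := recordDist_length_le () hO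

theorem Prog.branch_of_ne_nil {ι : Type} {w : List Bool} (hw : w ≠ []) (e f : Prog ι) :
    branch w e f f = f := by
  rcases w with _ | ⟨_ | _, _⟩
  · exact absurd rfl hw
  · rfl
  · rfl

/-- Output a bit that tells if the algorithm outputs a ciphertext that it received, or a valid
one. -/
noncomputable def validHandler : Handler Unit AEOracle where
  State := List (List Bool)
  Rep := RecordRep
  size W := (W.map fun w => w.length + 1).sum
  width := 9
  cost := handlerCost
  start := clear 0
  step _ := recordStep AEOracle.enc
  finish := seq (call AEOracle.dec 0 6 4) (seq search
    (cases 7 (cases 4 skip (push 2 true) (push 2 true)) (push 2 true) (push 2 true)))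
  startDist _ := PMF.pure []
  stepDist O := recordDist AEOracle.enc O
  finishDist O s x := (O s.2 AEOracle.dec x []).map fun r =>
    (if true :: x ∈ s.1 ∨ r.1 ≠ [] then [true] else [], r.2)
  width_gt := by norm_num
  rep_empty h := ⟨h.1 0 (by norm_num), h.1 1 (by norm_num), h.1 2 (by norm_num),
    h.1 3 (by norm_num)⟩
  start_spec O s t w h h0 h1 := by
    refine lift_clear_zero O s t _ h fun T hT =>
      ⟨⟨idle_update_zero (by norm_num) h1, ?_⟩, rfl, ?_, rfl⟩
    · simp [h1 8, encodeList]
    · rw [h0] at hT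
      exact Nat.add_le_add_left (hT.trans (le_handlerCost (by omega))) t
  step_spec O L hO o W s t h x y hR := by
    refine (lift_recordStep AEOracle.enc O hO o s t x y hR).mono ?_
    rintro c r ⟨h', h₁, h₂, h₃, h₄, h₅, h₆⟩
    exact ⟨h', h₁, h₂, h₃, h₄.trans (Nat.add_le_add_left (le_handlerCost (by omega)) t), h₅, h₆⟩
  finish_spec O L hO W s t h x hR := by
    obtain ⟨hI, h8⟩ := hR
    set n := x.length + (W.map fun w => w.length + 1).sum + L with hn
    rw [run_call_seq]
    simp only [update_apply, OfNat.ofNat_ne_zero, OfNat.ofNat_ne_one, if_true,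
      if_false, zero_ne_one, hI 6 (by norm_num)]
    refine Lift.bind (R := fun r r' => r = r') (Lift.refl fun r hr => rfl) ?_
    rintro ⟨r, s'⟩ _ rfl
    obtain ⟨f, hf, H⟩ := det_search (ι := AEOracle) (W := W) (n := n)
      (h := update (update (update h 0 x) 1 x) 4 r) (by simp [hI 3])
      (by simp [hI 5]) (by simp [hI 6]) (by simp [hI 7]) (by simp [h8])
      (by simp; omega) (by omega)
    set G := searchStore (update (update (update (update h 0 x) 1 x) 4 r) 0 (true :: x)) []
      (true :: x) true f with hG
    have hfin : Det (cases 7 (cases 4 skip (push 2 true) (push 2 true))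
        (push 2 true) (push 2 true) : Prog AEOracle) G
        (update G 2 (if true :: x ∈ W ∨ r ≠ [] then [true] else [])) 3 := by
      have hG2 : G 2 = [] := by simp [hG, searchStore, hI 2]
      have hpush : Det (push 2 true : Prog AEOracle) G (update G 2 [true]) 1 :=
        (Det.push _ _).congr (by rw [hG2]) le_rfl
      refine Det.cases (B := 2) ?_
      rw [show G 7 = f by simp [hG, searchStore]]
      by_cases hx : true :: x ∈ W
      · rw [branch_of_ne_nil fun h => hf.1 h (by simpa using hx), if_pos (Or.inl hx)]
        exact hpush.mono (by norm_num)
      · rw [hf.2 (by simpa using hx)]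
        refine Det.cases (B := 1) ?_
        rw [show G 4 = r by simp [hG, searchStore]]
        by_cases hr : r = []
        · subst hr
          exact Det.skip.congr (by simp [hx, ← hG2]) le_rfl
        · rw [branch_of_ne_nil hr, if_pos (Or.inr hr)]
          exact hpush
    obtain ⟨T, hT, e⟩ := H.seq hfin
    simp only [e, Function.comp]
    refine Lift.pure ⟨update G 2 [], by simp, by simp, ?_, rfl, ?_, ?_⟩
    · simp [hG, searchStore, hI 3]
    · rw [eval_handlerCost]
      have : n + 1 ≤ (n + 1) * (n + 1) := Nat.le_mul_of_pos_left _ (Nat.succ_pos n)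
      rw [mul_assoc] at hT
      change t + 1 + T ≤ _
      omega
    · refine le_handlerCost ?_
      simp only
      split_ifs <;> simp
      omega
  step_length_le O L hO := recordDist_length_le AEOracle.enc hO

/-! ### The handler that encrypts one side of each query -/

/-- The first nonempty reply in a list of replies, the latest of which comes first. -/
def firstReply : List (List Bool) → List Bool
  | [] => []
  | r :: W => if firstReply W = [] then r else firstReply W

theorem length_firstReply_le (W : List (List Bool)) :
    (firstReply W).length ≤ (W.map List.length).sum := by
  induction W with
  | nil => simp [firstReply]
  | cons r W ih =>
    rw [firstReply]
    split_ifs <;> simp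
    omega

/-- Compare the lengths of registers 0 and 1. -/
def compareLengths {ι : Type} : Prog ι :=
  seq (loop 0 (push 4 true)) (seq (loop 1 (pop 4)) (seq (loop 1 (push 5 true)) (loop 0 (pop 5))))

/-- Truncated subtraction in both directions: the lengths agree exactly if registers 4 and 5 both
end up empty. -/
theorem det_compareLengths {ι : Type} {h : ℕ → List Bool} (h4 : h 4 = []) (h5 : h 5 = []) :
    Det (compareLengths : Prog ι) h
      (update (update h 4 (List.replicate ((h 0).length - (h 1).length) true)) 5
        (List.replicate ((h 1).length - (h 0).length) true))
      (4 * ((h 0).length + (h 1).length) + 4) := by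
  refine ((det_pushLoop 0 4 true h).seq ((det_popLoop 1 4 _).seq
    ((det_pushLoop 1 5 true _).seq (det_popLoop 0 5 _)))).congr ?_ ?_
  · funext i
    simp only [update_apply]
    split_ifs <;> first | contradiction | omega | simp [h4, h5]
  · simp [h4, h5]
    omega

/-- Encrypt one of the two strings in each query; in the end, output a ciphertext that was received
if the algorithm outputs `true`, and a string that is longer than all of them otherwise. -/
noncomputable def selectHandler (b : Bool) : Handler Unit Unit where
  State := List (List Bool)
  Rep W h := Idle h ∧ h 8 = List.replicate (W.map List.length).sum true ∧ h 9 = firstReply W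
  size W := (W.map List.length).sum
  width := 10
  cost := handlerCost
  start := clear 0
  step _ := seq compareLengths (seq (cases 4 (cases 5
      (seq (call () (if b then 1 else 0) 6 2)
        (seq (loop 2 (push 8 true)) (cases 9 (copy 2 9 3) skip skip))) skip skip) skip skip)
    (seq (clear 0) (seq (clear 1) (seq (clear 4) (clear 5)))))
  finish := cases 0 (move 8 2) (move 8 2) (cases 9 (move 8 2)
    (seq (pop 9) (seq (move 9 3) (move 3 2))) (seq (pop 9) (seq (move 9 3) (move 3 2))))
  startDist _ := PMF.pure []
  stepDist O s _ x y :=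
    if x.length = y.length then
      (O s.2 () (if b then y else x) []).map fun r => (r.1, (r.1 :: s.1, r.2))
    else PMF.pure ([], s)
  finishDist _ s x := PMF.pure (if x.head? = some true ∧ firstReply s.1 ≠ [] then
    (firstReply s.1).tail else List.replicate (s.1.map List.length).sum true, s.2)
  width_gt := by norm_num
  rep_empty h := ⟨h.1 0 (by norm_num), h.1 1 (by norm_num), h.1 2 (by norm_num),
    h.1 3 (by norm_num)⟩
  start_spec O s t w h h0 h1 := by
    refine lift_clear_zero O s t _ h fun T hT =>
      ⟨⟨idle_update_zero (by norm_num) h1, ?_, ?_⟩, rfl, ?_, rfl⟩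
    · simp [h1 8]
    · simp [h1 9, firstReply]
    · rw [h0] at hT
      exact Nat.add_le_add_left (hT.trans (le_handlerCost (by omega))) t
  step_spec O L hO o W s t h x y hR := by
    obtain ⟨hI, h8, h9⟩ := hR
    have h0 := hI 0 (by norm_num)
    have h1 := hI 1 (by norm_num)
    have h2 := hI 2 (by norm_num)
    have h3 := hI 3 (by norm_num)
    have h4 := hI 4 (by norm_num)
    have h5 := hI 5 (by norm_num)
    have h6 := hI 6 (by norm_num)
    have hW := length_firstReply_le W
    have hcmp := det_compareLengths (ι := Unit) (h := update (update h 0 x) 1 y)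
      (by simp [h4]) (by simp [h5])
    -- Strings of different lengths cannot both be plaintexts, so such a query gets the reply `⊥`
    -- without a call.
    by_cases hxy : x.length = y.length
    · have hcmp : Det (compareLengths : Prog Unit) (update (update h 0 x) 1 y)
          (update (update h 0 x) 1 y) (4 * (x.length + y.length) + 4) := by
        refine hcmp.congr ?_ (by simp)
        funext i
        simp only [update_apply]
        split_ifs <;> first | contradiction | omega | (subst_vars; simp [h4, h5, hxy])
      obtain ⟨T, hT, e⟩ := hcmp.run_seq_eq
      have hb4 : update (update h 0 x) 1 y 4 = [] := by simp [h4]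
      have hb5 : update (update h 0 x) 1 y 5 = [] := by simp [h5]
      rw [e, run_seq]
      simp only [run_cases, hb4, branch, Config.tick, hb5]
      rw [run_call_seq, PMF.bind_bind, if_pos hxy,
        show update (update h 0 x) 1 y (if b then 1 else 0) = if b then y else x by
          cases b <;> simp, show update (update h 0 x) 1 y 6 = [] by simp [h6]]
      refine Lift.bind (R := fun r r' => r = r' ∧ r.1.length ≤ L)
        (Lift.refl fun r hr => ⟨rfl, hO _ _ _ _ r hr⟩) ?_
      rintro ⟨r, s'⟩ _ ⟨rfl, hr⟩
      have hcopy : Det (cases 9 (copy 2 9 3) skip skip : Prog Unit)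
          (update (update (update (update h 0 x) 1 y) 2 r) 8
            (List.replicate ((r :: W).map List.length).sum true))
          (update (update (update (update (update h 0 x) 1 y) 2 r) 8
            (List.replicate ((r :: W).map List.length).sum true)) 9 (firstReply (r :: W)))
          (9 * r.length + 3) := by
        refine Det.cases (B := 9 * r.length + 2) ?_
        rw [show (update (update (update (update h 0 x) 1 y) 2 r) 8
            (List.replicate ((r :: W).map List.length).sum true)) 9 = firstReply W by simp [h9]]
        -- A reply is stored only while all earlier ones were empty.
        by_cases hf : firstReply W = []
        · rw [hf]
          refine (det_copy (by decide) (by decide) (by decide) (by simp [h3])).congr ?_ (by simp)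
          simp [firstReply, hf, h9]
        · rw [branch_of_ne_nil hf]
          refine Det.skip.congr ?_ (by omega)
          simp [firstReply, hf, h9]
      have hpush : Det (loop 2 (push 8 true) : Prog Unit) (update (update (update h 0 x) 1 y) 2 r)
          (update (update (update (update h 0 x) 1 y) 2 r) 8
            (List.replicate ((r :: W).map List.length).sum true)) (2 * r.length + 1) := by
        refine (det_pushLoop _ _ _ _).congr ?_ (by simp)
        simp [h8]
      have hrest := (hpush.seq hcopy).seq ((det_clear 0 _).seq ((det_clear 1 _).seq
        ((det_clear 4 _).seq (det_clear 5 _))))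
      obtain ⟨T', hT', e'⟩ := hrest
      have e' := e' _ O s' (t + T + 1 + 1 + 1)
      rw [run_seq] at e'
      simp only [Function.comp]
      rw [e']
      refine Lift.pure ⟨update (update h 8 (List.replicate ((r :: W).map List.length).sum true)) 9
        (firstReply (r :: W)), ?_, ⟨fun i hi => ?_, ?_, ?_⟩, rfl, ?_, hr, ?_⟩
      · funext i
        simp only [update_apply]
        split_ifs <;> first | contradiction | omega | (subst_vars; simp [h0, h1, h4, h5])
      · rw [Function.update_of_ne (by omega), Function.update_of_ne (by omega), hI i hi]
      · simp
      · simp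
      · refine le_trans ?_ (Nat.add_le_add_left (le_handlerCost (a := 6 * (x.length + y.length) +
          11 * r.length + 20) (by simp only at hr; omega)) t)
        simp [h4, h5] at hT' ⊢
        omega
      · simp at hr ⊢
        omega
    · set G := update (update (update (update h 0 x) 1 y) 4
        (List.replicate (x.length - y.length) true)) 5
        (List.replicate (y.length - x.length) true) with hG
      have hcmp : Det (compareLengths : Prog Unit) (update (update h 0 x) 1 y) G
          (4 * (x.length + y.length) + 4) := hcmp.congr (by simp [hG]) (by simp)
      have hskip : Det (cases 4 (cases 5 (seq (call () (if b then 1 else 0) 6 2)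
          (seq (loop 2 (push 8 true)) (cases 9 (copy 2 9 3) skip skip))) skip skip) skip skip :
          Prog Unit) G G 3 := by
        refine Det.cases (B := 2) ?_
        by_cases hlt : y.length < x.length
        · rw [branch_of_ne_nil (by simp [hG]; omega)]
          exact Det.skip.mono one_le_two
        · rw [show G 4 = [] by simp [hG]; omega]
          refine Det.cases (B := 1) ?_
          rw [branch_of_ne_nil (by simp [hG]; omega)]
          exact Det.skip
      have hrest := hcmp.seq (hskip.seq ((det_clear 0 _).seq
        ((det_clear 1 _).seq ((det_clear 4 _).seq (det_clear 5 _)))))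
      obtain ⟨T, hT, e⟩ := hrest
      rw [e, if_neg hxy]
      refine Lift.pure ⟨h, ?_, ⟨hI, h8, h9⟩, rfl, ?_, by simp, Nat.le_add_right _ _⟩
      · funext i
        simp only [hG, update_apply]
        split_ifs <;> first | contradiction | omega | (subst_vars; simp [h0, h1, h2, h4, h5])
      · refine Nat.add_le_add_left (hT.trans (le_handlerCost ?_)) t
        simp [hG]
        omega
  finish_spec O L hO W s t h x hR := by
    obtain ⟨hI, h8, h9⟩ := hR
    have h2 := hI 2 (by norm_num)
    have h3 := hI 3 (by norm_num)
    have hW := length_firstReply_le W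
    set g := update (update h 0 x) 1 x with hg
    set n := x.length + (W.map List.length).sum + L with hn
    set w := if x.head? = some true ∧ firstReply W ≠ [] then (firstReply W).tail
      else List.replicate (W.map List.length).sum true with hw
    have hlong : Det (move 8 2 : Prog Unit) g
        (update (update g 2 (List.replicate (W.map List.length).sum true)) 8 [])
        (4 * n + 1) := by
      refine (det_move (by decide) g).congr ?_ ?_
      · simp [hg, h8, h2]
      · simp [hg, h8]
        omega
    have hfirst : Det (seq (pop 9) (seq (move 9 3) (move 3 2)) : Prog Unit) g
        (update (update g 2 (firstReply W).tail) 9 []) (8 * n + 3) := by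
      refine ((Det.pop 9).seq ((det_move (by decide) _).seq (det_move (by decide) _))).congr ?_ ?_
      · funext i
        simp only [update_apply]
        split_ifs <;> first | contradiction | omega | (subst_vars; simp [hg, h2, h3, h9])
      · simp [hg, h9, h3]
        omega
    have hfin : ∃ g' : ℕ → List Bool, g' 2 = w ∧ g' 3 = [] ∧
        Det (cases 0 (move 8 2) (move 8 2) (cases 9 (move 8 2)
          (seq (pop 9) (seq (move 9 3) (move 3 2))) (seq (pop 9) (seq (move 9 3) (move 3 2)))) :
          Prog Unit) g g' (8 * n + 5) := by
      by_cases hx : x.head? = some true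
      · obtain ⟨x', rfl⟩ : ∃ x', x = true :: x' := by
          rcases x with _ | ⟨a, x⟩
          · simp at hx
          · exact ⟨x, by simpa using hx⟩
        by_cases hf : firstReply W = []
        · refine ⟨_, ?_, ?_, Det.cases (B := 8 * n + 4) (h' := update (update g 2
            (List.replicate (W.map List.length).sum true)) 8 []) ?_⟩
          · simp [hw, hf]
          · simp [hg, h3]
          · rw [show g 0 = true :: x' by simp [hg]]
            refine Det.cases (B := 8 * n + 3) ?_
            rw [show g 9 = [] by simp [hg, h9, hf]]
            exact hlong.mono (by omega)
        · refine ⟨_, ?_, ?_, Det.cases (B := 8 * n + 4) (h' := update (update g 2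
            (firstReply W).tail) 9 []) ?_⟩
          · simp [hw, hf]
          · simp [hg, h3]
          · rw [show g 0 = true :: x' by simp [hg]]
            refine Det.cases (B := 8 * n + 3) ?_
            rw [show g 9 = firstReply W by simp [hg, h9], branch_of_ne_nil hf]
            exact hfirst
      · refine ⟨_, ?_, ?_, Det.cases (B := 8 * n + 4) (h' := update (update g 2
            (List.replicate (W.map List.length).sum true)) 8 []) ?_⟩
        · simp [hw, hx]
        · simp [hg, h3]
        · rw [show g 0 = x by simp [hg]]
          rcases x with _ | ⟨_ | _, x⟩
          · exact hlong.mono (by omega)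
          · exact hlong.mono (by omega)
          · simp at hx
    obtain ⟨g', hg2, hg3, T, hT, e⟩ := hfin
    rw [e]
    refine Lift.pure ⟨update g' 2 [], ?_, by simp, by simp [hg3], rfl, ?_, le_handlerCost ?_⟩
    · simp [← hg2]
    · exact Nat.add_le_add_left (hT.trans (le_handlerCost (by omega))) t
    · simp only [hw]
      split_ifs
      · simp
        omega
      · simp
        omega
  step_length_le O L hO s o x y r hr := by
    by_cases hxy : x.length = y.length
    · rw [if_pos hxy] at hr
      obtain ⟨r', hr', rfl⟩ := (mem_support_map_iff _ _ _).1 hr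
      exact hO _ _ _ _ r' hr'
    · rw [if_neg hxy, support_pure, Set.mem_singleton_iff] at hr
      simp [hr]

/-! ### Random strings and the handler that offers them as right-hand plaintexts -/

theorem uniformBits_apply (l : ℕ) (w : List Bool) :
    uniformBits l w = if w.length = l then (2 ^ l : ENNReal)⁻¹ else 0 := by
  simp only [uniformBits, map_apply, uniformOfFintype_apply, Fintype.card_fun, Fintype.card_bool,
    Fintype.card_fin]
  split_ifs with hw
  · subst hw
    rw [tsum_eq_single w.get]
    · simp
    · intro v hv
      rw [if_neg]
      intro h
      apply hv
      rw [← List.ofFn_inj, ← h, List.ofFn_get]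
  · refine ENNReal.tsum_eq_zero.2 fun v => if_neg ?_
    rintro rfl
    simp at hw

theorem uniformBits_zero : uniformBits 0 = PMF.pure [] := by
  ext w
  rw [uniformBits_apply, PMF.pure_apply]
  simp

/-- The new bit is in front because `flip` pushes it on top of those drawn before. -/
theorem uniformBits_succ (l : ℕ) : uniformBits (l + 1) =
    (uniformBits l).bind fun w => (uniformOfFintype Bool).map fun b => b :: w := by
  ext w
  simp only [PMF.bind_apply, PMF.map_apply, uniformBits_apply, uniformOfFintype_apply]
  rcases w with _ | ⟨c, v⟩
  · simp
  · rw [tsum_eq_single v]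
    · have h : (∑' b : Bool, if c :: v = b :: v then ((Fintype.card Bool : ENNReal))⁻¹ else 0) =
          2⁻¹ := by
        rw [tsum_eq_single c]
        · simp
        · intro b hb; simp [Ne.symm hb]
      rw [h]
      by_cases hv : v.length = l
      · simp only [List.length_cons, hv, if_true]
        rw [pow_succ, ENNReal.mul_inv (by simp) (by simp)]
      · simp [hv]
    · intro u hu
      simp [Ne.symm hu]

theorem length_of_mem_uniformBits {l : ℕ} {w : List Bool} (hw : w ∈ (uniformBits l).support) :
    w.length = l := by
  by_contra h
  rw [mem_support_iff, uniformBits_apply, if_neg h] at hw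
  exact hw rfl

theorem Prog.run_loop_flip {κ σ : Type} (O : Oracle κ σ) (s : σ) (t : ℕ) {h : ℕ → List Bool}
    (h1 : h 1 = []) : (loop 0 (flip 1)).run O ⟨h, s, t⟩ =
      (uniformBits (h 0).length).map fun w =>
        ⟨update h 1 w, s, t + 1 + 2 * (h 0).length⟩ := by
  rw [run_loop]
  generalize (h 0).length = n
  induction n with
  | zero => simp [passes, uniformBits_zero, PMF.pure_map, Config.tick, ← h1]
  | succ n ih =>
    change (passes O (flip 1) n (⟨h, s, t⟩ : Config σ).tick).bind _ = _
    rw [ih, uniformBits_succ, PMF.bind_map, PMF.map_bind]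
    congr 1; funext w
    simp only [Function.comp, run, PMF.map_comp, Config.tick, Config.set, Function.comp_def,
      Function.update_self, Function.update_idem]
    rfl

/-- Offer a choice between the query and a random string of the same length for encryption, and
answer decryption queries by `⊥`. -/
noncomputable def randomizeHandler : Handler AEOracle Unit where
  State := Unit
  Rep _ h := Idle h
  size _ := 0
  width := 8
  cost := handlerCost
  start := clear 0
  step
    | AEOracle.enc => seq (clear 1) (seq (loop 0 (flip 1)) (seq (call () 0 1 2)
        (seq (clear 0) (clear 1))))
    | AEOracle.dec => seq (clear 0) (clear 1)
  finish := seq (clear 1) (seq (move 0 3) (move 3 2))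
  startDist _ := PMF.pure ()
  stepDist O s o x _ :=
    match o with
    | AEOracle.enc => (uniformBits x.length).bind fun w =>
        (O s.2 () x w).map fun r => (r.1, ((), r.2))
    | AEOracle.dec => PMF.pure ([], s)
  finishDist _ s x := PMF.pure (x, s.2)
  width_gt := by norm_num
  rep_empty h := ⟨h 0 (by norm_num), h 1 (by norm_num), h 2 (by norm_num), h 3 (by norm_num)⟩
  start_spec O s t w h h0 h1 := by
    refine lift_clear_zero O s t _ h fun T hT =>
      ⟨idle_update_zero (by norm_num) h1, rfl, ?_, rfl⟩
    rw [h0] at hT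
    exact Nat.add_le_add_left (hT.trans (le_handlerCost (by omega))) t
  step_spec O L hO o q s t h x y hI := by
    have h0 := hI 0 (by norm_num)
    have h1 := hI 1 (by norm_num)
    have h2 := hI 2 (by norm_num)
    cases o with
    | enc =>
      obtain ⟨T, hT, e⟩ := (det_clear (ι := Unit) 1 (update (update h 0 x) 1 y)).run_seq_eq
      simp only [e, run_seq]
      rw [run_loop_flip _ _ _ (by simp), PMF.bind_map]
      simp only [Function.update_idem, Function.update_self,
        Function.update_of_ne zero_ne_one] at hT ⊢
      refine Lift.bind (R := fun w w' => w = w' ∧ w.length = x.length)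
        (Lift.refl fun w hw => ⟨rfl, length_of_mem_uniformBits hw⟩) ?_
      rintro w _ ⟨rfl, hw⟩
      simp only [Function.comp]
      rw [run_call_seq, show update (update h 0 x) 1 w 0 = x by simp,
        show update (update h 0 x) 1 w 1 = w by simp]
      refine Lift.bind (μ := O s () x w) (ν := O s () x w)
        (R := fun r r' => r = r' ∧ r.1.length ≤ L)
        (Lift.refl fun r hr => ⟨rfl, hO _ _ _ _ r hr⟩) ?_
      rintro ⟨r, s'⟩ _ ⟨rfl, hr⟩
      obtain ⟨T', hT', e'⟩ := (det_clear (ι := Unit) 0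
        (update (update (update h 0 x) 1 w) 2 r)).seq (det_clear 1 _)
      simp only [Function.comp]
      rw [e']
      refine Lift.pure ⟨h, ?_, hI, rfl, ?_, hr, Nat.zero_le _⟩
      · funext i
        simp only [update_apply]
        split_ifs <;> first | contradiction | omega | (subst_vars; simp [h0, h1])
      · refine le_trans ?_ (Nat.add_le_add_left (le_handlerCost
          (a := 10 * (x.length + y.length) + 20) (by omega)) t)
        simp [hw] at hT' ⊢
        omega
    | dec =>
      obtain ⟨T, hT, e⟩ := (det_clear (ι := Unit) 0 (update (update h 0 x) 1 y)).seq (det_clear 1 _)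
      rw [e]
      refine Lift.pure ⟨h, ?_, hI, rfl, ?_, Nat.zero_le _, Nat.zero_le _⟩
      · funext i
        simp only [update_apply]
        split_ifs <;> first | contradiction | omega | (subst_vars; simp [h0, h1, h2])
      · refine Nat.add_le_add_left (hT.trans (le_handlerCost ?_)) t
        simp
        omega
  finish_spec O L hO q s t h x hI := by
    have h2 := hI 2 (by norm_num)
    have h3 := hI 3 (by norm_num)
    obtain ⟨T, hT, e⟩ := (det_clear (ι := Unit) 1 (update (update h 0 x) 1 x)).seq
      ((det_move (x := 0) (y := 3) (by decide) _).seq (det_move (x := 3) (y := 2) (by decide) _))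
    rw [e]
    refine Lift.pure ⟨update (update (update h 0 []) 1 []) 2 [], ?_, by simp, by simp [h3], rfl, ?_,
      le_handlerCost (by simp only; omega)⟩
    · funext i
      simp only [update_apply]
      split_ifs <;> first | contradiction | omega | (subst_vars; simp [h2, h3])
    · refine Nat.add_le_add_left (hT.trans (le_handlerCost ?_)) t
      simp [h3]
      omega
  step_length_le O L hO s o x y r hr := by
    cases o with
    | enc =>
      obtain ⟨w, _, hr⟩ := (mem_support_bind_iff _ _ _).1 hr
      obtain ⟨r', hr', rfl⟩ := (mem_support_map_iff _ _ _).1 hr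
      exact hO _ _ _ _ r' hr'
    | dec =>
      simp only [support_pure, Set.mem_singleton_iff] at hr
      simp [hr]

/-! ### Guessing a number with fair coins -/

/-- Draw `⌊log₂ D⌋ + 1` random bits, of which the first has weight `S`, and add the number that they
represent to `I`; at most `n` bits are drawn. -/
noncomputable def guessLoop : ℕ → ℕ → ℕ → ℕ → PMF ℕ
  | 0, _, _, I => PMF.pure I
  | n + 1, D, S, I =>
    if D = 0 then guessLoop n D S I
    else (uniformOfFintype Bool).bind fun b => guessLoop n (D / 2) (S + S) (if b then S + I else I)

/-- Guess a number; all numbers up to `T` are about equally likely. -/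
noncomputable def guess (T : ℕ) : PMF ℕ := guessLoop T T 1 0

/-- Induction along the binary expansion: the next coin has to be the lowest bit of `i`, which costs
a factor 2, and `i / 2 ≤ D / 2` remains to be hit. The `⌊log₂ D⌋ + 1` coins cost at most a factor `2
* D`. -/
theorem inv_le_guessLoop (n : ℕ) : ∀ D S I i, i ≤ D → D ≤ n →
    ((if D = 0 then 1 else 2 * D : ℕ) : ENNReal)⁻¹ ≤ guessLoop n D S I (S * i + I) := by
  induction n with
  | zero =>
    intro D S I i hi hD
    obtain rfl : D = 0 := by omega
    obtain rfl : i = 0 := by omega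
    simp [guessLoop]
  | succ n ih =>
    intro D S I i hi hD
    by_cases h0 : D = 0
    · subst h0
      have := ih 0 S I i hi (Nat.zero_le _)
      simpa [guessLoop] using this
    · rw [guessLoop]
      simp only [if_neg h0]
      rw [bind_apply_eq_expect]
      -- Of the two outcomes of the coin, only the one that equals the lowest bit of `i` is kept.
      refine le_trans ?_ (apply_mul_le_expect _ _ (decide (i % 2 = 1)))
      have key := ih (D / 2) (S + S) (if i % 2 = 1 then S + I else I) (i / 2) (by omega) (by omega)
      have e : (S + S) * (i / 2) + (if i % 2 = 1 then S + I else I) = S * i + I := by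
        have h2 : S * i = S * (2 * (i / 2) + i % 2) := by rw [Nat.div_add_mod]
        rw [h2]
        rcases Nat.mod_two_eq_zero_or_one i with h | h
        · rw [h, if_neg (by decide)]; ring
        · rw [h, if_pos rfl]; ring
      rw [e] at key
      have hb : (if decide (i % 2 = 1) = true then S + I else I) =
          if i % 2 = 1 then S + I else I := by simp
      rw [hb]
      refine le_trans ?_ (mul_le_mul_right key _)
      rw [uniformOfFintype_apply, Fintype.card_bool, ← ENNReal.mul_inv (by simp) (by simp)]
      refine ENNReal.inv_le_inv.2 ?_
      norm_cast
      split_ifs <;> omega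

theorem inv_le_guess {T i : ℕ} (hT : 0 < T) (hi : i ≤ T) :
    ((2 * T : ℕ) : ENNReal)⁻¹ ≤ guess T i := by
  have := inv_le_guessLoop T T 1 0 i hi le_rfl
  rwa [if_neg hT.ne', one_mul, add_zero] at this

/-! ### Register programs for powers, halving and guessing -/

namespace Prog

variable {ι : Type}

/-- Multiply the number on register 4 by the length of register 0 plus 2. -/
def multiply : Prog ι :=
  seq (loop 4 (seq (loop 0 (push 5 true)) (seq (push 5 true) (push 5 true))))
    (seq (clear 4) (move 5 4))

theorem det_multiply {h : ℕ → List Bool} {a : ℕ} (h4 : h 4 = List.replicate a true)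
    (h5 : h 5 = []) : Det (multiply : Prog ι) h
      (update h 4 (List.replicate (a * ((h 0).length + 2)) true))
      (12 * (a * ((h 0).length + 2)) + 5) := by
  have hloop : ∀ (n : ℕ) (g : ℕ → List Bool), g 0 = h 0 →
      DetPasses (seq (loop 0 (push 5 true)) (seq (push 5 true) (push 5 true)) : Prog ι) n g
        (update g 5 (List.replicate (n * ((h 0).length + 2)) true ++ g 5))
        (n * (2 * (h 0).length + 4)) := by
    intro n
    induction n with
    | zero => intro g _; exact Det.passes_zero.congr (by simp) (by simp)
    | succ n ih =>
      intro g hg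
      have step : Det (seq (loop 0 (push 5 true)) (seq (push 5 true) (push 5 true)) : Prog ι) g
          (update g 5 (List.replicate ((h 0).length + 2) true ++ g 5)) (2 * (h 0).length + 3) := by
        refine ((det_pushLoop 0 5 true g).seq ((Det.push 5 true).seq (Det.push 5 true))).congr ?_ ?_
        · simp [hg, List.replicate_succ]
        · simp [hg]
      refine (Det.passes_succ step (ih _ (by simp [hg]))).congr ?_ ?_
      · simp [add_mul, ← List.append_assoc]
      · rw [add_mul n 1]; omega
  refine ((Det.loop (hloop _ h rfl)).seq ((det_clear 4 _).seq
    (det_move (x := 5) (y := 4) (by decide) _))).congr ?_ ?_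
  · funext i
    simp only [update_apply]
    split_ifs <;> first | contradiction | omega | (subst_vars; simp [h4, h5])
  · simp [h4, h5]
    ring_nf
    omega

/-- Write the number `(n + 2) ^ k` on register 4, where `n` is the length of register 0. -/
def power : ℕ → Prog ι
  | 0 => push 4 true
  | k + 1 => seq (power k) multiply

/-- With `m` the base, the last multiplication takes at most `12 * m ^ (k + 1) + 5` steps, which is
at most `17 * m ^ (k + 1)`; hence the constant. -/
theorem det_power {h : ℕ → List Bool} (h4 : h 4 = []) (h5 : h 5 = []) (k : ℕ) :
    Det (power k : Prog ι) h (update h 4 (List.replicate (((h 0).length + 2) ^ k) true))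
      (17 * k * ((h 0).length + 2) ^ k + 1) := by
  induction k with
  | zero => exact (Det.push 4 true).congr (by simp [h4]) (by simp)
  | succ k ih =>
    refine (ih.seq (det_multiply (a := ((h 0).length + 2) ^ k) (by simp)
      (by simp [h5]))).congr ?_ ?_
    · simp [pow_succ]
    · set m := (h 0).length + 2
      have h1 : m ^ k ≤ m ^ (k + 1) := Nat.pow_le_pow_right (by omega) (Nat.le_succ k)
      have h2 : 0 < m ^ (k + 1) := Nat.pow_pos (by omega)
      have h3 : 17 * k * m ^ k ≤ 17 * k * m ^ (k + 1) := Nat.mul_le_mul_left _ h1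
      simp only [Function.update_of_ne (show (0 : ℕ) ≠ 4 by decide)]
      rw [show 17 * (k + 1) * m ^ (k + 1) = 17 * k * m ^ (k + 1) + 17 * m ^ (k + 1) by ring]
      change _ + (12 * (m ^ k * m) + 5) ≤ _
      rw [← pow_succ]
      omega

/-- Halve the number on register 4. -/
def halve : Prog ι :=
  seq (loop 4 (cases 4 skip
    (seq (pop 4) (cases 4 skip (seq (pop 4) (push 7 true)) (seq (pop 4) (push 7 true))))
    (seq (pop 4) (cases 4 skip (seq (pop 4) (push 7 true)) (seq (pop 4) (push 7 true))))))
    (move 7 4)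

theorem det_halve {h : ℕ → List Bool} {D : ℕ} (h4 : h 4 = List.replicate D true)
    (h7 : h 7 = []) : Det (halve : Prog ι) h (update h 4 (List.replicate (D / 2) true))
      (8 * D + 2) := by
  -- A pass removes up to two bits and yields one for each full pair; surplus passes are idle. The
  -- yield `D / 2 - (D - 2) / 2` is 0 for `D ≤ 1` and 1 otherwise, so one formula covers all the
  -- cases.
  have hloop : ∀ (n D : ℕ) (g : ℕ → List Bool), D ≤ 2 * n → g 4 = List.replicate D true →
      DetPasses (cases 4 skip
        (seq (pop 4) (cases 4 skip (seq (pop 4) (push 7 true)) (seq (pop 4) (push 7 true))))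
        (seq (pop 4) (cases 4 skip (seq (pop 4) (push 7 true)) (seq (pop 4) (push 7 true)))) :
          Prog ι) n g
        (update (update g 4 []) 7 (List.replicate (D / 2) true ++ g 7)) (6 * n) := by
    intro n
    induction n with
    | zero =>
      intro D g hD hg
      obtain rfl : D = 0 := by omega
      refine Det.passes_zero.congr ?_ (by simp)
      simp at hg
      simp [← hg]
    | succ n ih =>
      intro D g hD hg
      have step : Det (cases 4 skip
        (seq (pop 4) (cases 4 skip (seq (pop 4) (push 7 true)) (seq (pop 4) (push 7 true))))
        (seq (pop 4) (cases 4 skip (seq (pop 4) (push 7 true)) (seq (pop 4) (push 7 true)))) :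
          Prog ι) g
        (update (update g 4 (List.replicate (D - 2) true)) 7
          (List.replicate (D / 2 - (D - 2) / 2) true ++ g 7)) 5 := by
        refine Det.cases (B := 4) ?_
        rw [hg]
        rcases D with _ | _ | D
        · refine Det.skip.congr ?_ (by norm_num)
          simp at hg
          simp [← hg]
        · refine ((Det.pop 4).seq (Det.cases (B := 1) ?_) (C := 2) (h'' := update g 4 [])).congr
            (by simp) (by norm_num)
          simp only [Function.update_self, hg, List.replicate, List.tail, branch]
          exact Det.skip
        · refine ((Det.pop 4).seq (Det.cases (B := 2) ?_) (C := 3)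
            (h'' := update (update g 4 (List.replicate D true)) 7 (true :: g 7))).congr ?_ le_rfl
          · simp only [Function.update_self, hg, List.replicate_succ, List.tail, branch]
            exact ((Det.pop 4).seq (Det.push 7 true)).congr (by simp) le_rfl
          · rw [show D + 1 + 1 - 2 = D by omega, show (D + 1 + 1) / 2 - D / 2 = 1 by omega]
            simp
      refine (Det.passes_succ step (ih (D - 2) _ (by omega) (by simp))).congr ?_ (by omega)
      have : D / 2 = (D - 2) / 2 + (D / 2 - (D - 2) / 2) := by omega
      funext i
      simp only [update_apply]
      split_ifs
      · rw [← List.append_assoc, List.replicate_append_replicate, ← this]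
      · rfl
      · rfl
  refine ((Det.loop (hloop _ D h (by rw [h4]; simp; omega) h4)).seq
    (det_move (x := 7) (y := 4) (by decide) _)).congr ?_ ?_
  · funext i
    simp only [update_apply]
    split_ifs <;> first | contradiction | omega | (subst_vars; simp [h7])
  · simp [h4, h7]
    omega

end Prog

namespace Prog

variable {ι : Type}

/-- Register contents while a number is guessed. -/
def guessStore (h : ℕ → List Bool) (D S I : ℕ) : ℕ → List Bool :=
  update (update (update h 4 (List.replicate D true)) 5 (List.replicate S true)) 8
    (List.replicate I true)

/-- Draw one bit of the number on register 8. -/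
def guessBit : Prog ι :=
  seq halve (seq (flip 6) (seq (cases 6 skip skip (copy 5 8 3))
    (seq (pop 6) (loop 5 (push 5 true)))))

/-- Draw one bit of the number on register 8 if register 4 is not empty. -/
def guessStep : Prog ι := cases 4 skip guessBit guessBit

theorem lift_guessBit {σ : Type} (O : Oracle ι σ) (s : σ) (t : ℕ) {h : ℕ → List Bool}
    (h3 : h 3 = []) (h6 : h 6 = []) (h7 : h 7 = []) (D S I : ℕ) :
    Lift (fun c b => c.store = guessStore h (D / 2) (S + S) (if b then S + I else I) ∧
      c.oracle = s ∧ c.time ≤ t + (8 * D + 11 * S + 20))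
      (guessBit.run O ⟨guessStore h D S I, s, t⟩) (uniformOfFintype Bool) := by
  obtain ⟨T, hT, e⟩ := (det_halve (ι := ι) (h := guessStore h D S I) (D := D)
    (by simp [guessStore]) (by simp [guessStore, h7])).run_seq_eq
  rw [guessBit, e, run_seq, run, PMF.bind_map, ← PMF.bind_pure (uniformOfFintype Bool),
    PMF.bind_bind]
  simp only [PMF.pure_bind]
  refine Lift.bind (R := fun b b' => b = b') (Lift.refl fun _ _ => rfl) ?_
  rintro b _ rfl
  simp only [Function.comp, Config.set]
  set g := update (guessStore h D S I) 4 (List.replicate (D / 2) true) with hg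
  have hcopy : Det (cases 6 skip skip (copy 5 8 3) : Prog ι) (update g 6 (b :: g 6))
      (update (update g 8 (List.replicate (if b then S + I else I) true)) 6 [b])
      (9 * S + 3) := by
    have hg6 : g 6 = [] := by simp [hg, guessStore, h6]
    refine Det.cases (B := 9 * S + 2) ?_
    rw [Function.update_self]
    cases b
    · refine Det.skip.congr ?_ (by omega)
      funext i
      simp only [update_apply]
      split_ifs <;> first | contradiction | omega | (subst_vars; simp [hg, guessStore, h6])
    · refine (det_copy (by decide) (by decide) (by decide) ?_).congr ?_ ?_
      · simp [hg, guessStore, h3]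
      · funext i
        simp only [update_apply]
        split_ifs <;> first | contradiction | omega | (subst_vars; simp [hg, guessStore, h6])
      · simp [hg, guessStore]
  obtain ⟨T', hT', e'⟩ := hcopy.seq ((Det.pop 6).seq (det_pushLoop 5 5 true _))
  rw [e']
  refine Lift.pure ⟨?_, rfl, ?_⟩
  · generalize (if b then S + I else I) = J
    funext i
    simp only [hg, guessStore, update_apply]
    split_ifs <;> first | contradiction | omega | (subst_vars; simp [h6])
  · simp [hg, guessStore] at hT' ⊢
    omega

/-- The weight `S` doubles while `D` at least halves, so `S * D` never grows. Thus `S` exceeds `T`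
at most after the last doubling, when `D` has become 0; hence the bound `2 * T`. -/
theorem lift_guessStep {σ : Type} (O : Oracle ι σ) (s : σ) {h : ℕ → List Bool}
    (h3 : h 3 = []) (h6 : h 6 = []) (h7 : h 7 = []) {T : ℕ} (n : ℕ) :
    ∀ D S I t, D ≤ T → S ≤ 2 * T → S * D ≤ T →
      Lift (fun c i => ∃ D S, c.store = guessStore h D S i ∧ D ≤ T ∧ S ≤ 2 * T ∧ c.oracle = s ∧
        c.time ≤ t + n * (30 * T + 22))
      (passes O guessStep n ⟨guessStore h D S I, s, t⟩) (guessLoop n D S I) := by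
  induction n with
  | zero =>
    intro D S I t hD hS _
    exact Lift.pure ⟨D, S, rfl, hD, hS, rfl, by simp⟩
  | succ n ih =>
    intro D S I t hD hS hSD
    rw [passes_succ, guessLoop, guessStep, run_cases]
    have h4 : guessStore h D S I 4 = List.replicate D true := by simp [guessStore]
    by_cases h0 : D = 0
    · subst h0
      simp only [Config.tick, h4, List.replicate, branch, run, PMF.pure_bind, if_true]
      refine (ih 0 S I _ hD hS hSD).mono ?_
      rintro c i ⟨D, S, h₁, h₂, h₃, h₄, h₅⟩
      refine ⟨D, S, h₁, h₂, h₃, h₄, h₅.trans ?_⟩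
      rw [add_mul n 1]; omega
    · simp only [Config.tick, h4, if_neg h0]
      rw [branch_of_ne_nil (by simpa using h0)]
      refine (lift_guessBit O s _ h3 h6 h7 D S I).bind ?_
      rintro ⟨_, _, tc⟩ b ⟨rfl, rfl, htc⟩
      have hS' : S ≤ T := (Nat.le_mul_of_pos_right S (Nat.pos_of_ne_zero h0)).trans hSD
      refine (ih (D / 2) (S + S) _ tc (by omega) (by omega) ?_).mono ?_
      · calc (S + S) * (D / 2) = S * (2 * (D / 2)) := by ring
          _ ≤ S * D := Nat.mul_le_mul_left _ (Nat.mul_div_le D 2)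
          _ ≤ T := hSD
      · rintro c i ⟨D', S', h₁, h₂, h₃, h₄, h₅⟩
        refine ⟨D', S', h₁, h₂, h₃, h₄, h₅.trans ?_⟩
        simp only at htc
        rw [add_mul n 1]; omega

/-- Guess a number of size about `(n + 2) ^ k`, where `n` is the length of register 0. -/
def guessProg (k : ℕ) : Prog ι :=
  seq (power k) (seq (push 5 true) (seq (loop 4 guessStep)
    (seq (clear 0) (seq (clear 4) (clear 5)))))

theorem lift_guessProg {σ : Type} (O : Oracle ι σ) (s : σ) (t : ℕ) {h : ℕ → List Bool} {k : ℕ}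
    (h1 : ∀ i, 0 < i → i < 11 → h i = []) :
    Lift (fun c i => c.store = update (update h 0 []) 8 (List.replicate i true) ∧
        c.oracle = s ∧ c.time ≤ t + ((17 * k + 100) * (((h 0).length + 2) ^ k) ^ 2 +
          2 * (h 0).length))
      ((guessProg k).run O ⟨h, s, t⟩) (guess (((h 0).length + 2) ^ k)) := by
  set T := ((h 0).length + 2) ^ k with hT
  have hT0 : 0 < T := Nat.pow_pos (by omega)
  have h4 := h1 4 (by norm_num) (by norm_num)
  have h5 := h1 5 (by norm_num) (by norm_num)
  have h8 := h1 8 (by norm_num) (by norm_num)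
  have hprep : Det (seq (power k) (push 5 true) : Prog ι) h (guessStore h T 1 0)
      (17 * k * T + 2) := by
    refine ((det_power h4 h5 k).seq (Det.push 5 true)).congr ?_
      (by rw [← hT])
    funext i
    simp only [guessStore, update_apply]
    split_ifs <;> first | contradiction | omega | (simp [hT]; done) | (subst i; simp [h5, h8])
  obtain ⟨T₁, hT₁, e₁⟩ := hprep.run_seq_eq
  have e₁ := e₁ (seq (loop 4 guessStep) (seq (clear 0) (seq (clear 4) (clear 5)))) σ O s t
  rw [run_seq, run_seq, PMF.bind_bind] at e₁
  rw [guessProg, run_seq]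
  refine Eq.subst (motive := fun μ => Lift _ μ _) e₁.symm ?_
  rw [run_seq, run_loop, ← PMF.bind_pure (guess T), guess]
  simp only [Config.tick]
  rw [show guessStore h T 1 0 4 = List.replicate T true by simp [guessStore],
    List.length_replicate]
  refine (lift_guessStep O s (h1 3 (by norm_num) (by norm_num)) (h1 6 (by norm_num) (by norm_num))
    (h1 7 (by norm_num) (by norm_num)) T T 1 0 _ le_rfl (by omega) (by omega)).bind ?_
  rintro ⟨_, s', tc⟩ i ⟨D, S, rfl, hD, hS, rfl, htc⟩
  obtain ⟨T₂, hT₂, e₂⟩ := (det_clear (ι := ι) 0 (guessStore h D S i)).seq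
    ((det_clear 4 _).seq (det_clear 5 _))
  rw [e₂]
  refine Lift.pure ⟨?_, rfl, ?_⟩
  · funext j
    simp only [guessStore, update_apply]
    split_ifs <;> first | contradiction | omega | (subst_vars; simp [h4, h5])
  · simp [guessStore] at hT₂ htc ⊢
    have h1 : k * T ≤ k * T ^ 2 := Nat.mul_le_mul_left _ (Nat.le_self_pow two_ne_zero T)
    have h2 : T ≤ T ^ 2 := Nat.le_self_pow two_ne_zero T
    have h3 : 1 ≤ T ^ 2 := Nat.pow_pos hT0
    nlinarith

end Prog

/-! ### The handler that guesses a decryption query -/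

/-- Stop at a decryption query that is guessed in advance, and output this query in the end. -/
noncomputable def guessHandler (k : ℕ) : Handler AEOracle Unit where
  State := ℕ × Option (List Bool)
  Rep q h := Idle h ∧ h 8 = List.replicate q.1 true ∧
    h 9 = (if q.2 = none then [] else [true]) ∧ h 10 = q.2.getD []
  size q := (q.2.getD []).length
  width := 11
  cost := ((17 * k + 100 : ℕ) : Polynomial ℕ) * ((Polynomial.X + 2) ^ k) ^ 2 + handlerCost
  start := guessProg k
  step
    | AEOracle.enc => seq (cases 9 (call () 0 1 2) skip skip) (seq (clear 0) (clear 1))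
    | AEOracle.dec => seq (cases 9 (cases 8 (seq (copy 0 10 3) (push 9 true)) (pop 8) (pop 8))
        skip skip) (seq (clear 0) (clear 1))
  finish := seq (clear 0) (seq (clear 1) (seq (move 10 3) (move 3 2)))
  startDist w := (guess ((w.length + 2) ^ k)).map fun i => (i, none)
  stepDist O s o x y :=
    match o, s.1.2 with
    | AEOracle.enc, none => (O s.2 () x y).map fun r => (r.1, (s.1, r.2))
    | AEOracle.dec, none =>
      PMF.pure ([], (if s.1.1 = 0 then (0, some x) else (s.1.1 - 1, none), s.2))
    | _, some _ => PMF.pure ([], s)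
  finishDist _ s _ := PMF.pure (s.1.2.getD [], s.2)
  width_gt := by norm_num
  rep_empty h := ⟨h.1 0 (by norm_num), h.1 1 (by norm_num), h.1 2 (by norm_num),
    h.1 3 (by norm_num)⟩
  start_spec O s t w h h0 h1 := by
    subst h0
    have key := lift_guessProg O s t (k := k) h1
    rw [← PMF.map_id ((guessProg k).run O _)]
    refine key.map ?_
    rintro c i ⟨hs, ho, ht⟩
    refine ⟨⟨?_, by simp [hs], by simp [hs, h1 9], by simp [hs, h1 10]⟩, ho, ht.trans ?_, rfl⟩
    · intro j hj
      rw [id, hs, Function.update_of_ne (by omega)]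
      exact idle_update_zero (n := 11) (by norm_num) h1 j hj
    · have := le_handlerCost (a := 2 * (h 0).length) (n := (h 0).length) (by omega)
      simp only [Polynomial.eval_add, Polynomial.eval_mul, Polynomial.eval_pow, Polynomial.eval_X,
        Polynomial.eval_natCast, Polynomial.eval_ofNat]
      push_cast
      omega
  step_spec O L hO o q s t h x y hR := by
    obtain ⟨i, z⟩ := q
    obtain ⟨hI, h8, h9, h10⟩ := hR
    have h0 := hI 0 (by norm_num)
    have h1 := hI 1 (by norm_num)
    have h2 := hI 2 (by norm_num)
    have h3 := hI 3 (by norm_num)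
    have hcost : ∀ {a n : ℕ}, a ≤ 100 * (n + 1) → a ≤ (((17 * k + 100 : ℕ) : Polynomial ℕ) *
        ((Polynomial.X + 2) ^ k) ^ 2 + handlerCost).eval n := fun h => by
      rw [Polynomial.eval_add]
      exact (le_handlerCost h).trans (Nat.le_add_left _ _)
    set g := update (update h 0 x) 1 y with hg
    have hclear := fun f : ℕ → List Bool =>
      (det_clear (ι := Unit) 0 f).seq (det_clear 1 _)
    cases z with
    | some c =>
      -- Once a query is stored, register 9 is not empty and all later queries fall through to `⊥`,
      -- so no further ciphertexts are issued.
      have hskip : ∀ p : Prog Unit, Det (cases 9 p skip skip) g g 2 := fun p => by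
        refine Det.cases (B := 1) ?_
        rw [show g 9 = [true] by simp [hg, h9]]
        exact Det.skip
      have hend : ∀ p : Prog Unit,
          Lift (fun c' (r : List Bool × ((ℕ × Option (List Bool)) × _)) => ∃ h' : ℕ → List Bool,
            c'.store = update h' 2 r.1 ∧ (Idle h' ∧ h' 8 = List.replicate r.2.1.1 true ∧
              h' 9 = (if r.2.1.2 = none then [] else [true]) ∧ h' 10 = r.2.1.2.getD []) ∧
            c'.oracle = r.2.2 ∧ c'.time ≤ t + (((17 * k + 100 : ℕ) : Polynomial ℕ) *
              ((Polynomial.X + 2) ^ k) ^ 2 + handlerCost).eval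
                (x.length + y.length + c.length + L) ∧ r.1.length ≤ L ∧
            (r.2.1.2.getD []).length ≤ c.length + (x.length + y.length + L + 1))
          ((seq (cases 9 p skip skip) (seq (clear 0) (clear 1))).run O ⟨g, s, t⟩)
          (PMF.pure ([], ((i, some c), s))) := fun p => by
        obtain ⟨T, hT, e⟩ := (hskip p).seq (hclear g)
        rw [e]
        refine Lift.pure ⟨h, ?_, ⟨hI, h8, h9, h10⟩, rfl, ?_, by simp, by simp⟩
        · funext j
          simp only [hg, update_apply]
          split_ifs <;> first | contradiction | omega | (subst_vars; simp [h0, h1, h2])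
        · refine Nat.add_le_add_left (hT.trans (hcost ?_)) t
          simp [hg]
          omega
      cases o <;> exact hend _
    | none =>
      have hg9 : g 9 = [] := by simp [hg, h9]
      cases o with
      | enc =>
        simp only [run_seq, run_cases, hg9, branch, Config.tick, run_call, PMF.bind_map]
        refine Lift.bind (R := fun r r' => r = r' ∧ r.1.length ≤ L)
          (Lift.refl fun r hr => ⟨rfl, hO _ _ _ _ r hr⟩) ?_
        rintro ⟨r, s'⟩ _ ⟨rfl, hr⟩
        obtain ⟨T, hT, e⟩ := hclear (update g 2 r)
        simp only [Function.comp, Config.set]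
        rw [e]
        refine Lift.pure ⟨h, ?_, ⟨hI, h8, h9, h10⟩, rfl, ?_, hr, by simp⟩
        · funext j
          simp only [hg, update_apply]
          split_ifs <;> first | contradiction | omega | (subst_vars; simp [h0, h1])
        · refine le_trans ?_ (Nat.add_le_add_left
            (hcost (a := 2 * (x.length + y.length) + 10) (by omega)) t)
          simp [hg] at hT ⊢
          omega
      | dec =>
        cases i with
        | zero =>
          have hsave : Det (cases 9 (cases 8 (seq (copy 0 10 3) (push 9 true)) (pop 8) (pop 8))
              skip skip : Prog Unit) g (update (update g 10 x) 9 [true]) (9 * x.length + 5) := by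
            refine Det.cases (B := 9 * x.length + 4) ?_
            rw [hg9]
            refine Det.cases (B := 9 * x.length + 3) ?_
            rw [show g 8 = [] by simp [hg, h8]]
            refine ((det_copy (by decide) (by decide) (by decide) ?_).seq
              (Det.push 9 true)).congr ?_ ?_
            · simp [hg, h3]
            · funext j
              simp only [update_apply]
              split_ifs <;> first | contradiction | omega | (subst_vars; simp [hg, h9, h10])
            · simp [hg]
          obtain ⟨T, hT, e⟩ := hsave.seq (hclear _)
          rw [e]
          refine Lift.pure ⟨update (update h 10 x) 9 [true], ?_, ⟨?_, ?_, ?_, ?_⟩, rfl, ?_,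
            by simp, ?_⟩
          · funext j
            simp only [hg, update_apply]
            split_ifs <;> first | contradiction | omega | (subst_vars; simp [h0, h1, h2])
          · intro j hj
            rw [Function.update_of_ne (by omega), Function.update_of_ne (by omega), hI j hj]
          · simp [h8]
          · simp
          · simp
          · refine Nat.add_le_add_left (hT.trans (hcost ?_)) t
            simp [hg]
            omega
          · simp
            omega
        | succ i =>
          have hcount : Det (cases 9 (cases 8 (seq (copy 0 10 3) (push 9 true)) (pop 8) (pop 8))
              skip skip : Prog Unit) g (update g 8 (List.replicate i true)) 3 := by
            refine Det.cases (B := 2) ?_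
            rw [hg9]
            refine Det.cases (B := 1) ?_
            rw [branch_of_ne_nil (by simp [hg, h8])]
            exact (Det.pop 8).congr (by simp [hg, h8]) le_rfl
          obtain ⟨T, hT, e⟩ := hcount.seq (hclear _)
          rw [e]
          refine Lift.pure ⟨update h 8 (List.replicate i true), ?_, ⟨?_, ?_, ?_, ?_⟩, rfl, ?_,
            by simp, by simp⟩
          · funext j
            simp only [hg, update_apply]
            split_ifs <;> first | contradiction | omega | (subst_vars; simp [h0, h1, h2])
          · intro j hj
            rw [Function.update_of_ne (by omega), hI j hj]
          · simp
          · simp [h9]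
          · simp [h10]
          · refine Nat.add_le_add_left (hT.trans (hcost ?_)) t
            simp [hg]
            omega
  finish_spec O L hO q s t h x hR := by
    obtain ⟨hI, h8, h9, h10⟩ := hR
    have h2 := hI 2 (by norm_num)
    have h3 := hI 3 (by norm_num)
    obtain ⟨T, hT, e⟩ := (det_clear (ι := Unit) 0 (update (update h 0 x) 1 x)).seq
      ((det_clear 1 _).seq ((det_move (x := 10) (y := 3) (by decide) _).seq
        (det_move (x := 3) (y := 2) (by decide) _)))
    rw [e]
    have hcost : ∀ {a n : ℕ}, a ≤ 100 * (n + 1) → a ≤ (((17 * k + 100 : ℕ) : Polynomial ℕ) *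
        ((Polynomial.X + 2) ^ k) ^ 2 + handlerCost).eval n := fun h => by
      rw [Polynomial.eval_add]
      exact (le_handlerCost h).trans (Nat.le_add_left _ _)
    refine Lift.pure ⟨update (update (update h 0 []) 1 []) 10 [], ?_, by simp [h2], by simp [h3],
      rfl, ?_, hcost (by simp only; omega)⟩
    · funext j
      simp only [update_apply]
      split_ifs <;> first | contradiction | omega | (subst_vars; simp [h2, h3, h10])
    · refine Nat.add_le_add_left (hT.trans (hcost ?_)) t
      simp [h3, h10]
      omega
  step_length_le O L hO s o x y r hr := by
    obtain ⟨⟨i, _ | c⟩, s⟩ := s <;> cases o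
    · obtain ⟨r', hr', rfl⟩ := (mem_support_map_iff _ _ _).1 hr
      exact hO _ _ _ _ r' hr'
    all_goals
      simp only [support_pure, Set.mem_singleton_iff] at hr
      simp [hr]

/-! ### Negligible functions -/

/-- A finite negligible quantity. -/
def NegligibleENN (f : ℕ → ENNReal) : Prop := (∀ n, f n ≠ ⊤) ∧ Negligible fun n => (f n).toReal

theorem Negligible.of_abs_le {f g : ℕ → ℝ} (hg : Negligible g) (h : ∀ n, |f n| ≤ |g n|) :
    Negligible f :=
  Asymptotics.SuperpolynomialDecay.trans_abs_le hg fun n => h n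

namespace NegligibleENN

variable {f g : ℕ → ENNReal}

theorem mono (hg : NegligibleENN g) (h : ∀ n, f n ≤ g n) : NegligibleENN f := by
  refine ⟨fun n => ne_top_of_le_ne_top (hg.1 n) (h n), hg.2.of_abs_le fun n => ?_⟩
  rw [abs_of_nonneg ENNReal.toReal_nonneg, abs_of_nonneg ENNReal.toReal_nonneg]
  exact ENNReal.toReal_mono (hg.1 n) (h n)

theorem add (hf : NegligibleENN f) (hg : NegligibleENN g) : NegligibleENN fun n => f n + g n := by
  refine ⟨fun n => ENNReal.add_ne_top.2 ⟨hf.1 n, hg.1 n⟩, ?_⟩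
  simp only [ENNReal.toReal_add (hf.1 _) (hg.1 _)]
  exact Asymptotics.SuperpolynomialDecay.add hf.2 hg.2

theorem polynomial_mul (p : Polynomial ℕ) (hf : NegligibleENN f) :
    NegligibleENN fun n => ((p.eval n : ℕ) : ENNReal) * f n := by
  refine ⟨fun n => ENNReal.mul_ne_top (ENNReal.natCast_ne_top _) (hf.1 n), ?_⟩
  simp only [ENNReal.toReal_mul, ENNReal.toReal_natCast]
  have := Asymptotics.SuperpolynomialDecay.polynomial_mul hf.2 (p.map (Nat.castRingHom ℝ))
  refine this.congr fun n => ?_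
  rw [Polynomial.eval_natCast_map]
  simp

end NegligibleENN

/-- Two quantities whose difference is negligible. -/
def Close (f g : ℕ → ENNReal) : Prop := ∃ d, NegligibleENN d ∧ ∀ n, f n ≤ g n + d n ∧ g n ≤ f n + d n

namespace Close

variable {f g h : ℕ → ENNReal}

theorem symm (hfg : Close f g) : Close g f :=
  let ⟨d, hd, H⟩ := hfg
  ⟨d, hd, fun n => (H n).symm⟩

theorem trans (hfg : Close f g) (hgh : Close g h) : Close f h := by
  obtain ⟨d, hd, H⟩ := hfg
  obtain ⟨e, he, K⟩ := hgh
  refine ⟨_, hd.add he, fun n => ⟨?_, ?_⟩⟩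
  · calc f n ≤ g n + d n := (H n).1
      _ ≤ h n + e n + d n := add_le_add_left (K n).1 _
      _ = h n + (d n + e n) := by ring
  · calc h n ≤ g n + e n := (K n).2
      _ ≤ f n + d n + e n := add_le_add_left (H n).2 _
      _ = f n + (d n + e n) := by ring

/-- Probabilities are compared in `ENNReal`, where subtraction truncates; closeness is therefore a
pair of inequalities, translated here to the absolute difference of real numbers. -/
theorem iff_negligible (hf : ∀ n, f n ≤ 1) (hg : ∀ n, g n ≤ 1) :
    Close f g ↔ Negligible fun n => |(f n).toReal - (g n).toReal| := by
  have hf' : ∀ n, f n ≠ ⊤ := fun n => ne_top_of_le_ne_top ENNReal.one_ne_top (hf n)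
  have hg' : ∀ n, g n ≠ ⊤ := fun n => ne_top_of_le_ne_top ENNReal.one_ne_top (hg n)
  constructor
  · rintro ⟨d, hd, H⟩
    refine hd.2.of_abs_le fun n => ?_
    rw [abs_abs, abs_of_nonneg (ENNReal.toReal_nonneg (a := d n)), abs_le]
    have h1 := ENNReal.toReal_mono (ENNReal.add_ne_top.2 ⟨hg' n, hd.1 n⟩) (H n).1
    have h2 := ENNReal.toReal_mono (ENNReal.add_ne_top.2 ⟨hf' n, hd.1 n⟩) (H n).2
    rw [ENNReal.toReal_add (hg' n) (hd.1 n)] at h1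
    rw [ENNReal.toReal_add (hf' n) (hd.1 n)] at h2
    constructor <;> linarith
  · intro h
    refine ⟨fun n => ENNReal.ofReal |(f n).toReal - (g n).toReal|,
      ⟨fun n => ENNReal.ofReal_ne_top, ?_⟩, fun n => ⟨?_, ?_⟩⟩
    · simpa only [ENNReal.toReal_ofReal (abs_nonneg _)] using h
    · conv_lhs => rw [← ENNReal.ofReal_toReal (hf' n)]
      conv_rhs => rw [← ENNReal.ofReal_toReal (hg' n)]
      rw [← ENNReal.ofReal_add ENNReal.toReal_nonneg (abs_nonneg _)]
      refine ENNReal.ofReal_le_ofReal ?_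
      linarith [le_abs_self ((f n).toReal - (g n).toReal)]
    · conv_lhs => rw [← ENNReal.ofReal_toReal (hg' n)]
      conv_rhs => rw [← ENNReal.ofReal_toReal (hf' n)]
      rw [← ENNReal.ofReal_add ENNReal.toReal_nonneg (abs_nonneg _)]
      refine ENNReal.ofReal_le_ofReal ?_
      linarith [neg_abs_le ((f n).toReal - (g n).toReal)]

end Close

theorem NegligibleENN.of_negligible {f : ℕ → ENNReal} (hf : ∀ n, f n ≤ 1)
    (h : Negligible fun n => (f n).toReal) : NegligibleENN f :=
  ⟨fun n => ne_top_of_le_ne_top ENNReal.one_ne_top (hf n), h⟩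

/-- Powers of `n + 2` are the bounds that `power` can compute. The base is at least 2 so that a
coefficient `c` is absorbed by `2 ^ c`. -/
theorem Polynomial.exists_eval_le_pow (p : Polynomial ℕ) : ∃ k, ∀ n, p.eval n ≤ (n + 2) ^ k := by
  induction p using Polynomial.induction_on' with
  | add p q hp hq =>
    obtain ⟨a, ha⟩ := hp
    obtain ⟨b, hb⟩ := hq
    refine ⟨a + b + 1, fun n => ?_⟩
    have h1 : (n + 2) ^ a ≤ (n + 2) ^ (a + b) := Nat.pow_le_pow_right (by omega) (by omega)
    have h2 : (n + 2) ^ b ≤ (n + 2) ^ (a + b) := Nat.pow_le_pow_right (by omega) (by omega)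
    rw [Polynomial.eval_add, pow_succ]
    have := ha n
    have := hb n
    nlinarith
  | monomial d c =>
    refine ⟨c + d, fun n => ?_⟩
    rw [Polynomial.eval_monomial, pow_add]
    exact Nat.mul_le_mul (Nat.lt_two_pow_self.le.trans (Nat.pow_le_pow_left (by omega) c))
      (Nat.pow_le_pow_left (by omega) d)

/-! ### Executions -/

/-- The replies of the oracle have length at most `L`. -/
def Oracle.RepliesLE {ι σ : Type} (O : Oracle ι σ) (L : ℕ) : Prop :=
  ∀ s o x y, ∀ r ∈ (O s o x y).support, r.1.length ≤ L

namespace Prog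

variable {ι σ τ : Type}

/-- Without oracle replies a step adds at most one bit to a register, so the output is no longer
than the inputs plus the running time. -/
theorem length_le_of_mem_output {c : Prog Empty} (hc : c.PolyTime) : ∃ p : Polynomial ℕ,
    ∀ inputs, ∀ w ∈ (c.output inputs).support, w.length ≤ p.eval (inputs.map List.length).sum := by
  obtain ⟨p, hp⟩ := hc
  refine ⟨Polynomial.X + p, fun inputs w hw => ?_⟩
  rw [output, exec, PMF.map_comp] at hw
  obtain ⟨s, hs, rfl⟩ := (mem_support_map_iff _ _ _).1 hw
  have ht := hp _ _ _ inputs 0 (fun _ o => o.elim) s hs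
  have := length_store_le (L := 0) (fun _ o => o.elim) (m := (inputs.map List.length).sum) hs
    (fun x => by
      simp only [Config.init, zero_mul, add_zero]
      by_cases hx : x < inputs.length
      · rw [List.getD_eq_getElem _ _ hx]
        exact List.single_le_sum (by simp) _ (List.mem_map_of_mem (List.getElem_mem hx))
      · rw [List.getD_eq_default _ _ (not_lt.1 hx)]
        simp) 0
  simp only [Function.comp, Config.out, Polynomial.eval_add, Polynomial.eval_X]
  simp only [zero_add, mul_one, add_zero] at this ht
  omega

theorem lift_exec {O₁ : Oracle ι σ} {O₂ : Oracle ι τ} {R Bad : σ → τ → Prop}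
    (hstep : ∀ s₁ s₂, R s₁ s₂ → ∀ o x y, Lift
      (fun r₁ r₂ => (r₁.1 = r₂.1 ∧ R r₁.2 r₂.2) ∨ Bad r₁.2 r₂.2) (O₁ s₁ o x y) (O₂ s₂ o x y))
    (hbad₁ : ∀ s₁ s₂, Bad s₁ s₂ → ∀ o x y, ∀ r ∈ (O₁ s₁ o x y).support, Bad r.2 s₂)
    (hbad₂ : ∀ s₁ s₂, Bad s₁ s₂ → ∀ o x y, ∀ r ∈ (O₂ s₂ o x y).support, Bad s₁ r.2)
    (c : Prog ι) {s₁ : σ} {s₂ : τ} (h : R s₁ s₂) (inputs : List (List Bool)) :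
    Lift (fun r₁ r₂ => (r₁.1 = r₂.1 ∧ R r₁.2 r₂.2) ∨ Bad r₁.2 r₂.2)
      (c.exec O₁ s₁ inputs) (c.exec O₂ s₂ inputs) := by
  refine (lift_run hstep hbad₁ hbad₂ c (Config.init inputs s₁) (Config.init inputs s₂)
    (Or.inl ⟨rfl, rfl, h⟩)).map ?_
  rintro a b (⟨h₁, _, h₂⟩ | h₂)
  · exact Or.inl ⟨by simp [Config.out, h₁], h₂⟩
  · exact Or.inr h₂

theorem lift_exec_of_step {O₁ : Oracle ι σ} {O₂ : Oracle ι τ} {R : σ → τ → Prop}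
    (hstep : ∀ s₁ s₂, R s₁ s₂ → ∀ o x y, Lift
      (fun r₁ r₂ => r₁.1 = r₂.1 ∧ R r₁.2 r₂.2) (O₁ s₁ o x y) (O₂ s₂ o x y))
    (c : Prog ι) {s₁ : σ} {s₂ : τ} (h : R s₁ s₂) (inputs : List (List Bool)) :
    Lift (fun r₁ r₂ => r₁.1 = r₂.1 ∧ R r₁.2 r₂.2) (c.exec O₁ s₁ inputs) (c.exec O₂ s₂ inputs) := by
  refine (lift_exec (R := R) (Bad := fun _ _ => False) (fun s₁ s₂ h o x y =>
    (hstep s₁ s₂ h o x y).mono fun _ _ => Or.inl) ?_ ?_ c h inputs).mono ?_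
  · exact fun _ _ h => h.elim
  · exact fun _ _ h => h.elim
  · exact fun _ _ h => h.resolve_right id

theorem expect_exec_le {O : Oracle ι σ} {f : σ → ENNReal} {ε : ENNReal}
    (hf : ∀ s o x y, (O s o x y).expect (fun r => f r.2) ≤ f s + ε) {T : ℕ} {c : Prog ι} {s₀ : σ}
    {inputs : List (List Bool)}
    (hT : ∀ s ∈ (c.run O (Config.init inputs s₀)).support, s.time ≤ T) :
    (c.exec O s₀ inputs).expect (fun r => f r.2) ≤ f s₀ + ε * T := by
  rw [exec, expect_map]
  refine (expect_mono fun a _ => ?_).trans (expect_run_le hf T c _ hT)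
  exact le_self_add

end Prog

theorem PMF.Lift.map_left {α β : Type*} {R : β → α → Prop} {μ : PMF α} {f : α → β}
    (h : ∀ a ∈ μ.support, R (f a) a) : Lift R (μ.map f) μ := by
  simpa [PMF.map_id] using Lift.mk μ f id h

theorem PMF.expect_le_one {α : Type*} {μ : PMF α} {f : α → ENNReal} (h : ∀ a, f a ≤ 1) :
    μ.expect f ≤ 1 :=
  (expect_mono fun a _ => h a).trans (expect_const μ 1).le

/-- Each reply of the oracle `o` to a query is `⊥` or a ciphertext that is added to the state. -/
def Oracle.Issues {κ : Type} (O : Oracle κ (List (List Bool))) (o : κ) : Prop :=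
  ∀ W x y, ∀ r ∈ (O W o x y).support, (∃ c, r = (true :: c, c :: W)) ∨ r = ([], W)

/-- A recorded reply is `true :: c` for an issued ciphertext `c`, or empty; the record therefore
decides membership in the list kept by the oracle, which the algorithm cannot see. -/
theorem lift_exec_recordDist {κ : Type} {O : Oracle κ (List (List Bool))} {o : κ}
    (hO : O.Issues o) (A : Prog Unit) (inputs : List (List Bool)) :
    Lift (fun r₁ r₂ => r₁.1 = r₂.1 ∧ r₁.2.2 = r₂.2 ∧ ∀ c, true :: c ∈ r₁.2.1 ↔ c ∈ r₂.2)
      (A.exec (recordDist o O) ([], []) inputs)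
      (A.exec (fun W (_ : Unit) x y => O W o x y) [] inputs) := by
  refine lift_exec_of_step (R := fun (s₁ : List (List Bool) × List (List Bool)) s₂ =>
    s₁.2 = s₂ ∧ ∀ c, true :: c ∈ s₁.1 ↔ c ∈ s₂)
    ?_ A ⟨rfl, by simp⟩ inputs
  rintro ⟨W, _⟩ s ⟨rfl, h⟩ _ x y
  refine Lift.map_left fun r hr => ⟨rfl, rfl, fun c => ?_⟩
  obtain ⟨c', rfl⟩ | rfl := hO _ _ _ r hr
  · simp only [List.mem_cons, List.cons.injEq, true_and]
    exact or_congr_right (h c)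
  · simpa using h c

namespace SKES

variable (S : SKES)

/-! ### Success probabilities for a fixed key -/

/-- The probability that a string decrypts to a plaintext. -/
noncomputable def decValid (n : ℕ) (k c : List Bool) : ENNReal :=
  (S.Dec n k c).expect fun m => if m.isSome then 1 else 0

noncomputable def forgeProb (A : Prog Unit) (n : ℕ) (k : List Bool) : ENNReal :=
  (A.exec (S.realEnc n k) [] [unary n]).expect fun r => S.decValid n k r.1

noncomputable def cheatProb (A : Prog Unit) (n : ℕ) (k : List Bool) : ENNReal :=
  (A.exec (S.randEnc n k) [] [unary n]).expect fun r => if r.1 ∈ r.2 then 1 else 0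

/-- The probability that a ciphertext received from the encryption oracle is output. -/
noncomputable def replayProb (A : Prog Unit) (n : ℕ) (k : List Bool) : ENNReal :=
  (A.exec (S.realEnc n k) [] [unary n]).expect fun r => if r.1 ∈ r.2 then 1 else 0

noncomputable def ctxtProb (A : Prog Unit) (n : ℕ) (k : List Bool) : ENNReal :=
  (A.exec (S.realEnc n k) [] [unary n]).expect fun r => if r.1 ∈ r.2 then 0 else S.decValid n k r.1

noncomputable def cpaProb (A : Prog Unit) (b : Bool) (n : ℕ) (k : List Bool) : ENNReal :=
  (A.exec (S.lrEnc n k b) [] [unary n]).expect fun r => if r.1.head? = some true then 1 else 0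

noncomputable def aeProb {σ : Type} (O : Oracle AEOracle σ) (s₀ : σ) (A : Prog AEOracle) (n : ℕ) :
    ENNReal :=
  (A.exec O s₀ [unary n]).expect fun r => if r.1.head? = some true then 1 else 0

variable {S} {n : ℕ} {k : List Bool}

theorem decValid_add_none (c : List Bool) : S.decValid n k c + S.Dec n k c none = 1 := by
  rw [decValid, ← expect_ite_eq (S.Dec n k c) none, ← expect_add]
  refine Eq.trans ?_ (expect_const (S.Dec n k c) 1)
  refine expect_congr fun m _ => ?_
  cases m <;> simp

theorem decValid_le_one (c : List Bool) : S.decValid n k c ≤ 1 :=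
  expect_le_one fun m => by split_ifs <;> simp

theorem ufForge_apply (A : Prog Unit) :
    S.ufForge A n true = (S.KeyGen n).expect (S.forgeProb A n) := by
  simp only [ufForge, bind_apply_eq_expect, map_apply_true]
  rfl

theorem ufCheat_apply (A : Prog Unit) :
    S.ufCheat A n true = (S.KeyGen n).expect (S.cheatProb A n) := by
  simp only [ufCheat, bind_apply_eq_expect, map_apply_true, decide_eq_true_eq]
  rfl

theorem cpaGame_apply (A : Prog Unit) (b : Bool) :
    S.cpaGame A b n true = (S.KeyGen n).expect (S.cpaProb A b n) := by
  simp only [cpaGame, bind_apply_eq_expect, map_apply_true, decide_eq_true_eq]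
  rfl

theorem ctxtGame_apply (A : Prog Unit) :
    S.ctxtGame A n true = (S.KeyGen n).expect (S.ctxtProb A n) := by
  simp only [ctxtGame, bind_apply_eq_expect, map_apply_true, Bool.and_eq_true, decide_eq_true_eq]
  refine expect_congr fun k _ => expect_congr fun r _ => ?_
  by_cases h : r.1 ∈ r.2
  · simp [h, expect_const]
  · simp [h, decValid]

theorem aeReal_apply (A : Prog AEOracle) : S.aeReal A n true =
    (S.KeyGen n).expect fun k => aeProb (S.aeRealOracle n k) [] A n := by
  simp only [aeReal, bind_apply_eq_expect, map_apply_true, decide_eq_true_eq]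
  rfl

theorem aeIdeal_apply (A : Prog AEOracle) : S.aeIdeal A n true =
    (S.KeyGen n).expect fun k => aeProb (S.aeIdealOracle n k) [] A n := by
  simp only [aeIdeal, bind_apply_eq_expect, map_apply_true, decide_eq_true_eq]
  rfl

/-! ### Bounds for replies, running times and correctness errors -/

variable (S) in
/-- The replies of all oracles have length at most `L`. -/
def ReplyBound (n : ℕ) (k : List Bool) (L : ℕ) : Prop :=
  S.msgLen n + 1 ≤ L ∧
    ∀ m, m.length = S.msgLen n → ∀ c ∈ (S.Enc n k m).support, c.length + 1 ≤ L

variable (S) in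
-- Keys and plaintexts have polynomial length, hence so do ciphertexts. The additional 1 is the
-- leading bit from `encodeReply`.
theorem exists_replyBound : ∃ Q : Polynomial ℕ, ∀ n, ∀ k ∈ (S.KeyGen n).support,
    S.ReplyBound n k (Q.eval n) := by
  obtain ⟨l, hl⟩ := S.msgLen_le
  obtain ⟨p, hp⟩ := length_le_of_mem_output S.keyGen_polyTime
  obtain ⟨q, hq⟩ := length_le_of_mem_output S.enc_polyTime
  refine ⟨l + q.comp (Polynomial.X + p + l) + 1, fun n k hk => ?_⟩
  have hk' : k.length ≤ p.eval n := by simpa [unary] using hp _ k hk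
  simp only [Polynomial.eval_add, Polynomial.eval_comp, Polynomial.eval_X, Polynomial.eval_one]
  refine ⟨?_, fun m hm c hc => ?_⟩
  · have := hl n
    omega
  · have h1 := hq _ c hc
    have h2 := Polynomial.eval_nat_mono q
      (show ([unary n, k, m].map List.length).sum ≤ n + p.eval n + l.eval n by
        have := hl n
        simp [unary, hm]
        omega)
    simp only at h2
    omega

variable {L : ℕ}

theorem realEnc_length_le (h : S.ReplyBound n k L) : (S.realEnc n k).RepliesLE L := by
  intro s o x y r hr
  rw [realEnc] at hr
  split_ifs at hr with hx
  · obtain ⟨c, hc, rfl⟩ := (mem_support_map_iff _ _ _).1 hr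
    exact h.2 x hx c hc
  · rw [support_pure, Set.mem_singleton_iff] at hr
    simp [hr, encodeReply]

theorem randEnc_length_le (h : S.ReplyBound n k L) : (S.randEnc n k).RepliesLE L := by
  intro s o x y r hr
  rw [randEnc] at hr
  split_ifs at hr with hx
  · obtain ⟨c, hc, rfl⟩ := (mem_support_map_iff _ _ _).1 hr
    obtain ⟨m, hm, hc⟩ := (mem_support_bind_iff _ _ _).1 hc
    exact h.2 m (length_of_mem_uniformBits hm) c hc
  · rw [support_pure, Set.mem_singleton_iff] at hr
    simp [hr, encodeReply]

theorem lrEnc_length_le (h : S.ReplyBound n k L) (b : Bool) : (S.lrEnc n k b).RepliesLE L := by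
  intro s o x y r hr
  rw [lrEnc] at hr
  split_ifs at hr with hx hb
  · obtain ⟨c, hc, rfl⟩ := (mem_support_map_iff _ _ _).1 hr
    exact h.2 _ hx.2 c hc
  · obtain ⟨c, hc, rfl⟩ := (mem_support_map_iff _ _ _).1 hr
    exact h.2 _ hx.1 c hc
  · rw [support_pure, Set.mem_singleton_iff] at hr
    simp [hr, encodeReply]

theorem length_le_of_mem_dec {c : List Bool} {m : Option (List Bool)}
    (hm : m ∈ (S.Dec n k c).support) : (encodeReply m).length ≤ S.msgLen n + 1 := by
  obtain ⟨w, -, rfl⟩ := (mem_support_map_iff _ _ _).1 hm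
  rcases w with _ | ⟨_ | _, w⟩
  · simp [parsePlaintext, encodeReply]
  · simp [parsePlaintext, encodeReply]
  · rw [parsePlaintext]
    split_ifs with h <;> simp [encodeReply, h]

theorem aeRealOracle_length_le (h : S.ReplyBound n k L) : (S.aeRealOracle n k).RepliesLE L := by
  rintro s (_ | _) x y r hr
  · exact realEnc_length_le h s () x y r hr
  · simp only [aeRealOracle] at hr
    split_ifs at hr with hx
    · rw [support_pure, Set.mem_singleton_iff] at hr
      simp [hr, encodeReply]
    · obtain ⟨m, hm, rfl⟩ := (mem_support_map_iff _ _ _).1 hr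
      exact (length_le_of_mem_dec hm).trans h.1

theorem aeIdealOracle_length_le (h : S.ReplyBound n k L) :
    (S.aeIdealOracle n k).RepliesLE L := by
  rintro s (_ | _) x y r hr
  · exact randEnc_length_le h s () x y r hr
  · simp only [aeIdealOracle, support_pure, Set.mem_singleton_iff] at hr
    simp [hr, encodeReply]

variable (S) in
-- Substituting the reply bound turns `PolyTime` into a bound in the security parameter, the same
-- for all the oracles used.
theorem exists_time_bound {ι : Type} {A : Prog ι} (hA : A.PolyTime) : ∃ T : Polynomial ℕ,
    ∀ n, ∀ k ∈ (S.KeyGen n).support, ∀ {σ : Type} {O : Oracle ι σ},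
      (∀ L, S.ReplyBound n k L → O.RepliesLE L) → ∀ s₀,
        ∀ s ∈ (A.run O (Config.init [unary n] s₀)).support, s.time ≤ T.eval n := by
  obtain ⟨Q, hQ⟩ := S.exists_replyBound
  obtain ⟨p, hp⟩ := hA
  refine ⟨p.comp (Polynomial.X + Q), fun n k hk σ O hO s₀ s hs => ?_⟩
  simpa [unary] using hp σ O s₀ [unary n] _ (hO _ (hQ n k hk)) s hs

variable (S) in
-- Only the rejection of an honest ciphertext matters below; its probability and that of the right
-- plaintext add up to at most 1. `ENNReal.ofReal` cuts off negative values of the given error.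
theorem exists_correctness_error : ∃ ε : ℕ → ENNReal, NegligibleENN ε ∧
    ∀ n, ∀ k ∈ (S.KeyGen n).support, ∀ m : List Bool, m.length = S.msgLen n →
      ((S.Enc n k m).expect fun c => S.Dec n k c none) ≤ ε n := by
  obtain ⟨ε, hε, h⟩ := S.correct
  refine ⟨fun n => ENNReal.ofReal (ε n), ⟨fun n => ENNReal.ofReal_ne_top, ?_⟩,
    fun n k hk m hm => ?_⟩
  · refine hε.of_abs_le fun n => ?_
    rw [abs_of_nonneg ENNReal.toReal_nonneg, ENNReal.toReal_ofReal']
    exact max_le (le_abs_self _) (abs_nonneg _)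
  · have h := h n k hk m hm
    set μ := (S.Enc n k m).bind (S.Dec n k) with hμ
    change μ none ≤ _
    have hle : μ none + μ (some m) ≤ 1 := by
      rw [← μ.tsum_coe, ← Finset.sum_pair (f := μ) (by simp : (none : Option (List Bool)) ≠ some m)]
      exact ENNReal.sum_le_tsum _
    have h1 : μ none ≠ ⊤ := PMF.apply_ne_top _ _
    have h2 : μ (some m) ≠ ⊤ := PMF.apply_ne_top _ _
    have := ENNReal.toReal_mono ENNReal.one_ne_top hle
    rw [ENNReal.toReal_add h1 h2, ENNReal.toReal_one] at this
    rw [← ENNReal.ofReal_toReal h1]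
    exact ENNReal.ofReal_le_ofReal (by linarith)

variable {ε : ENNReal} {A : Prog Unit} {T : ℕ}

/-- The expected number of ciphertexts issued that fail to decrypt is small. -/
theorem expect_decFail_le
    (hε : ∀ m : List Bool, m.length = S.msgLen n →
      ((S.Enc n k m).expect fun c => S.Dec n k c none) ≤ ε)
    (hT : ∀ s ∈ (A.run (S.realEnc n k) (Config.init [unary n] [])).support, s.time ≤ T) :
    ((A.exec (S.realEnc n k) [] [unary n]).expect fun r =>
      (r.2.map fun c => S.Dec n k c none).sum) ≤ T * ε := by
  -- A query adds at most one ciphertext to the list, with expected failure probability at most `ε`;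
  -- the drift bound sums this over the steps.
  have := expect_exec_le (f := fun W => (W.map fun c => S.Dec n k c none).sum) (ε := ε) ?_ hT
  · simpa [mul_comm] using this
  · intro s o x y
    rw [realEnc]
    split_ifs with hx
    · rw [expect_map]
      simp only [List.map_cons, List.sum_cons]
      rw [expect_add, expect_const, add_comm]
      exact add_le_add_right (hε x hx) _
    · rw [expect_pure]
      exact le_self_add

/-- A union bound: the adversary chooses which issued ciphertext to output, so its failure
probability is bounded by the sum over all of them. -/
theorem one_le_decValid_add {c : List Bool} {W : List (List Bool)} (h : c ∈ W) :
    1 ≤ S.decValid n k c + (W.map fun c => S.Dec n k c none).sum := by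
  rw [← decValid_add_none (S := S) (n := n) (k := k) c]
  exact add_le_add_right (List.single_le_sum (fun _ _ => zero_le) _
    (List.mem_map_of_mem (f := fun c => S.Dec n k c none) h)) _

theorem replayProb_le
    (hε : ∀ m : List Bool, m.length = S.msgLen n →
      ((S.Enc n k m).expect fun c => S.Dec n k c none) ≤ ε)
    (hT : ∀ s ∈ (A.run (S.realEnc n k) (Config.init [unary n] [])).support, s.time ≤ T) :
    S.replayProb A n k ≤ S.forgeProb A n k + T * ε := by
  refine le_trans ?_ (add_le_add_right (expect_decFail_le hε hT) _)
  rw [forgeProb, ← expect_add]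
  refine expect_mono fun r _ => ?_
  split_ifs with h
  · exact one_le_decValid_add h
  · exact zero_le

/-- A valid output has either been issued or counts against integrity. -/
theorem forgeProb_le (A : Prog Unit) :
    S.forgeProb A n k ≤ S.replayProb A n k + S.ctxtProb A n k := by
  rw [replayProb, ctxtProb, ← expect_add]
  refine expect_mono fun r _ => ?_
  split_ifs with h
  · simpa using decValid_le_one r.1
  · simp

theorem realEnc_issues : (S.realEnc n k).Issues () := by
  intro W x y r hr
  rw [realEnc] at hr
  split_ifs at hr with hx
  · obtain ⟨c, hc, rfl⟩ := (mem_support_map_iff _ _ _).1 hr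
    exact Or.inl ⟨c, rfl⟩
  · rw [support_pure, Set.mem_singleton_iff] at hr
    exact Or.inr hr

theorem randEnc_issues : (S.randEnc n k).Issues () := by
  intro W x y r hr
  rw [randEnc] at hr
  split_ifs at hr with hx
  · obtain ⟨c, hc, rfl⟩ := (mem_support_map_iff _ _ _).1 hr
    exact Or.inl ⟨c, rfl⟩
  · rw [support_pure, Set.mem_singleton_iff] at hr
    exact Or.inr hr

end SKES

/-! ### The oracle and the record in the left-or-right reduction -/

theorem PMF.expect_le_add {α : Type*} {μ : PMF α} {f g h : α → ENNReal}
    (H : ∀ a ∈ μ.support, f a ≤ g a + h a) : μ.expect f ≤ μ.expect g + μ.expect h :=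
  (expect_mono H).trans (expect_add μ g h).le

/-- Forward the query `x` or `y` to an encryption oracle if they have the same length. -/
noncomputable def selectOracle {σ : Type} (b : Bool) (O : Oracle Unit σ) : Oracle Unit σ :=
  fun s _ x y => if x.length = y.length then O s () (if b then y else x) [] else PMF.pure ([], s)

/-- What the replies that were recorded tell about the ciphertexts issued. -/
def Reflects (W issued : List (List Bool)) : Prop :=
  (firstReply W = [] ↔ issued = []) ∧ (firstReply W ≠ [] → (firstReply W).tail ∈ issued) ∧
    ∀ c ∈ issued, true :: c ∈ W

theorem Reflects.cons_nil {W issued : List (List Bool)} (h : Reflects W issued) :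
    Reflects ([] :: W) issued := by
  have : firstReply ([] :: W) = firstReply W := by
    rw [firstReply]
    split_ifs with h <;> simp [h]
  rw [Reflects, this]
  exact ⟨h.1, h.2.1, fun c hc => List.mem_cons_of_mem _ (h.2.2 c hc)⟩

theorem Reflects.cons {W issued : List (List Bool)} (h : Reflects W issued) (c : List Bool) :
    Reflects ((true :: c) :: W) (c :: issued) := by
  obtain ⟨-, h2, h3⟩ := h
  have hne : firstReply ((true :: c) :: W) ≠ [] := by
    rw [firstReply]
    split_ifs with h <;> simp [h]
  refine ⟨by simp [hne], fun _ => ?_, fun d hd => ?_⟩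
  · rw [firstReply]
    split_ifs with h
    · simp
    · exact List.mem_cons_of_mem _ (h2 h)
  · rcases List.mem_cons.1 hd with rfl | hd
    · simp
    · exact List.mem_cons_of_mem _ (h3 d hd)

theorem lift_exec_select {O : Oracle Unit (List (List Bool))} (hO : O.Issues ()) (b : Bool)
    (A : Prog Unit) (inputs : List (List Bool)) :
    Lift (fun r₁ r₂ => r₁.1 = r₂.1 ∧ r₁.2.2 = r₂.2 ∧ Reflects r₁.2.1 r₂.2)
      (A.exec ((selectHandler b).stepDist O) (([] : List (List Bool)), []) inputs)
      (A.exec (selectOracle b O) [] inputs) := by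
  refine lift_exec_of_step (R := fun (s₁ : List (List Bool) × List (List Bool)) s₂ =>
    s₁.2 = s₂ ∧ Reflects s₁.1 s₂) ?_ A ⟨rfl, by simp [Reflects, firstReply]⟩ inputs
  rintro ⟨W, _⟩ s ⟨rfl, h⟩ _ x y
  simp only [selectHandler, selectOracle]
  by_cases hx : x.length = y.length
  · rw [if_pos hx, if_pos hx]
    refine Lift.map_left fun r hr => ⟨rfl, rfl, ?_⟩
    obtain ⟨c, rfl⟩ | rfl := hO _ _ _ r hr
    · exact h.cons c
    · exact h.cons_nil
  · rw [if_neg hx, if_neg hx]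
    exact Lift.pure ⟨rfl, rfl, h⟩

namespace SKES

variable {S : SKES} {n : ℕ} {k : List Bool}

theorem uf_iff : S.UF ↔ ∀ A : Prog Unit, A.PolyTime →
    Close (fun n => (S.KeyGen n).expect (S.forgeProb A n))
      (fun n => (S.KeyGen n).expect (S.cheatProb A n)) := by
  refine forall₂_congr fun A _ => ?_
  simp only [← ufForge_apply, ← ufCheat_apply]
  exact (Close.iff_negligible (fun n => PMF.coe_le_one _ _) (fun n => PMF.coe_le_one _ _)).symm

theorem indcpa_iff : S.INDCPA ↔ ∀ A : Prog Unit, A.PolyTime →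
    Close (fun n => (S.KeyGen n).expect (S.cpaProb A true n))
      (fun n => (S.KeyGen n).expect (S.cpaProb A false n)) := by
  refine forall₂_congr fun A _ => ?_
  simp only [← cpaGame_apply]
  exact (Close.iff_negligible (fun n => PMF.coe_le_one _ _) (fun n => PMF.coe_le_one _ _)).symm

theorem indcca3_iff : S.INDCCA3 ↔ ∀ A : Prog AEOracle, A.PolyTime →
    Close (fun n => (S.KeyGen n).expect fun k => aeProb (S.aeRealOracle n k) [] A n)
      (fun n => (S.KeyGen n).expect fun k => aeProb (S.aeIdealOracle n k) [] A n) := by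
  refine forall₂_congr fun A _ => ?_
  simp only [← aeReal_apply, ← aeIdeal_apply]
  exact (Close.iff_negligible (fun n => PMF.coe_le_one _ _) (fun n => PMF.coe_le_one _ _)).symm

theorem intctxt_iff : S.INTCTXT ↔ ∀ A : Prog Unit, A.PolyTime →
    NegligibleENN fun n => (S.KeyGen n).expect (S.ctxtProb A n) := by
  refine forall₂_congr fun A _ => ?_
  simp only [← ctxtGame_apply]
  exact ⟨NegligibleENN.of_negligible fun n => PMF.coe_le_one _ _, fun h => h.2⟩

/-! ### Unforgeability implies authenticated encryption -/

variable (S) in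
-- The replacement string is longer than all ciphertexts issued, so cheating is impossible; and
-- whenever it replaces the output, the given adversary had not won.
theorem exists_fresh_forger {A : Prog Unit} (hA : A.PolyTime) : ∃ B : Prog Unit, B.PolyTime ∧
    ∀ n, ∀ k ∈ (S.KeyGen n).support,
      S.ctxtProb A n k ≤ S.forgeProb B n k ∧ S.cheatProb B n k = 0 := by
  obtain ⟨Q, hQ⟩ := S.exists_replyBound
  obtain ⟨B, hB, H⟩ := freshHandler.exists_reduction hA
  refine ⟨B, hB, fun n k hk => ?_⟩
  have key : ∀ O : Oracle Unit (List (List Bool)), O.RepliesLE (Q.eval n) →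
      B.exec O [] [unary n] = (A.exec (recordDist () O) ([], []) [unary n]).map fun r =>
        (if true :: r.1 ∈ r.2.1 then List.replicate (encodeList r.2.1).length true else r.1,
          r.2.2) := fun O hO => (H hO [] (unary n)).trans (PMF.pure_bind _ _)
  constructor
  · rw [forgeProb, key _ (realEnc_length_le (hQ n k hk)), expect_map]
    refine (lift_exec_recordDist realEnc_issues A _).swap.expect_le ?_
    rintro ⟨x, s⟩ ⟨_, W, _⟩ ⟨rfl, rfl, h⟩
    simp only [h]
    split_ifs
    · exact zero_le
    · exact le_rfl
  · rw [cheatProb, key _ (randEnc_length_le (hQ n k hk)), expect_map]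
    refine ((lift_exec_recordDist randEnc_issues A _).expect_eq (g := fun _ => 0) ?_).trans
      (expect_const _ 0)
    rintro ⟨_, W, _⟩ ⟨x, s⟩ ⟨rfl, rfl, h⟩
    refine if_neg fun hmem => ?_
    simp only [h] at hmem
    split_ifs at hmem with hx
    · have h1 := List.single_le_sum (fun _ _ => Nat.zero_le _) _
        (List.mem_map_of_mem (f := fun w => w.length + 1) ((h _).2 hmem))
      have h2 := (length_encodeList W).1
      simp only [List.length_cons, List.length_replicate] at h1
      omega
    · exact hx hmem

theorem UF.intctxt (h : S.UF) : S.INTCTXT := by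
  rw [uf_iff] at h
  refine intctxt_iff.2 fun A hA => ?_
  obtain ⟨B, hB, H⟩ := S.exists_fresh_forger hA
  obtain ⟨d, hd, Hd⟩ := h B hB
  refine hd.mono fun n => ?_
  calc (S.KeyGen n).expect (S.ctxtProb A n)
      ≤ (S.KeyGen n).expect (S.forgeProb B n) := expect_mono fun k hk => (H n k hk).1
    _ ≤ (S.KeyGen n).expect (S.cheatProb B n) + d n := (Hd n).1
    _ = d n := by
      rw [expect_congr fun k hk => (H n k hk).2, expect_const, zero_add]

/-- An issued ciphertext is valid up to the correctness error, and a valid string was issued unless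
integrity is broken. -/
theorem INTCTXT.close_replay (h : S.INTCTXT) {A : Prog Unit} (hA : A.PolyTime) :
    Close (fun n => (S.KeyGen n).expect (S.replayProb A n))
      (fun n => (S.KeyGen n).expect (S.forgeProb A n)) := by
  rw [intctxt_iff] at h
  obtain ⟨T, hT⟩ := S.exists_time_bound hA
  obtain ⟨ε, hε, H⟩ := S.exists_correctness_error
  refine ⟨_, (h A hA).add (hε.polynomial_mul T), fun n => ⟨?_, ?_⟩⟩
  · refine le_trans ?_ (add_le_add_right le_add_self _)
    rw [← expect_const (S.KeyGen n) (((T.eval n : ℕ) : ENNReal) * ε n)]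
    exact expect_le_add fun k hk => replayProb_le (H n k hk)
      (hT n k hk (fun L hL => realEnc_length_le hL) _)
  · refine le_trans ?_ (add_le_add_right le_self_add _)
    exact expect_le_add fun k _ => forgeProb_le A

variable (S) in
-- The output is an issued ciphertext exactly if the distinguisher says 1 after some ciphertext was
-- issued. The oracle is left open because both real and random encryption are plugged in.
theorem exists_selecting_forger {A : Prog Unit} (hA : A.PolyTime) (b : Bool) :
    ∃ B : Prog Unit, B.PolyTime ∧ ∀ n, ∀ k ∈ (S.KeyGen n).support,
      ∀ O : Oracle Unit (List (List Bool)), O.Issues () →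
        (∀ L, S.ReplyBound n k L → O.RepliesLE L) →
          ((B.exec O [] [unary n]).expect fun r => if r.1 ∈ r.2 then 1 else 0) =
            (A.exec (selectOracle b O) [] [unary n]).expect fun r =>
              if r.1.head? = some true ∧ r.2 ≠ [] then 1 else 0 := by
  obtain ⟨Q, hQ⟩ := S.exists_replyBound
  obtain ⟨B, hB, H⟩ := (selectHandler b).exists_reduction hA
  refine ⟨B, hB, fun n k hk O hO hL => ?_⟩
  have key : B.exec O [] [unary n] =
      (A.exec ((selectHandler b).stepDist O) (([] : List (List Bool)), []) [unary n]).map fun r =>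
        (if r.1.head? = some true ∧ firstReply r.2.1 ≠ [] then (firstReply r.2.1).tail
          else List.replicate (r.2.1.map List.length).sum true, r.2.2) :=
    (H (hL _ (hQ n k hk)) [] (unary n)).trans (PMF.pure_bind _ _)
  rw [key, expect_map]
  refine (lift_exec_select hO b A _).expect_eq ?_
  rintro ⟨x, W, s⟩ ⟨_, _⟩ ⟨rfl, rfl, h1, h2, h3⟩
  simp only [ne_eq, ← h1]
  by_cases hb : x.head? = some true ∧ ¬firstReply W = []
  · rw [if_pos hb, if_pos hb, if_pos (h2 hb.2)]
  · rw [if_neg hb, if_neg hb, if_neg]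
    intro ha
    -- Replies carry a leading bit, so the total length of the replies exceeds the length of each
    -- ciphertext.
    have h4 := List.single_le_sum (fun _ _ => Nat.zero_le _) _
      (List.mem_map_of_mem (f := List.length) (h3 _ ha))
    simp only [List.length_cons, List.length_replicate] at h4
    omega

theorem selectOracle_realEnc (b : Bool) : selectOracle b (S.realEnc n k) = S.lrEnc n k b := by
  funext s _ x y
  simp only [selectOracle, realEnc, lrEnc]
  by_cases hxy : x.length = y.length
  · cases b <;> simp [hxy]
  · rw [if_neg hxy, if_neg (by rintro ⟨h1, h2⟩; exact hxy (h1.trans h2.symm))]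
    rfl

/-- Random encryption looks only at the length of its query, and the two candidates have equal
length. -/
theorem selectOracle_randEnc : selectOracle true (S.randEnc n k) =
    selectOracle false (S.randEnc n k) := by
  funext s _ x y
  simp only [selectOracle, randEnc]
  by_cases hxy : x.length = y.length <;> simp [hxy]

/-- Without a ciphertext, the two sides cannot be told apart. -/
theorem lrEnc_expect_eq (A : Prog Unit) (inputs : List (List Bool)) :
    ((A.exec (S.lrEnc n k true) [] inputs).expect fun r =>
        if r.1.head? = some true ∧ r.2 = [] then (1 : ENNReal) else 0) =
      (A.exec (S.lrEnc n k false) [] inputs).expect fun r =>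
        if r.1.head? = some true ∧ r.2 = [] then 1 else 0 := by
  -- Both sides accept the same queries, so the first ciphertext is issued at the same time on both;
  -- from then on neither run contributes.
  refine (lift_exec (R := fun s₁ s₂ => s₁ = [] ∧ s₂ = []) (Bad := fun s₁ s₂ => s₁ ≠ [] ∧ s₂ ≠ [])
    ?_ ?_ ?_ A ⟨rfl, rfl⟩ inputs).expect_eq ?_
  · rintro _ _ ⟨rfl, rfl⟩ _ x y
    rw [lrEnc, lrEnc]
    by_cases hx : x.length = S.msgLen n ∧ y.length = S.msgLen n
    · rw [if_pos hx, if_pos hx]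
      refine Lift.of_support fun a ha b hb => Or.inr ?_
      obtain ⟨c, -, rfl⟩ := (mem_support_map_iff _ _ _).1 ha
      obtain ⟨d, -, rfl⟩ := (mem_support_map_iff _ _ _).1 hb
      simp
    · rw [if_neg hx, if_neg hx]
      exact Lift.pure (Or.inl ⟨rfl, rfl, rfl⟩)
  · intro s₁ s₂ h _ x y r hr
    refine ⟨?_, h.2⟩
    rw [lrEnc] at hr
    split_ifs at hr
    · obtain ⟨c, -, rfl⟩ := (mem_support_map_iff _ _ _).1 hr
      simp
    · obtain ⟨c, -, rfl⟩ := (mem_support_map_iff _ _ _).1 hr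
      simp
    · rw [support_pure, Set.mem_singleton_iff] at hr
      simpa [hr] using h.1
  · intro s₁ s₂ h _ x y r hr
    refine ⟨h.1, ?_⟩
    rw [lrEnc] at hr
    split_ifs at hr
    · obtain ⟨c, -, rfl⟩ := (mem_support_map_iff _ _ _).1 hr
      simp
    · obtain ⟨c, -, rfl⟩ := (mem_support_map_iff _ _ _).1 hr
      simp
    · rw [support_pure, Set.mem_singleton_iff] at hr
      simpa [hr] using h.2
  · rintro ⟨x, s⟩ ⟨y, s'⟩ (⟨h, h1, h2⟩ | ⟨h1, h2⟩)
    · simp only at h h1 h2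
      simp [h, h1, h2]
    · simp only at h1 h2
      simp [h1, h2]

theorem UF.indcpa (h : S.UF) : S.INDCPA := by
  have hctxt := h.intctxt
  rw [uf_iff] at h
  refine indcpa_iff.2 fun A hA => ?_
  choose B hB H using S.exists_selecting_forger hA
  have hreplay : ∀ b n, ∀ k ∈ (S.KeyGen n).support, S.replayProb (B b) n k =
      (A.exec (S.lrEnc n k b) [] [unary n]).expect fun r =>
        if r.1.head? = some true ∧ r.2 ≠ [] then 1 else 0 := fun b n k hk => by
    rw [replayProb, H b n k hk _ realEnc_issues fun L hL => realEnc_length_le hL,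
      selectOracle_realEnc]
  have hcheat : ∀ n, (S.KeyGen n).expect (S.cheatProb (B true) n) =
      (S.KeyGen n).expect (S.cheatProb (B false) n) := fun n => expect_congr fun k hk => by
    rw [cheatProb, cheatProb, H true n k hk _ randEnc_issues fun L hL => randEnc_length_le hL,
      H false n k hk _ randEnc_issues fun L hL => randEnc_length_le hL, selectOracle_randEnc]
  have hclose : ∀ b, Close (fun n => (S.KeyGen n).expect (S.replayProb (B b) n))
      (fun n => (S.KeyGen n).expect (S.cheatProb (B b) n)) := fun b =>
    (hctxt.close_replay (hB b)).trans (h _ (hB b))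
  have hmain := hclose true
  simp only [hcheat] at hmain
  obtain ⟨d, hd, Hd⟩ := hmain.trans (hclose false).symm
  -- Split by whether a ciphertext was issued. The part without ciphertexts is written with the
  -- right side for both values of `b`, so it is a common summand.
  have hsplit : ∀ b n, (S.KeyGen n).expect (S.cpaProb A b n) =
      ((S.KeyGen n).expect (S.replayProb (B b) n)) + (S.KeyGen n).expect fun k =>
        (A.exec (S.lrEnc n k true) [] [unary n]).expect fun r =>
          if r.1.head? = some true ∧ r.2 = [] then 1 else 0 := fun b n => by
    rw [← expect_add]
    refine expect_congr fun k hk => ?_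
    have e : ((A.exec (S.lrEnc n k true) [] [unary n]).expect fun r =>
          if r.1.head? = some true ∧ r.2 = [] then (1 : ENNReal) else 0) =
        (A.exec (S.lrEnc n k b) [] [unary n]).expect fun r =>
          if r.1.head? = some true ∧ r.2 = [] then 1 else 0 := by
      cases b
      · exact lrEnc_expect_eq A _
      · rfl
    rw [hreplay b n k hk, e, ← expect_add, cpaProb]
    refine expect_congr fun r _ => ?_
    by_cases h1 : r.1.head? = some true <;> by_cases h2 : r.2 = [] <;> simp [h1, h2]
  refine ⟨d, hd, fun n => ?_⟩
  simp only [hsplit]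
  rw [add_right_comm, add_right_comm _ _ (d n)]
  exact ⟨add_le_add_left (Hd n).1 _, add_le_add_left (Hd n).2 _⟩

/-! ### The real/ideal form implies unforgeability -/

variable (S) in
-- Real decryption rejects issued ciphertexts, so these are accepted by means of the record; ideal
-- decryption always rejects, so there the record alone decides.
theorem exists_validity_distinguisher {A : Prog Unit} (hA : A.PolyTime) :
    ∃ B : Prog AEOracle, B.PolyTime ∧ ∀ n, ∀ k ∈ (S.KeyGen n).support,
      (aeProb (S.aeRealOracle n k) [] B n = (A.exec (S.realEnc n k) [] [unary n]).expect fun r =>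
        if r.1 ∈ r.2 then 1 else S.decValid n k r.1) ∧
      aeProb (S.aeIdealOracle n k) [] B n = S.cheatProb A n k := by
  obtain ⟨Q, hQ⟩ := S.exists_replyBound
  obtain ⟨B, hB, H⟩ := validHandler.exists_reduction hA
  refine ⟨B, hB, fun n k hk => ?_⟩
  have key : ∀ O : Oracle AEOracle (List (List Bool)), O.RepliesLE (Q.eval n) →
      B.exec O [] [unary n] = (A.exec (recordDist AEOracle.enc O) ([], []) [unary n]).bind
        fun r => (O r.2.2 AEOracle.dec r.1 []).map fun r' =>
          (if true :: r.1 ∈ r.2.1 ∨ r'.1 ≠ [] then [true] else [], r'.2) :=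
    fun O hO => (H hO [] (unary n)).trans (PMF.pure_bind _ _)
  have hreal : (S.aeRealOracle n k).Issues AEOracle.enc := fun W x y r hr =>
    realEnc_issues W x y r hr
  have hideal : (S.aeIdealOracle n k).Issues AEOracle.enc := fun W x y r hr =>
    randEnc_issues W x y r hr
  constructor
  · rw [aeProb, key _ (aeRealOracle_length_le (hQ n k hk)), expect_bind]
    refine (lift_exec_recordDist hreal A _).expect_eq ?_
    rintro ⟨x, W, s⟩ ⟨_, _⟩ ⟨rfl, rfl, h⟩
    have h : true :: x ∈ W ↔ x ∈ s := h x
    simp only [expect_map, aeRealOracle]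
    by_cases hx : x ∈ s
    · simp [hx, h.2 hx]
    · rw [if_neg hx, if_neg hx, expect_map, decValid]
      refine expect_congr fun m _ => ?_
      cases m <;> simp [encodeReply, mt h.1 hx]
  · rw [aeProb, key _ (aeIdealOracle_length_le (hQ n k hk)), expect_bind]
    refine (lift_exec_recordDist hideal A _).expect_eq ?_
    rintro ⟨x, W, s⟩ ⟨_, _⟩ ⟨rfl, rfl, h⟩
    have h : true :: x ∈ W ↔ x ∈ s := h x
    simp only [expect_map, aeIdealOracle, expect_pure]
    by_cases hx : x ∈ s
    · simp [hx, h.2 hx]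
    · simp [encodeReply, hx, mt h.1 hx]

theorem INDCCA3.uf (h : S.INDCCA3) : S.UF := by
  rw [indcca3_iff] at h
  refine uf_iff.2 fun A hA => ?_
  obtain ⟨B, hB, H⟩ := S.exists_validity_distinguisher hA
  obtain ⟨T, hT⟩ := S.exists_time_bound hA
  obtain ⟨ε, hε, Hε⟩ := S.exists_correctness_error
  -- The distinguisher accepts every issued ciphertext, the forging game only if it decrypts;
  -- decryption failures are the only gap.
  have hforge : Close (fun n => (S.KeyGen n).expect (S.forgeProb A n))
      (fun n => (S.KeyGen n).expect fun k => aeProb (S.aeRealOracle n k) [] B n) := by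
    refine ⟨_, hε.polynomial_mul T, fun n => ⟨?_, ?_⟩⟩
    · refine le_trans (expect_mono fun k hk => ?_) le_self_add
      rw [(H n k hk).1]
      refine expect_mono fun r _ => ?_
      split_ifs
      · exact decValid_le_one _
      · exact le_rfl
    · rw [← expect_const (S.KeyGen n) (((T.eval n : ℕ) : ENNReal) * ε n)]
      refine expect_le_add fun k hk => ?_
      rw [(H n k hk).1]
      refine le_trans ?_ (add_le_add_right (expect_decFail_le (Hε n k hk)
        (hT n k hk (fun L hL => realEnc_length_le hL) _)) _)
      refine expect_le_add fun r _ => ?_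
      split_ifs with hr
      · exact one_le_decValid_add hr
      · exact le_self_add
  have hcheat : ∀ n, (S.KeyGen n).expect (fun k => aeProb (S.aeIdealOracle n k) [] B n) =
      (S.KeyGen n).expect (S.cheatProb A n) := fun n => expect_congr fun k hk => (H n k hk).2
  have hB' := h B hB
  simp only [hcheat] at hB'
  exact hforge.trans hB'

end SKES

/-! ### From rejection of all decryption queries to the ideal world -/

theorem PMF.Lift.expect_le_add {α β : Type*} {R : α → β → Prop} {μ : PMF α} {ν : PMF β}
    {f h : α → ENNReal} {g : β → ENNReal} (H : Lift R μ ν)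
    (hfg : ∀ a b, R a b → f a ≤ g b + h a) : μ.expect f ≤ ν.expect g + μ.expect h := by
  obtain ⟨ρ, rfl, rfl, hρ⟩ := H
  simp only [expect_map]
  exact PMF.expect_le_add fun p hp => hfg _ _ (hρ p hp)

namespace SKES

variable (S : SKES)

/-- Encryption, and decryption that always rejects. -/
noncomputable def rejectOracle (n : ℕ) (k : List Bool) : Oracle AEOracle (List (List Bool)) :=
  fun issued o x y =>
    match o with
    | AEOracle.enc => S.realEnc n k issued () x y
    | AEOracle.dec => PMF.pure ([], issued)

variable {S} {n : ℕ} {k : List Bool} {L : ℕ}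

/-- By `henc`, averaging over the random right-hand string turns left-or-right encryption into the
encryption of `O`. This can be done query by query since each string is drawn afresh and then
discarded. -/
theorem aeProb_randomize {A : Prog AEOracle} {B : Prog Unit} {b : Bool}
    {O : Oracle AEOracle (List (List Bool))}
    (H : B.exec (S.lrEnc n k b) [] [unary n] = (randomizeHandler.startDist (unary n)).bind fun q =>
      (A.exec (randomizeHandler.stepDist (S.lrEnc n k b)) (q, []) [unary n]).bind fun r =>
        randomizeHandler.finishDist (S.lrEnc n k b) r.2 r.1)
    (henc : ∀ s x y, ((uniformBits x.length).bind fun w => S.lrEnc n k b s () x w) =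
      O s AEOracle.enc x y)
    (hdec : ∀ s x y, O s AEOracle.dec x y = PMF.pure ([], s)) :
    S.cpaProb B b n k = aeProb O [] A n := by
  have H : B.exec (S.lrEnc n k b) [] [unary n] = (A.exec (fun (s : Unit × _) o x y =>
      randomizeHandler.stepDist (S.lrEnc n k b) s o x y) ((), []) [unary n]).map fun r =>
        (r.1, r.2.2) := H.trans (PMF.pure_bind _ _)
  rw [cpaProb, H, expect_map, aeProb]
  refine (lift_exec_of_step (R := fun (s₁ : Unit × List (List Bool)) s₂ => s₁.2 = s₂) ?_ A rfl
    [unary n]).expect_eq fun a b h => by rw [h.1]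
  rintro ⟨_, s⟩ _ rfl o x y
  cases o with
  | enc =>
    simp only [randomizeHandler, ← henc]
    have e : ((uniformBits x.length).bind fun w => (S.lrEnc n k b s () x w).map
        fun r => (r.1, ((), r.2))) = ((uniformBits x.length).bind fun w =>
          S.lrEnc n k b s () x w).map fun r => (r.1, ((), r.2)) := (PMF.map_bind _ _ _).symm
    rw [e]
    exact Lift.map_left fun r _ => ⟨rfl, rfl⟩
  | dec =>
    rw [hdec]
    exact Lift.pure ⟨rfl, rfl⟩

variable (S) in
theorem exists_randomized_distinguisher {A : Prog AEOracle} (hA : A.PolyTime) :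
    ∃ B : Prog Unit, B.PolyTime ∧ ∀ n, ∀ k ∈ (S.KeyGen n).support,
      S.cpaProb B true n k = aeProb (S.aeIdealOracle n k) [] A n ∧
        S.cpaProb B false n k = aeProb (S.rejectOracle n k) [] A n := by
  obtain ⟨Q, hQ⟩ := S.exists_replyBound
  obtain ⟨B, hB, H⟩ := randomizeHandler.exists_reduction hA
  refine ⟨B, hB, fun n k hk => ⟨?_, ?_⟩⟩
  · refine aeProb_randomize (H (lrEnc_length_le (hQ n k hk) true) [] _) (fun s x y => ?_)
      fun s x y => rfl
    simp only [lrEnc, aeIdealOracle, randEnc]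
    by_cases hx : x.length = S.msgLen n
    · rw [if_pos hx, hx, PMF.map_bind]
      exact bind_congr fun w hw => by simp [length_of_mem_uniformBits hw]
    · simp [hx]
  · refine aeProb_randomize (H (lrEnc_length_le (hQ n k hk) false) [] _) (fun s x y => ?_)
      fun s x y => rfl
    simp only [lrEnc, rejectOracle, realEnc]
    by_cases hx : x.length = S.msgLen n
    · rw [if_pos hx, hx]
      -- The left side is encrypted, so the random string is ignored.
      refine Eq.trans (bind_congr fun w hw => ?_) (PMF.bind_const (uniformBits (S.msgLen n)) _)
      simp [length_of_mem_uniformBits hw]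
    · simp [hx]

/-! ### Detecting forgeries among the decryption queries -/

variable (S) in
/-- Is the string a valid ciphertext that was not issued? -/
noncomputable def isForgery (n : ℕ) (k : List Bool) (issued : List (List Bool)) (x : List Bool) :
    PMF Bool :=
  if x ∈ issued then PMF.pure false else (S.Dec n k x).map Option.isSome

variable (S) in
/-- Decryption always rejects, but it is recorded which of the queries are forgeries. -/
noncomputable def watchOracle (n : ℕ) (k : List Bool) :
    Oracle AEOracle (List (List Bool) × List Bool) :=
  fun s o x y =>
    match o with
    | AEOracle.enc => (S.realEnc n k s.1 () x y).map fun r => (r.1, (r.2, s.2))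
    | AEOracle.dec => (S.isForgery n k s.1 x).map fun b => ([], (s.1, s.2 ++ [b]))

variable (S) in
/-- It is recorded if one of the decryption queries, whose number is given, is a forgery. -/
noncomputable def stopOracle (n : ℕ) (k : List Bool) :
    Oracle AEOracle (((ℕ × Option (List Bool)) × List (List Bool)) × Bool) :=
  fun s o x y =>
    match o, s.1.1.2 with
    | AEOracle.enc, none => (S.realEnc n k s.1.2 () x y).map fun r => (r.1, ((s.1.1, r.2), s.2))
    | AEOracle.dec, none =>
      if s.1.1.1 = 0 then
        (S.isForgery n k s.1.2 x).map fun b => ([], (((0, some x), s.1.2), b))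
      else PMF.pure ([], (((s.1.1.1 - 1, none), s.1.2), s.2))
    | _, some _ => PMF.pure ([], s)

variable (S) in
/-- Find out if the query at which the algorithm was stopped is a forgery. -/
noncomputable def judge (n : ℕ) (k : List Bool) (s : (ℕ × Option (List Bool)) × List (List Bool)) :
    PMF (((ℕ × Option (List Bool)) × List (List Bool)) × Bool) :=
  match s.1.2 with
  | none => PMF.pure (s, false)
  | some x => (S.isForgery n k s.2 x).map fun b => (s, b)

theorem watchOracle_length_le (h : S.ReplyBound n k L) : (S.watchOracle n k).RepliesLE L := by
  rintro s (_ | _) x y r hr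
  · obtain ⟨r', hr', rfl⟩ := (mem_support_map_iff _ _ _).1 hr
    exact realEnc_length_le h s.1 () x y r' hr'
  · obtain ⟨b, -, rfl⟩ := (mem_support_map_iff _ _ _).1 hr
    simp

/-- Run the algorithm until it has made a given number of decryption queries. -/
noncomputable def guessOracle {σ : Type} (O : Oracle Unit σ) :
    Oracle AEOracle ((ℕ × Option (List Bool)) × σ) := (guessHandler 0).stepDist O

/-- After the stop neither the stored query nor the issued list changes, so testing the query when
it is made or at the end gives the same distribution. -/
theorem judge_step (s : (ℕ × Option (List Bool)) × List (List Bool)) (o : AEOracle)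
    (x y : List Bool) :
    ((guessOracle (S.realEnc n k) s o x y).bind fun r =>
      (S.judge n k r.2).map fun s' => (r.1, s')) =
      (S.judge n k s).bind fun s' => S.stopOracle n k s' o x y := by
  obtain ⟨⟨i, _ | z⟩, W⟩ := s
  · cases o with
    | enc =>
      simp only [guessOracle, guessHandler, judge, stopOracle, PMF.pure_bind, PMF.bind_map]
      simp only [Function.comp_def, PMF.pure_map]
      rfl
    | dec =>
      cases i with
      | zero =>
        simp only [guessOracle, guessHandler, judge, stopOracle, PMF.pure_bind, if_true, PMF.map_comp]
        rfl
      | succ i =>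
        simp [guessOracle, guessHandler, judge, stopOracle, PMF.pure_bind, PMF.pure_map]
  · have : guessOracle (S.realEnc n k) ((i, some z), W) o x y =
        PMF.pure ([], ((i, some z), W)) := by
      cases o <;> rfl
    rw [this, PMF.pure_bind]
    simp only [judge, PMF.map_comp, PMF.bind_map]
    cases o <;> rfl

/-- The probability that the query number `i` to the decryption oracle is a forgery. -/
noncomputable def queryProb (S : SKES) (A : Prog AEOracle) (n : ℕ) (k : List Bool) (i : ℕ) :
    ENNReal :=
  (A.exec (S.stopOracle n k) (((i, none), []), false) [unary n]).expect fun r =>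
    if r.2.2 then 1 else 0

/-- By `judge_step` and `run_bind_kernel` the test at the chosen query may be postponed to the end,
where it is the test of the integrity game. If the chosen query is never made, nothing is recorded
and the left side gains nothing. -/
theorem queryProb_le (A : Prog AEOracle) (i : ℕ) : queryProb S A n k i ≤
    (A.exec (guessOracle (S.realEnc n k)) ((i, none), []) [unary n]).expect fun r =>
      if r.2.1.2.getD [] ∈ r.2.2 then 0 else S.decValid n k (r.2.1.2.getD []) := by
  have key := run_bind_kernel (S.judge n k) judge_step A
    (Config.init [unary n] ((i, none), []))
  have key' : (A.run (S.stopOracle n k) (Config.init [unary n] (((i, none), []), false))) =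
      (A.run (guessOracle (S.realEnc n k))
        (Config.init [unary n] ((i, none), []))).bind fun u =>
          (S.judge n k u.oracle).map fun s' => (⟨u.store, s', u.time⟩ : Config _) :=
    (key.trans (PMF.pure_bind _ _)).symm
  unfold queryProb exec
  rw [expect_map, expect_map, key', expect_bind]
  refine expect_mono fun u _ => ?_
  obtain ⟨h, ⟨⟨j, _ | z⟩, W⟩, t⟩ := u
  · simp [judge, expect_map]
  · simp only [judge, expect_map, isForgery, Option.getD_some]
    split_ifs with hz
    · simp
    · rw [expect_map, decValid]

theorem expect_queryProb_le {e : ℕ} {A : Prog AEOracle} {B : Prog Unit}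
    (H : B.exec (S.realEnc n k) [] [unary n] =
      ((guessHandler e).startDist (unary n)).bind fun q =>
        (A.exec ((guessHandler e).stepDist (S.realEnc n k)) (q, []) [unary n]).bind fun r =>
          (guessHandler e).finishDist (S.realEnc n k) r.2 r.1) :
    (guess ((n + 2) ^ e)).expect (queryProb S A n k) ≤ S.ctxtProb B n k := by
  -- The exponent enters only the initial guess, so `guessOracle`, which is defined with exponent 0,
  -- serves for every `e`.
  have H : B.exec (S.realEnc n k) [] [unary n] = (guess (((unary n).length + 2) ^ e)).bind fun i =>
      (A.exec (guessOracle (S.realEnc n k)) ((i, none), []) [unary n]).map fun r =>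
        (r.2.1.2.getD [], r.2.2) := H.trans (PMF.bind_map _ _ _)
  rw [ctxtProb, H, expect_bind, unary, List.length_replicate]
  refine expect_mono fun i _ => (queryProb_le A i).trans ?_
  rw [expect_map]
  rfl

/-- Every index below `T` is guessed with probability at least `1 / (2 * (n + 2) ^ e)`. -/
theorem sum_queryProb_le {e : ℕ} {A : Prog AEOracle} {T : ℕ} (hT : T ≤ (n + 2) ^ e) :
    ∑ i ∈ Finset.range T, queryProb S A n k i ≤
      ((2 * (n + 2) ^ e : ℕ) : ENNReal) * (guess ((n + 2) ^ e)).expect (queryProb S A n k) := by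
  set N := (n + 2) ^ e
  have hN : 0 < N := Nat.pow_pos (by omega)
  calc ∑ i ∈ Finset.range T, queryProb S A n k i
      = ((2 * N : ℕ) : ENNReal) * ∑ i ∈ Finset.range T,
          ((2 * N : ℕ) : ENNReal)⁻¹ * queryProb S A n k i := by
        rw [← Finset.mul_sum, ← mul_assoc, ENNReal.mul_inv_cancel, one_mul]
        · exact Nat.cast_ne_zero.2 (by omega)
        · exact ENNReal.natCast_ne_top _
    _ ≤ _ := by
        refine mul_le_mul_right ?_ _
        refine le_trans (Finset.sum_le_sum fun i hi => ?_) (ENNReal.sum_le_tsum (Finset.range T))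
        exact mul_le_mul_left (inv_le_guess hN ((Finset.mem_range.1 hi).le.trans hT)) _

/-- If the query number `i` to the decryption oracle is a forgery, this is detected. -/
theorem watch_le_queryProb (A : Prog AEOracle) (i : ℕ) :
    ((A.exec (S.watchOracle n k) ([], []) [unary n]).expect fun r =>
      if r.2.2[i]? = some true then 1 else 0) ≤ queryProb S A n k i := by
  -- The counter plus the number of verdicts so far stays equal to `i`. `Bad` means that query `i`
  -- has been made; from then on its verdict is fixed, and equal, in both runs.
  refine (lift_exec
    (R := fun (s₁ : List (List Bool) × List Bool)
      (s₂ : ((ℕ × Option (List Bool)) × List (List Bool)) × Bool) =>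
        s₂.1.2 = s₁.1 ∧ s₂.1.1.2 = none ∧ s₂.1.1.1 + s₁.2.length = i)
    (Bad := fun s₁ s₂ => s₂.1.1.2 ≠ none ∧ s₁.2[i]? = some s₂.2) ?_ ?_ ?_ A
    ⟨rfl, rfl, rfl⟩ [unary n]).expect_le ?_
  · rintro ⟨W, tr⟩ ⟨⟨⟨j, z⟩, W'⟩, f⟩ ⟨h1, h2, h3⟩ o x y
    simp only at h1 h2 h3
    subst h1 h2
    cases o with
    | enc =>
      refine (Lift.refl (R := Eq) fun _ _ => rfl).map fun r r' h => Or.inl ?_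
      subst h
      exact ⟨rfl, rfl, rfl, h3⟩
    | dec =>
      simp only [watchOracle, stopOracle]
      by_cases hj : j = 0
      · rw [if_pos hj]
        refine (Lift.refl (R := Eq) fun _ _ => rfl).map fun r r' h => Or.inr ?_
        subst h
        refine ⟨by simp, ?_⟩
        have : tr.length = i := by omega
        simp [← this]
      -- The stopped run does not test this query. Writing its deterministic reply as a constant
      -- function of a verdict lets both runs share the same draw.
      · rw [if_neg hj, ← PMF.map_const (S.isForgery n k W' x)]
        refine (Lift.refl (R := Eq) fun _ _ => rfl).map fun r r' h => Or.inl ⟨rfl, rfl, rfl, ?_⟩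
        simp
        omega
  · rintro ⟨W, tr⟩ ⟨s, f⟩ ⟨h1, h2⟩ o x y r hr
    refine ⟨h1, ?_⟩
    cases o with
    | enc =>
      obtain ⟨r', hr', rfl⟩ := (mem_support_map_iff _ _ _).1 hr
      exact h2
    | dec =>
      obtain ⟨b, -, rfl⟩ := (mem_support_map_iff _ _ _).1 hr
      simp only at h2 ⊢
      rw [List.getElem?_append_left (List.getElem?_eq_some_iff.1 h2).1, h2]
  · rintro ⟨W, tr⟩ ⟨⟨⟨j, _ | z⟩, W'⟩, f⟩ ⟨h1, h2⟩ o x y r hr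
    · exact absurd rfl h1
    · have : r = ([], (((j, some z), W'), f)) := by
        cases o
        · simpa [stopOracle] using hr
        · simpa [stopOracle] using hr
      rw [this]
      exact ⟨h1, h2⟩
  · rintro ⟨x, W, tr⟩ ⟨y, ⟨⟨j, z⟩, W'⟩, f⟩ (⟨-, -, -, h⟩ | ⟨-, h⟩)
    · simp only at h
      rw [if_neg]
      · exact zero_le
      · simp only
        rw [List.getElem?_eq_none (by omega)]
        simp
    · simp only at h
      simp [h]

theorem expect_forgery_le_sum {A : Prog AEOracle} {T : ℕ}
    (hT : ∀ s ∈ (A.run (S.watchOracle n k) (Config.init [unary n] ([], []))).support, s.time ≤ T) :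
    ((A.exec (S.watchOracle n k) ([], []) [unary n]).expect fun r =>
      if true ∈ r.2.2 then 1 else 0) ≤ ∑ i ∈ Finset.range T, queryProb S A n k i := by
  refine le_trans ?_ (Finset.sum_le_sum fun i _ => watch_le_queryProb A i)
  unfold exec
  simp only [← expect_finset_sum, expect_map]
  refine expect_mono fun u hu => ?_
  split_ifs with h
  -- Each verdict costs a step, so the index of a forgery is below `T`.
  · have hlen := counter_le_time (q := fun s : List (List Bool) × List Bool => s.2.length)
      (fun s o x y r hr => by
        cases o with
        | enc =>
          obtain ⟨r', hr', rfl⟩ := (mem_support_map_iff _ _ _).1 hr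
          exact Nat.le_succ _
        | dec =>
          obtain ⟨b, -, rfl⟩ := (mem_support_map_iff _ _ _).1 hr
          simp) hu
    have hu := hT u hu
    simp only [Config.init, List.length_nil, zero_add, add_zero] at hlen
    obtain ⟨i, hi, e⟩ := List.getElem_of_mem h
    refine le_trans ?_ (Finset.single_le_sum (fun _ _ => zero_le)
      (Finset.mem_range.2 ((hi.trans_le hlen).trans_le hu)))
    rw [if_pos (List.getElem?_eq_some_iff.2 ⟨hi, e⟩)]
  · exact zero_le

/-- The adversary cannot tell decryption from rejection unless it makes a forgery. -/
theorem lift_exec_aeReal_watch (A : Prog AEOracle) (inputs : List (List Bool)) :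
    Lift (fun r₁ r₂ => r₁.1 = r₂.1 ∨ true ∈ r₂.2.2) (A.exec (S.aeRealOracle n k) [] inputs)
      (A.exec (S.watchOracle n k) ([], []) inputs) := by
  refine (lift_exec (s₁ := []) (s₂ := ([], []))
    (R := fun s₁ (s₂ : List (List Bool) × List Bool) => s₂.1 = s₁)
    (Bad := fun _ s₂ => true ∈ s₂.2) ?_ ?_ ?_ A rfl inputs).mono fun _ _ h => h.imp And.left id
  · rintro _ ⟨W, tr⟩ rfl o x y
    cases o with
    | enc => exact (Lift.map_left (R := fun a b => b.1 = a.1 ∧ a.2.1 = b.2)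
        fun r _ => ⟨rfl, rfl⟩).swap.mono fun _ _ => Or.inl
    | dec =>
      simp only [aeRealOracle, watchOracle, isForgery]
      by_cases hx : x ∈ W
      · rw [if_pos hx, if_pos hx, PMF.pure_map]
        exact Lift.pure (Or.inl ⟨rfl, rfl⟩)
      · rw [if_neg hx, if_neg hx, PMF.map_comp]
        -- Both runs share the outcome of decryption: `⊥` is the same reply in both, and a plaintext
        -- is recorded as a forgery.
        refine (Lift.refl (R := Eq) fun _ _ => rfl).map ?_
        rintro (_ | m) _ rfl
        · exact Or.inl ⟨rfl, rfl⟩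
        · exact Or.inr (by simp)
  · exact fun _ _ h _ _ _ _ _ => h
  · rintro _ ⟨W, tr⟩ h o x y r hr
    cases o with
    | enc =>
      obtain ⟨r', hr', rfl⟩ := (mem_support_map_iff _ _ _).1 hr
      exact h
    | dec =>
      obtain ⟨b, -, rfl⟩ := (mem_support_map_iff _ _ _).1 hr
      exact List.mem_append_left _ h

/-- The recorded verdicts never enter a reply, so they may be forgotten. -/
theorem aeProb_watchOracle (A : Prog AEOracle) :
    aeProb (S.watchOracle n k) ([], []) A n = aeProb (S.rejectOracle n k) [] A n := by
  refine (lift_exec_of_step (R := fun (s₁ : List (List Bool) × List Bool) s₂ => s₁.1 = s₂) ?_ A rfl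
    [unary n]).expect_eq fun a b h => by rw [h.1]
  rintro ⟨W, tr⟩ _ rfl o x y
  cases o with
  | enc => exact Lift.map_left fun r _ => ⟨rfl, rfl⟩
  | dec =>
    refine Lift.of_support fun a ha b hb => ?_
    obtain ⟨c, -, rfl⟩ := (mem_support_map_iff _ _ _).1 ha
    rw [rejectOracle, support_pure, Set.mem_singleton_iff] at hb
    rw [hb]
    exact ⟨rfl, rfl⟩

/-- Real decryption and rejection agree until a forgery is queried, and the probability of this is
at most `2 * (n + 2) ^ e` times the success of the adversary that guesses the query. -/
theorem INTCTXT.close_reject (h : S.INTCTXT) {A : Prog AEOracle} (hA : A.PolyTime) :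
    Close (fun n => (S.KeyGen n).expect fun k => aeProb (S.aeRealOracle n k) [] A n)
      (fun n => (S.KeyGen n).expect fun k => aeProb (S.rejectOracle n k) [] A n) := by
  obtain ⟨T, hT⟩ := S.exists_time_bound hA
  obtain ⟨Q, hQ⟩ := S.exists_replyBound
  obtain ⟨e, he⟩ := T.exists_eval_le_pow
  obtain ⟨B, hB, H⟩ := (guessHandler e).exists_reduction hA
  have hbad : ∀ n, ∀ k ∈ (S.KeyGen n).support,
      ((A.exec (S.watchOracle n k) ([], []) [unary n]).expect fun r =>
        if true ∈ r.2.2 then 1 else 0) ≤ ((2 * (n + 2) ^ e : ℕ) : ENNReal) * S.ctxtProb B n k :=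
    fun n k hk => (expect_forgery_le_sum (hT n k hk (fun L hL => watchOracle_length_le hL) _)).trans
      ((sum_queryProb_le (he n)).trans (mul_le_mul_right
        (expect_queryProb_le (H (realEnc_length_le (hQ n k hk)) [] (unary n))) _))
  have hsmall := (intctxt_iff.1 h B hB).polynomial_mul (2 * (Polynomial.X + 2) ^ e)
  refine ⟨_, hsmall, fun n => ?_⟩
  simp only [Polynomial.eval_mul, Polynomial.eval_pow, Polynomial.eval_add, Polynomial.eval_X,
    Polynomial.eval_ofNat, ← expect_const_mul]
  have hlift := fun k => lift_exec_aeReal_watch (S := S) (n := n) (k := k) A [unary n]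
  constructor
  · refine PMF.expect_le_add fun k hk => le_trans ?_ (add_le_add_right (hbad n k hk) _)
    rw [← aeProb_watchOracle, aeProb, aeProb, ← expect_add]
    refine (hlift k).expect_le ?_
    rintro r₁ r₂ (h | h)
    · rw [h]
      exact le_self_add
    · rw [if_pos h]
      refine le_trans ?_ le_add_self
      split_ifs <;> simp
  · refine PMF.expect_le_add fun k hk => le_trans ?_ (add_le_add_right (hbad n k hk) _)
    rw [← aeProb_watchOracle]
    refine (hlift k).swap.expect_le_add ?_
    rintro r₁ r₂ (h | h)
    · rw [h]
      exact le_self_add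
    · rw [if_pos h]
      refine le_trans ?_ le_add_self
      split_ifs <;> simp

/-- The two hops meet at `rejectOracle`: integrity removes decryption, then indistinguishability
replaces the plaintexts. -/
theorem AE.indcca3 (h : S.AE) : S.INDCCA3 := by
  refine indcca3_iff.2 fun A hA => (h.2.close_reject hA).trans ?_
  obtain ⟨B, hB, H⟩ := S.exists_randomized_distinguisher hA
  have := (indcpa_iff.1 h.1 B hB).symm
  have e1 : ∀ n, (S.KeyGen n).expect (S.cpaProb B true n) =
      (S.KeyGen n).expect fun k => aeProb (S.aeIdealOracle n k) [] A n :=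
    fun n => expect_congr fun k hk => (H n k hk).1
  have e2 : ∀ n, (S.KeyGen n).expect (S.cpaProb B false n) =
      (S.KeyGen n).expect fun k => aeProb (S.rejectOracle n k) [] A n :=
    fun n => expect_congr fun k hk => (H n k hk).2
  simpa only [e1, e2] using this

theorem UF.ae (h : S.UF) : S.AE := ⟨h.indcpa, h.intctxt⟩

end SKES

theorem mainTheorem7 (S : SKES) : (S.UF ↔ S.AE) ∧ (S.UF ↔ S.INDCCA3) :=
  ⟨⟨fun h => h.ae, fun h => h.indcca3.uf⟩, fun h => h.ae.indcca3, fun h => h.uf⟩
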